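/- Let $P$ be a pair of pants with $\pi_1(P)=\langle\alpha,\beta,\gamma\mid\alpha\beta\gamma=1\rangle$, where $\alpha,\beta,\gamma$ are the peripheral loops, and let $\delta=\alpha\gamma^{-1}$ be the figure eight curve. A framed representation is a representation $\rho:\pi_1(P)\to\mathrm{PSL}(3,\mathbb R)=\mathrm{SL}(3,\mathbb R)$ together with full flags $F_\alpha,F_\beta,F_\gamma$ of $\mathbb R^3$ fixed by $\rho(\alpha),\rho(\beta),\rho(\gamma)$. For flags $F_i=(p_i,\ell_i)$ put $$\mathsf{cr}_1=-\frac{\ell_1(p_2)\,\overline{p_1p_3}(p_4)}{\ell_1(p_4)\,\overline{p_1p_3}(p_2)},\qquad \mathsf{cr}_2=-\frac{\ell_3(p_4)\,\overline{p_1p_3}(p_2)}{\ell_3(p_2)\,\overline{p_1p_3}(p_4)},\qquad \mathsf T=\frac{\ell_1(p_2)\ell_2(p_3)\ell_3(p_1)}{\ell_1(p_3)\ell_2(p_1)\ell_3(p_2)} .$$ The Fock–Goncharov coordinates of a framed representation are, for $i=1,2$, $$\sigma_{3-i}=\mathsf{cr}_i(F_\alpha,\rho(\alpha)F_\beta,F_\gamma,F_\beta),\quad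 \sigma_{5-i}=\mathsf{cr}_i(F_\beta,\rho(\beta)F_\gamma,F_\alpha,F_\gamma),\quad \sigma_{7-i}=\mathsf{cr}_i(F_\gamma,\rho(\gamma)F_\alpha,F_\beta,F_\alpha),$$ $$\tau_1=\mathsf T(F_\alpha,F_\gamma,F_\beta),\qquad \tau_2=\mathsf T(F_\gamma,\rho(\gamma)F_\alpha,F_\beta).$$ Let $\widehat{\mathfrak C}(P)$ be the space of framed convex projective structures on $P$, that is, of framed representations all of whose coordinates are (defined and) positive, up to the action of $\mathrm{PSL}(3,\mathbb R)$; the coordinates identify it with $\mathbb R^8_{>0}$. It carries the Poisson bracket with $\{\tau_1,\tau_2\}=\{\sigma_i,\sigma_j\}=0$, $\{\sigma_i,\tau_1\}=(-1)^{i+1}2\sigma_i\tau_1$ and $\{\sigma_i,\tau_2\}=(-1)^{i}2\sigma_i\tau_2$. The Hamiltonian vector field $H_f$ of $f$ is given by $dg(H_f)=\{g,f\}$ for all $g$; a symplectic leaf is the set of all points that can be reached from a given point by finite compositions of time-one maps of Hamiltonian flows of smooth functions. For $c\in\pi_1(P)$ let $\mathsf{tr}_c$ be the function $[\rho,F]\mapsto\operatorname{tr}\rho(c)$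 on $\widehat{\mathfrak C}(P)$. A point of $\widehat{\mathfrak C}(P)$ is called hyperbolic if its holonomy $\rho$ factors, up to conjugation, through the irreducible representation $\mathrm{PSL}(2,\mathbb R)\to\mathrm{PSL}(3,\mathbb R)$, and tangentially framed hyperbolic if moreover its flags are tangent flags of the conic that this representation preserves. Theorem C. Let $\mathcal Q$ be any symplectic leaf of $\widehat{\mathfrak C}(P)$, and let $f=\mathsf{tr}_\delta+\mathsf{tr}_{\delta^{-1}}$. (1) The restriction $f|_{\mathcal Q}$ attains a unique minimum, at a point $p$. Through every point of $\mathcal Q$ there is exactly one flow line of the Hamiltonian flow of $f|_{\mathcal Q}$; it is defined for all time, stays in $\mathcal Q$ and is periodic. The point $p$ is the unique fixed point of this flow. (2) If $\mathcal Q$ contains a hyperbolic structure, then $p$ is the unique hyperbolic structure in $\mathcal Q$. (3) For $\ell_\alpha,\ell_\beta,\ell_\gamma>0$ the set $\mathcal Q_{L(F)}$ of the points with $$\sigma_1\sigma_4=\ell_\alpha,\quad \frac{\tau_1\tau_2}{\sigma_2\sigma_3}=\frac1{\ell_\alpha},\quad \sigma_3\sigma_6=\ell_\beta,\quad \frac{\tau_1\tau_2}{\sigma_4\sigma_5}=\frac1{\ell_\beta},\quad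 \sigma_2\sigma_5=\ell_\gamma,\quad \frac{\tau_1\tau_2}{\sigma_1\sigma_6}=\frac1{\ell_\gamma}$$ is a symplectic leaf, and every leaf that contains a tangentially framed hyperbolic structure is of this form. If $\mathcal Q=\mathcal Q_{L(F)}$, then $p$ is a tangentially framed hyperbolic structure, and it has the coordinates $$\sigma_1=\sigma_2=\sqrt{\frac{\ell_\alpha\ell_\gamma}{\ell_\beta}},\qquad \sigma_3=\sigma_4=\sqrt{\frac{\ell_\alpha\ell_\beta}{\ell_\gamma}},\qquad \sigma_5=\sigma_6=\sqrt{\frac{\ell_\beta\ell_\gamma}{\ell_\alpha}},\qquad \tau_1=\tau_2=1.$$ -/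

import Mathlib

open scoped LinearAlgebra.Projectivization Matrix MatrixGroups ContDiff

noncomputable section

namespace PairOfPants

/-! ### Flags in the real projective plane -/

/-- `PSL(3, ℝ)`: the centre of `SL(3, ℝ)` is trivial, so the two groups coincide, and the trace
of an element is defined. -/
abbrev PSL3 : Type := Matrix.SpecialLinearGroup (Fin 3) ℝ

/-- `PSL(2, ℝ)`. -/
abbrev PSL2 : Type := Matrix.ProjectiveSpecialLinearGroup (Fin 2) ℝ

/-- The real projective plane. It is also used for its dual: a projective line is the class of a
non-zero linear functional, written as a row vector. -/
abbrev RP2 : Type := ℙ ℝ (Fin 3 → ℝ)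

/-- The functional with kernel the projective line through `p` and `q`, namely
`v ↦ det (p, q, v)`. -/
def lineThrough (p q v : Fin 3 → ℝ) : ℝ := Matrix.det (Matrix.of ![p, q, v])

/-- A full flag of `ℝ³`: a point of the projective plane and a projective line through it. -/
@[ext]
structure Flag where
  point : RP2
  line : RP2
  incident : line.rep ⬝ᵥ point.rep = 0

/-- `F.pair G` is `ℓ_F(p_G)`, for representatives of the line of `F` and of the point of `G`. -/
def Flag.pair (F G : Flag) : ℝ := F.line.rep ⬝ᵥ G.point.rep

/-- The first cross ratio of four flags. -/
def cr₁ (F₁ F₂ F₃ F₄ : Flag) : ℝ :=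
  -((F₁.pair F₂ * lineThrough F₁.point.rep F₃.point.rep F₄.point.rep) /
    (F₁.pair F₄ * lineThrough F₁.point.rep F₃.point.rep F₂.point.rep))

/-- The second cross ratio of four flags. -/
def cr₂ (F₁ F₂ F₃ F₄ : Flag) : ℝ :=
  -((F₃.pair F₄ * lineThrough F₁.point.rep F₃.point.rep F₂.point.rep) /
    (F₃.pair F₂ * lineThrough F₁.point.rep F₃.point.rep F₄.point.rep))

/-- The triple ratio of three flags. -/
def tripleRatio (F₁ F₂ F₃ : Flag) : ℝ :=
  (F₁.pair F₂ * F₂.pair F₃ * F₃.pair F₁) / (F₁.pair F₃ * F₂.pair F₁ * F₃.pair F₂)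

lemma exists_rep_smul (g : PSL3) (x : RP2) :
    ∃ a : ℝ, a ≠ 0 ∧ (g • x).rep = a • (g.1 *ᵥ x.rep) := by
  have h1 : g • x = Projectivization.mk ℝ (g • x.rep)
      ((smul_ne_zero_iff_ne g).mpr x.rep_nonzero) := by
    conv_lhs => rw [← x.mk_rep]
    rw [Projectivization.smul_mk]
  obtain ⟨a, ha⟩ := Projectivization.exists_smul_eq_mk_rep ℝ (g • x.rep)
    ((smul_ne_zero_iff_ne g).mpr x.rep_nonzero)
  refine ⟨a, a.ne_zero, ?_⟩
  rw [h1, ← ha]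
  rfl

/-- The contragredient `g ↦ (g⁻¹)ᵀ`: row vectors are moved by `ℓ ↦ ℓ g⁻¹`. -/
def contra : PSL3 →* PSL3 where
  toFun g := (g⁻¹).transpose
  map_one' := by ext i j; simp [Matrix.one_apply, eq_comm]
  map_mul' g h := by
    apply Subtype.ext
    change ((g * h)⁻¹).1ᵀ = (g⁻¹).1ᵀ * (h⁻¹).1ᵀ
    rw [mul_inv_rev, Matrix.SpecialLinearGroup.coe_mul, Matrix.transpose_mul]

lemma contra_dot (g : PSL3) (v w : Fin 3 → ℝ) :
    ((contra g).1 *ᵥ v) ⬝ᵥ (g.1 *ᵥ w) = v ⬝ᵥ w := by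
  change ((g⁻¹).1ᵀ *ᵥ v) ⬝ᵥ (g.1 *ᵥ w) = v ⬝ᵥ w
  rw [Matrix.mulVec_transpose, ← Matrix.dotProduct_mulVec, Matrix.mulVec_mulVec,
    ← Matrix.SpecialLinearGroup.coe_mul, inv_mul_cancel, Matrix.SpecialLinearGroup.coe_one,
    Matrix.one_mulVec]

lemma exists_dot_smul (g : PSL3) (l p : RP2) :
    ∃ a b : ℝ, a ≠ 0 ∧ b ≠ 0 ∧ (contra g • l).rep = a • ((contra g).1 *ᵥ l.rep) ∧
      (g • p).rep = b • (g.1 *ᵥ p.rep) := by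
  obtain ⟨a, ha, h1⟩ := exists_rep_smul (contra g) l
  obtain ⟨b, hb, h2⟩ := exists_rep_smul g p
  exact ⟨a, b, ha, hb, h1, h2⟩

instance : MulAction PSL3 Flag where
  smul g F := ⟨g • F.point, contra g • F.line, by
    obtain ⟨a, b, -, -, h1, h2⟩ := exists_dot_smul g F.line F.point
    rw [h1, h2, smul_dotProduct, dotProduct_smul, contra_dot, F.incident]
    simp⟩
  one_smul F := by
    apply Flag.ext
    · exact one_smul _ _
    · change contra 1 • F.line = F.line
      rw [map_one, one_smul]
  mul_smul g h F := by
    apply Flag.ext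
    · exact mul_smul _ _ _
    · change contra (g * h) • F.line = contra g • contra h • F.line
      rw [map_mul, mul_smul]

lemma lineThrough_smul (g : PSL3) (a b c : ℝ) (p q v : Fin 3 → ℝ) :
    lineThrough (a • (g.1 *ᵥ p)) (b • (g.1 *ᵥ q)) (c • (g.1 *ᵥ v)) =
      a * b * c * lineThrough p q v := by
  have h : lineThrough (a • (g.1 *ᵥ p)) (b • (g.1 *ᵥ q)) (c • (g.1 *ᵥ v)) =
      a * b * c * (lineThrough p q v * g.1.det) := by
    simp only [lineThrough, Matrix.det_fin_three, Matrix.mulVec, dotProduct, Fin.sum_univ_three,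
      Matrix.of_apply, Matrix.cons_val, Pi.smul_apply, smul_eq_mul]
    ring
  rw [h, g.2, mul_one]

/-- Scaling factors of the chosen representatives under the action. -/
lemma Flag.exists_factors (g : PSL3) (F : Flag) :
    ∃ a b : ℝ, a ≠ 0 ∧ b ≠ 0 ∧ (g • F).line.rep = a • ((contra g).1 *ᵥ F.line.rep) ∧
      (g • F).point.rep = b • (g.1 *ᵥ F.point.rep) :=
  exists_dot_smul g F.line F.point

lemma cr₁_smul (g : PSL3) (F₁ F₂ F₃ F₄ : Flag) :
    cr₁ (g • F₁) (g • F₂) (g • F₃) (g • F₄) = cr₁ F₁ F₂ F₃ F₄ := by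
  obtain ⟨a₁, b₁, ha₁, hb₁, l₁, p₁⟩ := F₁.exists_factors g
  obtain ⟨a₂, b₂, ha₂, hb₂, l₂, p₂⟩ := F₂.exists_factors g
  obtain ⟨a₃, b₃, ha₃, hb₃, l₃, p₃⟩ := F₃.exists_factors g
  obtain ⟨a₄, b₄, ha₄, hb₄, l₄, p₄⟩ := F₄.exists_factors g
  simp only [cr₁, Flag.pair, l₁, p₁, p₂, p₃, p₄, smul_dotProduct, dotProduct_smul, contra_dot,
    lineThrough_smul, smul_eq_mul]
  congr 1
  rw [show ∀ x y : ℝ, b₂ * (a₁ * x) * (b₁ * b₃ * b₄ * y) = (b₂ * a₁ * b₁ * b₃ * b₄) * (x * y) by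
      intros; ring,
    show ∀ x y : ℝ, b₄ * (a₁ * x) * (b₁ * b₃ * b₂ * y) = (b₂ * a₁ * b₁ * b₃ * b₄) * (x * y) by
      intros; ring]
  exact mul_div_mul_left _ _ (by positivity)

lemma cr₂_smul (g : PSL3) (F₁ F₂ F₃ F₄ : Flag) :
    cr₂ (g • F₁) (g • F₂) (g • F₃) (g • F₄) = cr₂ F₁ F₂ F₃ F₄ := by
  obtain ⟨a₁, b₁, ha₁, hb₁, l₁, p₁⟩ := F₁.exists_factors g
  obtain ⟨a₂, b₂, ha₂, hb₂, l₂, p₂⟩ := F₂.exists_factors g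
  obtain ⟨a₃, b₃, ha₃, hb₃, l₃, p₃⟩ := F₃.exists_factors g
  obtain ⟨a₄, b₄, ha₄, hb₄, l₄, p₄⟩ := F₄.exists_factors g
  simp only [cr₂, Flag.pair, l₃, p₁, p₂, p₃, p₄, smul_dotProduct, dotProduct_smul, contra_dot,
    lineThrough_smul, smul_eq_mul]
  congr 1
  rw [show ∀ x y : ℝ, b₂ * (a₃ * x) * (b₁ * b₃ * b₄ * y) = (b₂ * a₃ * b₁ * b₃ * b₄) * (x * y) by
      intros; ring,
    show ∀ x y : ℝ, b₄ * (a₃ * x) * (b₁ * b₃ * b₂ * y) = (b₂ * a₃ * b₁ * b₃ * b₄) * (x * y) by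
      intros; ring]
  exact mul_div_mul_left _ _ (by positivity)

lemma tripleRatio_smul (g : PSL3) (F₁ F₂ F₃ : Flag) :
    tripleRatio (g • F₁) (g • F₂) (g • F₃) = tripleRatio F₁ F₂ F₃ := by
  obtain ⟨a₁, b₁, ha₁, hb₁, l₁, p₁⟩ := F₁.exists_factors g
  obtain ⟨a₂, b₂, ha₂, hb₂, l₂, p₂⟩ := F₂.exists_factors g
  obtain ⟨a₃, b₃, ha₃, hb₃, l₃, p₃⟩ := F₃.exists_factors g
  simp only [tripleRatio, Flag.pair, l₁, l₂, l₃, p₁, p₂, p₃, smul_dotProduct, dotProduct_smul,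
    contra_dot, smul_eq_mul]
  rw [show ∀ x y z : ℝ, b₂ * (a₁ * x) * (b₃ * (a₂ * y)) * (b₁ * (a₃ * z)) =
      (a₁ * a₂ * a₃ * b₁ * b₂ * b₃) * (x * y * z) by intros; ring,
    show ∀ x y z : ℝ, b₃ * (a₁ * x) * (b₁ * (a₂ * y)) * (b₂ * (a₃ * z)) =
      (a₁ * a₂ * a₃ * b₁ * b₂ * b₃) * (x * y * z) by intros; ring]
  exact mul_div_mul_left _ _ (by positivity)

/-! ### Framed representations of the fundamental group of the pair of pants -/

/-- The fundamental group `⟨α, β, γ | αβγ = 1⟩` of the pair of pants. -/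
abbrev Pi1 : Type :=
  PresentedGroup ({FreeGroup.of 0 * FreeGroup.of 1 * FreeGroup.of 2} : Set (FreeGroup (Fin 3)))

/-- The peripheral generators: `peripheral 0 = α`, `peripheral 1 = β`, `peripheral 2 = γ`. -/
def peripheral (i : Fin 3) : Pi1 := PresentedGroup.of i

/-- The peripheral loop `α`. -/
def curveα : Pi1 := peripheral 0
/-- The peripheral loop `β`. -/
def curveβ : Pi1 := peripheral 1
/-- The peripheral loop `γ`. -/
def curveγ : Pi1 := peripheral 2
/-- The figure eight curve `δ = αγ⁻¹`. -/
def curveδ : Pi1 := curveα * curveγ⁻¹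

/-- A framed representation: a representation together with, for each of the three boundary
components, a flag that is fixed by the holonomy of that boundary component. -/
@[ext]
structure FramedRep where
  ρ : Pi1 →* PSL3
  flag : Fin 3 → Flag
  fixed : ∀ i, ρ (peripheral i) • flag i = flag i

instance : MulAction PSL3 FramedRep where
  smul g R := ⟨(MulAut.conj g).toMonoidHom.comp R.ρ, fun i => g • R.flag i, fun i => by
    simp only [MonoidHom.comp_apply, MulEquiv.toMonoidHom_eq_coe, MonoidHom.coe_coe,
      MulAut.conj_apply]
    rw [mul_smul, mul_smul, inv_smul_smul, R.fixed]⟩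
  one_smul R := by
    apply FramedRep.ext
    · change (MulAut.conj (1 : PSL3)).toMonoidHom.comp R.ρ = R.ρ
      ext c : 1
      simp
    · funext i
      exact one_smul _ _
  mul_smul g h R := by
    apply FramedRep.ext
    · change (MulAut.conj (g * h)).toMonoidHom.comp R.ρ =
        (MulAut.conj g).toMonoidHom.comp ((MulAut.conj h).toMonoidHom.comp R.ρ)
      rw [map_mul]
      rfl
    · funext i
      exact mul_smul _ _ _

/-- Framed representations up to the action of `PSL(3, ℝ)`. -/
abbrev FramedClass : Type := Quotient (MulAction.orbitRel PSL3 FramedRep)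

/-- The Fock-Goncharov coordinates `(σ₁, …, σ₆, τ₁, τ₂)` of a framed representation.

The pair of pants, with its boundary components shrunk to punctures, is cut into two ideal
triangles. One of them lifts to a triangle with vertices `a`, `c`, `b` (in counterclockwise order)
fixed by `α`, `γ`, `β`. The lifts of the other one that are adjacent to it along the edges `cb`,
`ba`, `ac` have as their third vertices `γ a`, `β c`, `α b`; here `γ a = β⁻¹ a`, `β c = α⁻¹ c`
and `α b = γ⁻¹ b`. The counterclockwise orders of the vertices of the three quadrilaterals are
`a, α b, c, b` and `b, β c, a, c` and `c, γ a, b, a`. The coordinates `σ₂, σ₁` sit on the edge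
`ac`, with `σ₂` next to `a`; `σ₄, σ₃` sit on `ba`, with `σ₄` next to `b`; and `σ₆, σ₅` sit on `cb`,
with `σ₆` next to `c`. The entries `0, …, 5` are `σ₁, …, σ₆`, the entries `6, 7` are `τ₁, τ₂`. -/
def FramedRep.coord (R : FramedRep) : Fin 8 → ℝ :=
  let a := R.flag 0
  let b := R.flag 1
  let c := R.flag 2
  let a' := R.ρ curveγ • a
  let b' := R.ρ curveα • b
  let c' := R.ρ curveβ • c
  ![cr₂ a b' c b, cr₁ a b' c b,
    cr₂ b c' a c, cr₁ b c' a c,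
    cr₂ c a' b a, cr₁ c a' b a,
    tripleRatio a c b, tripleRatio c a' b]

lemma FramedRep.coord_smul (g : PSL3) (R : FramedRep) : (g • R).coord = R.coord := by
  have hf : ∀ i, (g • R).flag i = g • R.flag i := fun _ => rfl
  have hr : ∀ (x : Pi1) (F : Flag), (g • R).ρ x • g • F = g • R.ρ x • F := by
    intro x F
    change (g * R.ρ x * g⁻¹) • g • F = g • R.ρ x • F
    rw [mul_smul, mul_smul, inv_smul_smul]
  simp only [FramedRep.coord, hf, hr, cr₁_smul, cr₂_smul, tripleRatio_smul]

/-- The coordinates of a class of framed representations. -/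
def FramedClass.coord : FramedClass → Fin 8 → ℝ :=
  Quotient.lift FramedRep.coord (by
    rintro R S ⟨g, rfl⟩
    exact FramedRep.coord_smul g S)

/-- The trace function of `x ∈ π₁(P)`. -/
def FramedClass.tr (x : Pi1) : FramedClass → ℝ :=
  Quotient.lift (fun R : FramedRep => Matrix.trace (R.ρ x).1) (by
    rintro R S ⟨g, rfl⟩
    change Matrix.trace (g * S.ρ x * g⁻¹ : PSL3).1 = Matrix.trace (S.ρ x).1
    rw [Matrix.SpecialLinearGroup.coe_mul, Matrix.trace_mul_comm,
      ← Matrix.SpecialLinearGroup.coe_mul, inv_mul_cancel_left])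

/-- The deformation space of framed convex projective structures on the pair of pants, as the
space of positive framed representations: all Fock-Goncharov coordinates are defined and positive
(a coordinate with a vanishing denominator has the value `0` here, so it is not positive). -/
def FramedConvex : Type := {x : FramedClass // ∀ i, 0 < x.coord i}

/-- The Fock-Goncharov chart. -/
def coord (x : FramedConvex) : Fin 8 → ℝ := x.1.coord

/-- The trace function of a closed curve. -/
def tr (c : Pi1) (x : FramedConvex) : ℝ := x.1.tr c

/-- The symmetrized trace `tr_δ + tr_{δ⁻¹}` of the figure eight curve. -/
def symTrace (x : FramedConvex) : ℝ := tr curveδ x + tr curveδ⁻¹ x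

/-! ### The Poisson structure, Hamiltonian flows and symplectic leaves -/

/-- The open positive orthant, the image of the chart. -/
def orthant : Set (Fin 8 → ℝ) := {y | ∀ i, 0 < y i}

/-- The exchange matrix: the entry `(i, j)` is the number of arrows from `i` to `j` minus the number of arrows from `j` to `i` in
the quiver of the triangulation. -/
def exchange : Matrix (Fin 8) (Fin 8) ℝ :=
  !![ 0, 0,  0, 0,  0, 0,  1, -1;
      0, 0,  0, 0,  0, 0, -1,  1;
      0, 0,  0, 0,  0, 0,  1, -1;
      0, 0,  0, 0,  0, 0, -1,  1;
      0, 0,  0, 0,  0, 0,  1, -1;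
      0, 0,  0, 0,  0, 0, -1,  1;
     -1, 1, -1, 1, -1, 1,  0,  0;
      1, -1, 1, -1, 1, -1, 0,  0]

/-- The expression of a function in the chart (it is only used on the image of the chart). -/
def inChart (f : FramedConvex → ℝ) : (Fin 8 → ℝ) → ℝ := Function.extend coord f 0

/-- Smooth functions on the deformation space. -/
def IsSmooth (f : FramedConvex → ℝ) : Prop := ContDiffOn ℝ ∞ (inChart f) orthant

/-- The partial derivative of `f` in the direction of the `i`-th coordinate. -/
def partialDeriv (f : FramedConvex → ℝ) (x : FramedConvex) (i : Fin 8) : ℝ :=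
  fderiv ℝ (inChart f) (coord x) (Pi.single i 1)

/-- The Poisson bracket, determined by `{Xᵢ, Xⱼ} = 2 εᵢⱼ Xᵢ Xⱼ` on the coordinate functions,
where `εᵢⱼ` is the exchange matrix. -/
def poisson (f g : FramedConvex → ℝ) (x : FramedConvex) : ℝ :=
  ∑ i, ∑ j, 2 * exchange i j * coord x i * coord x j * partialDeriv f x i * partialDeriv g x j

/-- The Hamiltonian vector field of `f` in the chart, `dg (H_f) = {g, f}`: its `i`-th component is
`{Xᵢ, f}`. -/
def hamiltonianField (f : FramedConvex → ℝ) (x : FramedConvex) : Fin 8 → ℝ :=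
  fun i => poisson (fun y => coord y i) f x

/-- The curve `c` follows the Hamiltonian flow of `f` at the time `t`. -/
def FollowsAt (f : FramedConvex → ℝ) (c : ℝ → FramedConvex) (t : ℝ) : Prop :=
  HasDerivAt (fun s => coord (c s)) (hamiltonianField f (c t)) t

/-- `c` is a complete flow line of the Hamiltonian flow of `f`. On a symplectic leaf this is the
Hamiltonian flow of the restriction of `f`, for the symplectic form induced by the Poisson
structure. -/
def IsFlowLine (f : FramedConvex → ℝ) (c : ℝ → FramedConvex) : Prop := ∀ t, FollowsAt f c t

/-- `p` is a fixed point of the Hamiltonian flow of `f`. -/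
def IsFixedPoint (f : FramedConvex → ℝ) (p : FramedConvex) : Prop := IsFlowLine f (fun _ => p)

/-- `q` is the image of `p` under the time one map of the Hamiltonian flow of a smooth function. -/
def HamiltonianStep (p q : FramedConvex) : Prop :=
  ∃ f, IsSmooth f ∧ ∃ c : ℝ → FramedConvex,
    (∀ t ∈ Set.Icc (0 : ℝ) 1, FollowsAt f c t) ∧ c 0 = p ∧ c 1 = q

/-- A symplectic leaf: the set of all points that can be reached from a given point by a finite
composition of time one maps of Hamiltonian flows. -/
def IsSymplecticLeaf (Q : Set FramedConvex) : Prop :=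
  ∃ p, Q = {q | Relation.ReflTransGen HamiltonianStep p q}

/-- The Casimir functions `(ℓ_{α,1}, ℓ_{α,2}, ℓ_{β,1}, ℓ_{β,2}, ℓ_{γ,1}, ℓ_{γ,2})`. -/
def casimirs (x : FramedConvex) : Fin 6 → ℝ :=
  let σ₁ := coord x 0
  let σ₂ := coord x 1
  let σ₃ := coord x 2
  let σ₄ := coord x 3
  let σ₅ := coord x 4
  let σ₆ := coord x 5
  let τ₁ := coord x 6
  let τ₂ := coord x 7
  ![σ₁ * σ₄, τ₁ * τ₂ / (σ₂ * σ₃), σ₃ * σ₆, τ₁ * τ₂ / (σ₄ * σ₅), σ₂ * σ₅, τ₁ * τ₂ / (σ₁ * σ₆)]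

/-- The common level set `Q_L` of the Casimir functions. -/
def leafOf (L : Fin 6 → ℝ) : Set FramedConvex := {x | casimirs x = L}

/-- The length vector `L(F)` of `F = (ℓ_α, ℓ_β, ℓ_γ)`. -/
def fuchsianLengths (ℓα ℓβ ℓγ : ℝ) : Fin 6 → ℝ := ![ℓα, ℓα⁻¹, ℓβ, ℓβ⁻¹, ℓγ, ℓγ⁻¹]

/-! ### Hyperbolic structures -/

/-- The action of a `2 × 2` matrix on the coordinates `(x², xy, y²)` of the square of a vector. -/
def symSquareMatrix (g : Matrix (Fin 2) (Fin 2) ℝ) : Matrix (Fin 3) (Fin 3) ℝ :=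
  !![g 0 0 ^ 2, 2 * g 0 0 * g 0 1, g 0 1 ^ 2;
    g 0 0 * g 1 0, g 0 0 * g 1 1 + g 0 1 * g 1 0, g 0 1 * g 1 1;
    g 1 0 ^ 2, 2 * g 1 0 * g 1 1, g 1 1 ^ 2]

lemma symSquareMatrix_det (g : Matrix (Fin 2) (Fin 2) ℝ) :
    (symSquareMatrix g).det = g.det ^ 3 := by
  rw [Matrix.det_fin_three, Matrix.det_fin_two]
  simp only [symSquareMatrix, Matrix.of_apply, Matrix.cons_val]
  ring

lemma symSquareMatrix_mul (g h : Matrix (Fin 2) (Fin 2) ℝ) :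
    symSquareMatrix (g * h) = symSquareMatrix g * symSquareMatrix h := by
  ext i j
  fin_cases i <;> fin_cases j <;>
    simp [symSquareMatrix, Matrix.mul_apply, Fin.sum_univ_succ] <;> ring

/-- The symmetric square of the standard representation of `SL(2, ℝ)`. -/
def symSquare : Matrix.SpecialLinearGroup (Fin 2) ℝ →* PSL3 where
  toFun g := ⟨symSquareMatrix g.1, by rw [symSquareMatrix_det, g.2, one_pow]⟩
  map_one' := by
    apply Subtype.ext
    ext i j
    fin_cases i <;> fin_cases j <;> simp [symSquareMatrix]
  map_mul' g h := Subtype.ext (symSquareMatrix_mul g.1 h.1)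

/-- The irreducible representation `PSL(2, ℝ) → PSL(3, ℝ)`, which is unique up to conjugation. -/
def irrep : PSL2 →* PSL3 :=
  QuotientGroup.lift _ symSquare (by
    intro g hg
    obtain ⟨r, hr, hg'⟩ := Matrix.SpecialLinearGroup.mem_center_iff.mp hg
    have hr2 : r ^ 2 = 1 := by simpa using hr
    have hr2' : r * r = 1 := by rw [← hr2, sq]
    apply Subtype.ext
    change symSquareMatrix g.1 = 1
    rw [← hg']
    ext i j
    fin_cases i <;> fin_cases j <;> simp [symSquareMatrix, hr2, hr2'])

/-- A framed convex projective structure is hyperbolic if its holonomy factors, up to conjugation,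
through the irreducible representation of `PSL(2, ℝ)`. -/
def IsHyperbolic (x : FramedConvex) : Prop :=
  ∃ R : FramedRep, (⟦R⟧ : FramedClass) = x.1 ∧ ∃ ρ₀ : Pi1 →* PSL2, R.ρ = irrep.comp ρ₀

/-- The flag `F` is tangent to the invariant conic `xz = y²` of the irreducible representation:
its point is `(s², st, t²)` and its line is the tangent line there. -/
def Flag.IsTangent (F : Flag) : Prop :=
  ∃ (s t : ℝ) (h : ![s ^ 2, s * t, t ^ 2] ≠ 0) (h' : ![t ^ 2, -2 * s * t, s ^ 2] ≠ 0),
    F.point = Projectivization.mk ℝ ![s ^ 2, s * t, t ^ 2] h ∧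
    F.line = Projectivization.mk ℝ ![t ^ 2, -2 * s * t, s ^ 2] h'

/-- A hyperbolic structure whose framing consists of tangent flags of the invariant conic, that is,
of the boundary of the hyperbolic plane in the projective plane. -/
def IsTangentHyperbolic (x : FramedConvex) : Prop :=
  ∃ R : FramedRep, (⟦R⟧ : FramedClass) = x.1 ∧ (∃ ρ₀ : Pi1 →* PSL2, R.ρ = irrep.comp ρ₀) ∧
    ∀ i, (R.flag i).IsTangent

end PairOfPants

end

open PairOfPants

/-!
A positive framed representation has a normal form: after a projective change of coordinates the
points of its three flags, and their lines up to the triple ratio `τ₁`, are standard, and then the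
holonomies of `α` and `γ` are the triangular matrices `matA` and `matC`, whose entries are
polynomials in the Fock-Goncharov coordinates `y`
(`FramedRep.exists_smul_eq_normalForm`, `normalForm_coord`). So the chart is a bijection onto the
positive orthant, and every trace function is explicit.

In logarithmic coordinates the Poisson structure is constant of rank two. Its leaves are the planes
`leafMove x`, on which `σ₁, σ₃, σ₅` are multiplied by `eˢ`, `σ₂, σ₄, σ₆` by `e⁻ˢ`, `τ₁` by `eʳ` and
`τ₂` by `e⁻ʳ`; they are also the level sets of the Casimir functions (`isSymplecticLeaf_iff`,
`leafOf_casimirs`). With `z = s + i r` the Hamiltonian flow of `f` is `z' = -2 i ∇f`.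

On a leaf the symmetrized trace of the figure eight curve is a sum of exponentials
`k exp ⟪w, z⟫` with `k ≥ 0`, and the exponents `±1`, `±i` occur with positive coefficients. It is
therefore strictly convex and proper (`convexEnergy_symTrace`). It has exactly one critical point,
its minimum. The flow is complete, since it stays in a compact level curve. An orbit that does not
start at the minimum turns around it with an angular speed that is bounded away from zero, so it
meets the initial ray again after one turn. As the function is strictly increasing on rays from the
minimum, and is conserved, the orbit closes up there (`ConvexEnergy.flow_periodic`).

At a hyperbolic structure the holonomies of `α` and `γ` are symmetric squares of `a, c ∈ SL(2, ℝ)`.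
Along a leaf the traces of `ρ(α)`, `ρ(γ)`, `ρ(γα)` and of their inverses are constant. To first
order, a symmetrized trace sees only the `𝔰𝔩₂`-component of a deformation, and in `SL(2, ℝ)` the
trace of `a c⁻¹` is `tr a tr c - tr (a c)`; hence the symmetrized trace of the figure eight curve is
critical (`IsHyperbolic.leafGrad_eq_zero`), and the structure is the minimum. If moreover the flags
are tangent flags of the conic, the cross ratios on each edge agree and the triple ratios are one
(`IsTangentHyperbolic.exists_coord`). Conversely the normal forms with such coordinates consist of
symmetric squares (`isTangentHyperbolic_ofCoord`), and every leaf `Q_{L(F)}` contains exactly one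
of them.
-/

noncomputable section

/-! ### Convex Hamiltonian systems in the plane -/

namespace PlanarFlow

open Set Metric MeasureTheory intervalIntegral

open scoped InnerProductSpace NNReal

/-- A bounded Lipschitz vector field has complete integral curves. -/
theorem exists_global_of_lipschitz {E : Type*} [NormedAddCommGroup E] [NormedSpace ℝ E]
    [CompleteSpace E] {v : E → E} {K L : ℝ≥0} (hK : LipschitzWith K v) (hL : ∀ x, ‖v x‖ ≤ L)
    (x : E) : ∃ γ : ℝ → E, γ 0 = x ∧ ∀ t, HasDerivAt γ (v (γ t)) t := by
  have hex : ∀ n : ℕ, ∃ γ : ℝ → E, γ 0 = x ∧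
      ∀ t ∈ Ioo (-((n : ℝ) + 1)) ((n : ℝ) + 1), HasDerivAt γ (v (γ t)) t := by
    intro n
    have hn : (0 : ℝ) ≤ (n : ℝ) + 1 := by positivity
    have hpl : IsPicardLindelof (fun _ => v) (tmin := -((n : ℝ) + 1)) (tmax := (n : ℝ) + 1)
        ⟨0, neg_nonpos.mpr hn, hn⟩ x (L * ((n : ℝ≥0) + 1)) 0 L K := by
      apply IsPicardLindelof.of_time_independent (fun y _ => hL y) hK.lipschitzOnWith
      simp
    obtain ⟨γ, h0, h1⟩ := hpl.exists_eq_forall_mem_Icc_hasDerivWithinAt₀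
    exact ⟨γ, h0, fun t ht =>
      (h1 t (Ioo_subset_Icc_self ht)).hasDerivAt (Icc_mem_nhds ht.1 ht.2)⟩
  choose γ h0 h1 using hex
  have hagree : ∀ m n : ℕ, m ≤ n →
      EqOn (γ m) (γ n) (Ioo (-((m : ℝ) + 1)) ((m : ℝ) + 1)) := by
    intro m n hmn
    have hmn' : (m : ℝ) ≤ n := by exact_mod_cast hmn
    have hm : (0 : ℝ) < (m : ℝ) + 1 := by positivity
    refine ODE_solution_unique_of_mem_Ioo (v := fun _ => v) (s := fun _ => univ) (K := K)
      (t₀ := 0) (fun t _ => hK.lipschitzOnWith) ⟨by linarith, hm⟩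
      (fun t ht => ⟨h1 m t ht, mem_univ _⟩) (fun t ht => ⟨h1 n t ⟨?_, ?_⟩, mem_univ _⟩)
      (by rw [h0, h0])
    · linarith [ht.1]
    · linarith [ht.2]
  have hfl : ∀ t : ℝ, |t| < (⌊|t|⌋₊ : ℝ) + 1 := fun t => Nat.lt_floor_add_one _
  refine ⟨fun t => γ ⌊|t|⌋₊ t, by simp [h0], fun t => ?_⟩
  set n := ⌊|t|⌋₊ + 1 with hn
  have ht : t ∈ Ioo (-((n : ℝ) + 1)) ((n : ℝ) + 1) := by
    rw [mem_Ioo, ← abs_lt, hn]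
    push_cast
    linarith [hfl t]
  have hval : ∀ s : ℝ, |s| < (n : ℝ) → γ ⌊|s|⌋₊ s = γ n s := by
    intro s hs
    apply hagree _ _ _ (abs_lt.mp (hfl s))
    exact ((Nat.floor_lt (abs_nonneg s)).mpr hs).le
  have htn : |t| < (n : ℝ) := by rw [hn]; push_cast; exact hfl t
  have hev : (fun s => γ ⌊|s|⌋₊ s) =ᶠ[nhds t] γ n := by
    filter_upwards [continuous_abs.continuousAt.eventually_lt_const htn] with s hs
    exact hval s hs
  beta_reduce
  rw [hval t htn]
  exact (h1 n t ht).congr_of_eventuallyEq hev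

/-- A function `H` on the plane `ℂ` with gradient `grad` that is strictly convex (the gradient is
strictly monotone) and whose sublevel sets are bounded. -/
structure ConvexEnergy (H : ℂ → ℝ) (grad : ℂ → ℂ) : Prop where
  contDiff : ContDiff ℝ 1 grad
  hasFDerivAt : ∀ z, HasFDerivAt H (innerSL ℝ (grad z)) z
  monotone : ∀ z w, z ≠ w → 0 < ⟪grad z - grad w, z - w⟫_ℝ
  bounded : ∀ C, ∃ R, ∀ z, H z ≤ C → ‖z‖ ≤ R

/-- The curve `z` follows the Hamiltonian flow `s' = 2 ∂H/∂r`, `r' = -2 ∂H/∂s` on the plane with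
coordinate `s + i r`. -/
def IsFlow (grad : ℂ → ℂ) (z : ℝ → ℂ) : Prop :=
  ∀ t, HasDerivAt z (-2 * Complex.I * grad (z t)) t

namespace ConvexEnergy

variable {H : ℂ → ℝ} {grad : ℂ → ℂ}

theorem continuous (h : ConvexEnergy H grad) : Continuous H :=
  continuous_iff_continuousAt.mpr fun z => (h.hasFDerivAt z).continuousAt

theorem exists_grad_eq_zero (h : ConvexEnergy H grad) : ∃ p, grad p = 0 := by
  obtain ⟨R, hR⟩ := h.bounded (H 0)
  obtain ⟨p, hp⟩ := h.continuous.exists_forall_le' 0 (by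
    filter_upwards [(isCompact_closedBall (0 : ℂ) R).compl_mem_cocompact] with x hx
    by_contra hlt
    exact hx (mem_closedBall_zero_iff.mpr (hR x (not_le.mp hlt).le)))
  have h0 : innerSL ℝ (grad p) = 0 :=
    IsLocalMin.hasFDerivAt_eq_zero (Filter.Eventually.of_forall hp) (h.hasFDerivAt p)
  refine ⟨p, inner_self_eq_zero (𝕜 := ℝ).mp ?_⟩
  simpa using congrArg (fun L => L (grad p)) h0

theorem ray_lt (h : ConvexEnergy H grad) {p v : ℂ} (hp : grad p = 0) (hv : v ≠ 0) {l m : ℝ}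
    (hl : 0 ≤ l) (hlm : l < m) : H (p + l * v) < H (p + m * v) := by
  have hd : ∀ x : ℝ, HasDerivAt (fun x : ℝ => H (p + x * v)) ⟪grad (p + x * v), v⟫_ℝ x := by
    intro x
    have h1 : HasDerivAt (fun x : ℝ => p + (x : ℂ) * v) v x := by
      simpa using (Complex.ofRealCLM.hasDerivAt.mul_const v).const_add p
    exact (h.hasFDerivAt (p + x * v)).comp_hasDerivAt x h1
  obtain ⟨x, hx, hxe⟩ := exists_hasDerivAt_eq_slope (fun x : ℝ => H (p + x * v)) _ hlm
    (fun x _ => (hd x).continuousAt.continuousWithinAt) (fun x _ => hd x)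
  have hx0 : 0 < x := lt_of_le_of_lt hl hx.1
  have hne : p + x * v ≠ p := by
    simpa [hv] using hx0.ne'
  have hpos := h.monotone _ _ hne
  rw [hp, sub_zero, add_sub_cancel_left, ← Complex.real_smul, real_inner_smul_right] at hpos
  have hpos' : 0 < ⟪grad (p + x * v), v⟫_ℝ := by
    rw [← Complex.real_smul]
    exact pos_of_mul_pos_right hpos hx0.le
  rw [hxe] at hpos'
  have := (div_pos_iff_of_pos_right (sub_pos.mpr hlm)).mp hpos'
  linarith

theorem lt_of_ne (h : ConvexEnergy H grad) {p q : ℂ} (hp : grad p = 0) (hq : q ≠ p) :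
    H p < H q := by
  simpa using h.ray_lt hp (sub_ne_zero.mpr hq) le_rfl zero_lt_one

theorem eq_of_grad_eq_zero (h : ConvexEnergy H grad) {p q : ℂ} (hp : grad p = 0)
    (hq : grad q = 0) : q = p := by
  by_contra hne
  have := h.monotone q p hne
  simp [hp, hq] at this

theorem inner_I_mul (w : ℂ) (c : ℝ) : ⟪w, c * Complex.I * w⟫_ℝ = 0 := by
  simp [Complex.inner, Complex.mul_re, Complex.mul_im]
  ring

/-- The energy is conserved, even when the speed of the flow is changed by a factor `χ`. -/
theorem conserved (h : ConvexEnergy H grad) {z : ℝ → ℂ} {χ : ℂ → ℝ}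
    (hz : ∀ t, HasDerivAt z (χ (z t) • (-2 * Complex.I * grad (z t))) t) (t : ℝ) :
    H (z t) = H (z 0) := by
  have hd : ∀ t, HasDerivAt (fun t => H (z t)) 0 t := by
    intro t
    have := (h.hasFDerivAt (z t)).comp_hasDerivAt t (hz t)
    have e : (innerSL ℝ (grad (z t))) (χ (z t) • (-2 * Complex.I * grad (z t))) = 0 := by
      rw [innerSL_apply_apply, real_inner_smul_right]
      have := inner_I_mul (grad (z t)) (-2)
      push_cast at this
      rw [this, mul_zero]
    rwa [e] at this
  exact is_const_of_deriv_eq_zero (fun t => (hd t).differentiableAt) (fun t => (hd t).deriv) t 0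

theorem flow_conserved (h : ConvexEnergy H grad) {z : ℝ → ℂ} (hz : IsFlow grad z) (t : ℝ) :
    H (z t) = H (z 0) :=
  h.conserved (χ := fun _ => 1) (fun t => by simpa using hz t) t

theorem flow_unique (h : ConvexEnergy H grad) {z w : ℝ → ℂ} (hz : IsFlow grad z)
    (hw : IsFlow grad w) {t₀ : ℝ} (h0 : z t₀ = w t₀) : z = w := by
  obtain ⟨R, hR⟩ := h.bounded (H (z t₀))
  have hV : ContDiff ℝ 1 (fun x => -2 * Complex.I * grad x) := contDiff_const.mul h.contDiff
  obtain ⟨K, hK⟩ := hV.contDiffOn.exists_lipschitzOnWith (s := closedBall 0 R) one_ne_zero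
    (convex_closedBall 0 R) (isCompact_closedBall 0 R)
  refine ODE_solution_unique_univ (v := fun _ x => -2 * Complex.I * grad x)
    (s := fun _ => closedBall 0 R) (fun _ => hK) (fun t => ⟨hz t, ?_⟩) (fun t => ⟨hw t, ?_⟩) h0
  · rw [mem_closedBall_zero_iff]
    exact hR _ (by rw [h.flow_conserved hz t, h.flow_conserved hz t₀])
  · rw [mem_closedBall_zero_iff]
    exact hR _ (by rw [h0, h.flow_conserved hw t, h.flow_conserved hw t₀])

theorem exists_flow (h : ConvexEnergy H grad) (q : ℂ) :
    ∃ z : ℝ → ℂ, z 0 = q ∧ IsFlow grad z := by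
  obtain ⟨R, hR⟩ := h.bounded (H q)
  -- the field is cut off outside a ball that contains the sublevel set of `q`
  have hR0 : 0 ≤ R := (norm_nonneg q).trans (hR q le_rfl)
  let χ : ContDiffBump (0 : ℂ) := ⟨R + 1, R + 2, by linarith, by linarith⟩
  have hV : ContDiff ℝ 1 (fun x => χ x • (-2 * Complex.I * grad x)) :=
    χ.contDiff.smul (contDiff_const.mul h.contDiff)
  have hc : HasCompactSupport (fun x => χ x • (-2 * Complex.I * grad x)) :=
    χ.hasCompactSupport.smul_right
  obtain ⟨K, hK⟩ := ContDiff.lipschitzWith_of_hasCompactSupport hc hV one_ne_zero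
  obtain ⟨L, hL⟩ := hc.exists_bound_of_continuous hV.continuous
  obtain ⟨z, hz0, hz⟩ := exists_global_of_lipschitz (L := L.toNNReal) hK
    (fun x => (hL x).trans (Real.le_coe_toNNReal L)) q
  refine ⟨z, hz0, fun t => ?_⟩
  have h1 : χ (z t) = 1 := by
    apply χ.one_of_mem_closedBall
    rw [mem_closedBall_zero_iff]
    have := hR (z t) (by rw [h.conserved hz t, hz0])
    change _ ≤ R + 1
    linarith
  simpa [h1] using hz t

/-- Around the critical point `p` an orbit turns clockwise, with an angular velocity that is bounded
away from zero by compactness of the energy level. When it has made one turn it is on the same ray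
from `p`, and it is at the same point since the energy increases along rays. -/
theorem flow_periodic (h : ConvexEnergy H grad) {z : ℝ → ℂ} (hz : IsFlow grad z) :
    ∃ T, 0 < T ∧ Function.Periodic z T := by
  obtain ⟨p, hp⟩ := h.exists_grad_eq_zero
  suffices hret : ∃ T, 0 < T ∧ z T = z 0 by
    obtain ⟨T, hT, hzT⟩ := hret
    refine ⟨T, hT, fun t => ?_⟩
    have hs : IsFlow grad (fun t => z (t + T)) := fun t => (hz (t + T)).comp_add_const t T
    exact congrFun (h.flow_unique hs hz (t₀ := 0) (by simpa using hzT)) t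
  by_cases h0 : z 0 = p
  · refine ⟨1, one_pos, ?_⟩
    by_contra hne
    have h1 := h.lt_of_ne hp (fun e => hne (e.trans h0.symm))
    rw [h.flow_conserved hz 1, h0] at h1
    exact lt_irrefl _ h1
  have hne : ∀ t, z t - p ≠ 0 := by
    intro t e
    have := h.lt_of_ne hp h0
    rw [← h.flow_conserved hz t, sub_eq_zero.mp e] at this
    exact lt_irrefl _ this
  have hzc : Continuous z := continuous_iff_continuousAt.mpr fun t => (hz t).continuousAt
  let θ : ℂ → ℂ := fun x => -2 * Complex.I * grad x / (x - p)
  have hφc : Continuous (fun t => θ (z t)) :=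
    ((continuous_const.mul (h.contDiff.continuous.comp hzc))).div (hzc.sub continuous_const) hne
  let Φ : ℝ → ℂ := fun t => ∫ s in (0 : ℝ)..t, θ (z s)
  have hΦ : ∀ t, HasDerivAt Φ (θ (z t)) t := fun t =>
    intervalIntegral.integral_hasDerivAt_right (hφc.intervalIntegrable _ _)
      (hφc.stronglyMeasurableAtFilter _ _) hφc.continuousAt
  have hΦ0 : Φ 0 = 0 := intervalIntegral.integral_same
  have hexp : ∀ t, z t - p = (z 0 - p) * Complex.exp (Φ t) := by
    have hd : ∀ t, HasDerivAt (fun t => (z t - p) * Complex.exp (-Φ t)) 0 t := by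
      intro t
      have h1 := ((hz t).sub_const p).mul ((hΦ t).neg.cexp)
      have e : -2 * Complex.I * grad (z t) * Complex.exp (-Φ t) +
          (z t - p) * (Complex.exp (-Φ t) * -θ (z t)) = 0 := by
        have := hne t
        simp only [θ]
        field_simp
        ring
      exact e ▸ h1
    intro t
    have := is_const_of_deriv_eq_zero (fun t => (hd t).differentiableAt)
      (fun t => (hd t).deriv) t 0
    simp only [hΦ0, neg_zero, Complex.exp_zero, mul_one] at this
    rw [← this, mul_assoc, ← Complex.exp_add, neg_add_cancel, Complex.exp_zero, mul_one]
  -- the angular velocity is at most `-ε`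
  obtain ⟨ε, hε, hθ⟩ : ∃ ε > 0, ∀ t, (θ (z t)).im ≤ -ε := by
    obtain ⟨R, hR⟩ := h.bounded (H (z 0))
    have hcpt : IsCompact {x | H x = H (z 0)} :=
      (isCompact_closedBall (0 : ℂ) R).of_isClosed_subset
        (isClosed_singleton.preimage h.continuous)
        (fun x hx => by rw [mem_closedBall_zero_iff]; exact hR x (le_of_eq hx))
    have hnp : ∀ x ∈ {x | H x = H (z 0)}, x - p ≠ 0 := by
      intro x hx e
      have := h.lt_of_ne hp h0
      rw [← (show H x = H (z 0) from hx), sub_eq_zero.mp e] at this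
      exact lt_irrefl _ this
    have hcont : ContinuousOn (fun x => (θ x).im) {x | H x = H (z 0)} :=
      Complex.continuous_im.comp_continuousOn
        (((continuous_const.mul h.contDiff.continuous).continuousOn).div
          (continuous_id.sub continuous_const).continuousOn hnp)
    obtain ⟨m, hm, hmax⟩ := hcpt.exists_isMaxOn ⟨z 0, rfl⟩ hcont
    refine ⟨-(θ m).im, ?_, fun t => by
      simpa using hmax (show z t ∈ _ from h.flow_conserved hz t)⟩
    have hpos := h.monotone m p (sub_ne_zero.mp (hnp m hm))
    have e : (θ m).im = -2 * ⟪grad m - grad p, m - p⟫_ℝ / Complex.normSq (m - p) := by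
      rw [hp, sub_zero]
      simp only [θ, Complex.div_im, Complex.inner]
      simp [Complex.mul_re, Complex.mul_im]
      ring
    have hn : 0 < Complex.normSq (m - p) := Complex.normSq_pos.mpr (hnp m hm)
    rw [e, gt_iff_lt, neg_pos]
    apply div_neg_of_neg_of_pos _ hn
    linarith
  have hle : ∀ t, 0 ≤ t → (Φ t).im ≤ -ε * t := by
    have hmon : Antitone (fun t => (Φ t).im + ε * t) := by
      apply antitone_of_hasDerivAt_nonpos (f' := fun t => (θ (z t)).im + ε * 1)
      · intro t
        exact (Complex.imCLM.hasFDerivAt.comp_hasDerivAt t (hΦ t)).add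
          ((hasDerivAt_id t).const_mul ε)
      · intro t
        have := hθ t
        simp
        linarith
    intro t ht
    have := hmon ht
    simp [hΦ0] at this
    linarith
  have hΦc : Continuous (fun t => (Φ t).im) :=
    Complex.continuous_im.comp (continuous_iff_continuousAt.mpr fun t => (hΦ t).continuousAt)
  obtain ⟨T, hT, hTe⟩ : ∃ T ∈ Icc 0 (2 * Real.pi / ε), (Φ T).im = -(2 * Real.pi) := by
    have h2 : 0 ≤ 2 * Real.pi / ε := by positivity
    have hsub := intermediate_value_Icc' h2 hΦc.continuousOn
    apply hsub
    refine ⟨(hle _ h2).trans (le_of_eq (by field_simp)), ?_⟩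
    simp only [hΦ0, Complex.zero_im]
    linarith [Real.pi_pos]
  have hT0 : T ≠ 0 := by
    rintro rfl
    rw [hΦ0] at hTe
    simp at hTe
  refine ⟨T, lt_of_le_of_ne hT.1 hT0.symm, ?_⟩
  set l := Real.exp (Φ T).re with hl
  have hray : z T = p + l * (z 0 - p) := by
    have e1 : Complex.exp (Φ T) = l := by
      have e2 : Φ T = ((Φ T).re : ℂ) + (-1 : ℤ) * (2 * Real.pi * Complex.I) := by
        apply Complex.ext <;> simp [hTe]
      rw [e2, Complex.exp_add, Complex.exp_int_mul_two_pi_mul_I, mul_one, hl, Complex.ofReal_exp]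
    rw [← e1, mul_comm, ← hexp T]
    ring
  have hE := h.flow_conserved hz T
  have hv : z 0 - p ≠ 0 := hne 0
  have hz1 : z 0 = p + (1 : ℝ) * (z 0 - p) := by simp
  rcases lt_trichotomy l 1 with hlt | heq | hgt
  · have := h.ray_lt hp hv (Real.exp_pos _).le hlt
    rw [← hray, ← hz1, hE] at this
    exact absurd this (lt_irrefl _)
  · rw [hray, heq, ← hz1]
  · have := h.ray_lt hp hv zero_le_one hgt
    rw [← hray, ← hz1, hE] at this
    exact absurd this (lt_irrefl _)

end ConvexEnergy

end PlanarFlow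

end

noncomputable section

/-! ### Sums of exponentials with positive coefficients -/

namespace PlanarFlow

open Complex (I)

open scoped InnerProductSpace

/-- A finite sum of real exponentials of linear forms on the plane, with coefficients `≥ 0`. -/
def IsExpSum (f : ℂ → ℝ) : Prop :=
  ∃ (ι : Type) (_ : Fintype ι) (c : ι → ℝ) (w : ι → ℂ), (∀ i, 0 ≤ c i) ∧
    ∀ z, f z = ∑ i, c i * Real.exp ⟪w i, z⟫_ℝ

theorem IsExpSum.monomial {c : ℝ} (hc : 0 ≤ c) (w : ℂ) :
    IsExpSum (fun z => c * Real.exp ⟪w, z⟫_ℝ) :=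
  ⟨Unit, inferInstance, fun _ => c, fun _ => w, fun _ => hc, fun z => by simp⟩

theorem IsExpSum.const {c : ℝ} (hc : 0 ≤ c) : IsExpSum (fun _ => c) := by
  simpa using IsExpSum.monomial hc 0

theorem IsExpSum.add {f g : ℂ → ℝ} (hf : IsExpSum f) (hg : IsExpSum g) :
    IsExpSum (fun z => f z + g z) := by
  obtain ⟨ι, _, c, w, hc, hf⟩ := hf
  obtain ⟨κ, _, d, v, hd, hg⟩ := hg
  refine ⟨ι ⊕ κ, inferInstance, Sum.elim c d, Sum.elim w v, ?_, fun z => ?_⟩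
  · rintro (i | i)
    · exact hc i
    · exact hd i
  · simp [hf, hg]

theorem IsExpSum.mul {f g : ℂ → ℝ} (hf : IsExpSum f) (hg : IsExpSum g) :
    IsExpSum (fun z => f z * g z) := by
  obtain ⟨ι, _, c, w, hc, hf⟩ := hf
  obtain ⟨κ, _, d, v, hd, hg⟩ := hg
  refine ⟨ι × κ, inferInstance, fun i => c i.1 * d i.2, fun i => w i.1 + v i.2,
    fun i => mul_nonneg (hc _) (hd _), fun z => ?_⟩
  beta_reduce
  rw [hf, hg, Finset.sum_mul_sum, Fintype.sum_prod_type]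
  refine Finset.sum_congr rfl fun i _ => Finset.sum_congr rfl fun j _ => ?_
  rw [inner_add_left, Real.exp_add]
  ring

/-- The summands with exponents `±1`, `±i` make a positive sum of exponentials strictly convex, with
bounded sublevel sets. -/
theorem ConvexEnergy.of_sum_exp {ι : Type} [Fintype ι] {c : ι → ℝ} {w : ι → ℂ}
    (hc : ∀ i, 0 ≤ c i)
    (hw : ∀ u : ℂ, u = 1 ∨ u = -1 ∨ u = I ∨ u = -I → ∃ i, 0 < c i ∧ w i = u) :
    ConvexEnergy (fun z => ∑ i, c i * Real.exp ⟪w i, z⟫_ℝ)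
      (fun z => ∑ i, (c i * Real.exp ⟪w i, z⟫_ℝ) • w i) where
  contDiff := by
    refine ContDiff.sum fun i _ => ContDiff.smul (contDiff_const.mul (Real.contDiff_exp.comp ?_))
      contDiff_const
    exact (innerSL ℝ (w i)).contDiff
  hasFDerivAt z := by
    have h : ∀ i, HasFDerivAt (fun z => c i * Real.exp ⟪w i, z⟫_ℝ)
        (c i • (Real.exp ⟪w i, z⟫_ℝ • innerSL ℝ (w i))) z := fun i =>
      (((innerSL ℝ (w i)).hasFDerivAt (x := z)).exp).const_mul (c i)
    refine (HasFDerivAt.fun_sum (u := Finset.univ) (fun i _ => h i)).congr_fderiv ?_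
    ext1 v
    simp only [sum_apply, smul_apply, innerSL_apply_apply,
      sum_inner, real_inner_smul_left, smul_eq_mul, mul_assoc]
  monotone z v hne := by
    have hterm : ∀ i, ⟪(c i * Real.exp ⟪w i, z⟫_ℝ) • w i - (c i * Real.exp ⟪w i, v⟫_ℝ) • w i,
        z - v⟫_ℝ =
        c i * ((Real.exp ⟪w i, z⟫_ℝ - Real.exp ⟪w i, v⟫_ℝ) * (⟪w i, z⟫_ℝ - ⟪w i, v⟫_ℝ)) := by
      intro i
      rw [← sub_smul, real_inner_smul_left, inner_sub_right]
      ring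
    have hpos : ∀ a b : ℝ, a ≠ b → 0 < (Real.exp a - Real.exp b) * (a - b) := by
      intro a b hab
      rcases lt_or_gt_of_ne hab with h | h
      · exact mul_pos_of_neg_of_neg (sub_neg.mpr (Real.exp_lt_exp.mpr h)) (sub_neg.mpr h)
      · exact mul_pos (sub_pos.mpr (Real.exp_lt_exp.mpr h)) (sub_pos.mpr h)
    have hnn : ∀ a b : ℝ, 0 ≤ (Real.exp a - Real.exp b) * (a - b) := by
      intro a b
      rcases eq_or_ne a b with rfl | h
      · simp
      · exact (hpos a b h).le
    rw [← Finset.sum_sub_distrib, sum_inner]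
    simp only [hterm]
    obtain ⟨i, hi, hiw⟩ : ∃ i, 0 < c i ∧ ⟪w i, z⟫_ℝ ≠ ⟪w i, v⟫_ℝ := by
      by_cases hre : z.re = v.re
      · obtain ⟨i, hi, hiw⟩ := hw I (by simp)
        refine ⟨i, hi, fun e => hne (Complex.ext hre ?_)⟩
        simpa [hiw, Complex.inner] using e
      · obtain ⟨i, hi, hiw⟩ := hw 1 (by simp)
        refine ⟨i, hi, fun e => hre ?_⟩
        simpa [hiw, Complex.inner] using e
    exact Finset.sum_pos' (fun j _ => mul_nonneg (hc j) (hnn _ _))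
      ⟨i, Finset.mem_univ i, mul_pos hi (hpos _ _ hiw)⟩
  bounded C := by
    have hle : ∀ u : ℂ, u = 1 ∨ u = -1 ∨ u = I ∨ u = -I → ∃ R : ℝ, ∀ z : ℂ,
        ∑ i, c i * Real.exp ⟪w i, z⟫_ℝ ≤ C → ⟪u, z⟫_ℝ ≤ R := by
      intro u hu
      obtain ⟨i, hi, rfl⟩ := hw u hu
      refine ⟨C / c i, fun z hz => ?_⟩
      have h1 : c i * Real.exp ⟪w i, z⟫_ℝ ≤ C :=
        (Finset.single_le_sum (f := fun i => c i * Real.exp ⟪w i, z⟫_ℝ)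
          (fun j _ => mul_nonneg (hc j) (Real.exp_pos _).le) (Finset.mem_univ i)).trans hz
      rw [le_div_iff₀' hi]
      refine le_trans ?_ h1
      gcongr
      linarith [Real.add_one_le_exp ⟪w i, z⟫_ℝ]
    obtain ⟨R₁, h₁⟩ := hle 1 (by simp)
    obtain ⟨R₂, h₂⟩ := hle (-1) (by simp)
    obtain ⟨R₃, h₃⟩ := hle I (by simp)
    obtain ⟨R₄, h₄⟩ := hle (-I) (by simp)
    refine ⟨max R₁ R₂ + max R₃ R₄, fun z hz => ?_⟩
    have e₁ := h₁ z hz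
    have e₂ := h₂ z hz
    have e₃ := h₃ z hz
    have e₄ := h₄ z hz
    simp [Complex.inner] at e₁ e₂ e₃ e₄
    refine (Complex.norm_le_abs_re_add_abs_im z).trans (add_le_add ?_ ?_)
    · exact abs_le'.mpr ⟨le_max_of_le_left e₁, le_max_of_le_right (by linarith)⟩
    · exact abs_le'.mpr ⟨le_max_of_le_left e₃, le_max_of_le_right (by linarith)⟩

theorem IsExpSum.exists_convexEnergy {f g : ℂ → ℝ} (hg : IsExpSum g) {k₁ k₂ k₃ k₄ : ℝ}
    (h₁ : 0 < k₁) (h₂ : 0 < k₂) (h₃ : 0 < k₃) (h₄ : 0 < k₄)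
    (hf : ∀ z, f z = k₁ * Real.exp z.re + k₂ * Real.exp (-z.re) + k₃ * Real.exp z.im +
      k₄ * Real.exp (-z.im) + g z) :
    ∃ grad, ConvexEnergy f grad := by
  obtain ⟨κ, _, d, v, hd, hg⟩ := hg
  have key := ConvexEnergy.of_sum_exp (c := Sum.elim ![k₁, k₂, k₃, k₄] d)
    (w := Sum.elim ![1, -1, I, -I] v) (by
      rintro (i | i)
      · fin_cases i
        exacts [h₁.le, h₂.le, h₃.le, h₄.le]
      · exact hd i) (by
      rintro u (rfl | rfl | rfl | rfl)
      exacts [⟨Sum.inl 0, h₁, rfl⟩, ⟨Sum.inl 1, h₂, rfl⟩, ⟨Sum.inl 2, h₃, rfl⟩,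
        ⟨Sum.inl 3, h₄, rfl⟩])
  have hfe : f = _ := funext fun z => show f z = ∑ i, (Sum.elim ![k₁, k₂, k₃, k₄] d) i *
      Real.exp ⟪(Sum.elim ![1, -1, I, -I] v) i, z⟫_ℝ by
    rw [hf, hg, Fintype.sum_sum_type, Fin.sum_univ_four]
    simp [Complex.inner]
  exact ⟨_, hfe ▸ key⟩

end PlanarFlow

end

noncomputable section

/-! ### Representatives of flags -/

namespace PairOfPants

/-- The vector `p` represents the point of the flag `F`. -/
def Flag.RepPt (F : Flag) (p : Fin 3 → ℝ) : Prop := ∃ a : ℝ, a ≠ 0 ∧ F.point.rep = a • p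

/-- The row vector `l` represents the line of the flag `F`. -/
def Flag.RepLn (F : Flag) (l : Fin 3 → ℝ) : Prop := ∃ a : ℝ, a ≠ 0 ∧ F.line.rep = a • l

theorem Flag.repPt_self (F : Flag) : F.RepPt F.point.rep := ⟨1, one_ne_zero, (one_smul _ _).symm⟩

theorem Flag.repLn_self (F : Flag) : F.RepLn F.line.rep := ⟨1, one_ne_zero, (one_smul _ _).symm⟩

theorem Flag.RepPt.unique {F : Flag} {p q : Fin 3 → ℝ} (h : F.RepPt p) (h' : F.RepPt q) :
    ∃ k : ℝ, k ≠ 0 ∧ q = k • p := by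
  obtain ⟨a, ha, h⟩ := h
  obtain ⟨b, hb, h'⟩ := h'
  exact ⟨b⁻¹ * a, mul_ne_zero (inv_ne_zero hb) ha, by
    rw [mul_smul, ← h, h', smul_smul, inv_mul_cancel₀ hb, one_smul]⟩

theorem Flag.RepLn.unique {F : Flag} {p q : Fin 3 → ℝ} (h : F.RepLn p) (h' : F.RepLn q) :
    ∃ k : ℝ, k ≠ 0 ∧ q = k • p := by
  obtain ⟨a, ha, h⟩ := h
  obtain ⟨b, hb, h'⟩ := h'
  exact ⟨b⁻¹ * a, mul_ne_zero (inv_ne_zero hb) ha, by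
    rw [mul_smul, ← h, h', smul_smul, inv_mul_cancel₀ hb, one_smul]⟩

theorem RP2.eq_of_rep {x y : RP2} {p : Fin 3 → ℝ} {a b : ℝ} (hb : b ≠ 0)
    (hx : x.rep = a • p) (hy : y.rep = b • p) : x = y := by
  rw [← x.mk_rep, ← y.mk_rep, Projectivization.mk_eq_mk_iff']
  exact ⟨a * b⁻¹, by rw [hx, hy, smul_smul, mul_assoc, inv_mul_cancel₀ hb, mul_one]⟩

theorem Flag.eq_of_rep {F G : Flag} {p l : Fin 3 → ℝ} (hF : F.RepPt p) (hF' : F.RepLn l)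
    (hG : G.RepPt p) (hG' : G.RepLn l) : F = G := by
  obtain ⟨a, -, hF⟩ := hF
  obtain ⟨b, hb, hG⟩ := hG
  obtain ⟨c, -, hF'⟩ := hF'
  obtain ⟨d, hd, hG'⟩ := hG'
  exact Flag.ext (RP2.eq_of_rep hb hF hG) (RP2.eq_of_rep hd hF' hG')

theorem RP2.rep_mk (p : Fin 3 → ℝ) (hp : p ≠ 0) :
    ∃ a : ℝ, a ≠ 0 ∧ (Projectivization.mk ℝ p hp).rep = a • p := by
  obtain ⟨a, ha⟩ := Projectivization.exists_smul_eq_mk_rep ℝ p hp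
  exact ⟨a, a.ne_zero, ha.symm⟩

/-- The flag with given representatives of its point and its line. -/
def Flag.ofVec (p l : Fin 3 → ℝ) (hp : p ≠ 0) (hl : l ≠ 0) (h : l ⬝ᵥ p = 0) : Flag where
  point := Projectivization.mk ℝ p hp
  line := Projectivization.mk ℝ l hl
  incident := by
    obtain ⟨a, -, ha⟩ := RP2.rep_mk p hp
    obtain ⟨b, -, hb⟩ := RP2.rep_mk l hl
    rw [ha, hb, smul_dotProduct, dotProduct_smul, h, smul_zero, smul_zero]

theorem Flag.ofVec_repPt {p l : Fin 3 → ℝ} (hp : p ≠ 0) (hl : l ≠ 0) (h : l ⬝ᵥ p = 0) :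
    (Flag.ofVec p l hp hl h).RepPt p := RP2.rep_mk p hp

theorem Flag.ofVec_repLn {p l : Fin 3 → ℝ} (hp : p ≠ 0) (hl : l ≠ 0) (h : l ⬝ᵥ p = 0) :
    (Flag.ofVec p l hp hl h).RepLn l := RP2.rep_mk l hl

theorem Flag.RepPt.smul {F : Flag} {p q : Fin 3 → ℝ} (h : F.RepPt p) (g : PSL3) {k : ℝ}
    (hk : k ≠ 0) (e : g.1 *ᵥ p = k • q) : (g • F).RepPt q := by
  obtain ⟨a, ha, h⟩ := h
  obtain ⟨-, b, -, hb, -, hg⟩ := F.exists_factors g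
  exact ⟨b * a * k, by positivity, by
    rw [hg, h, Matrix.mulVec_smul, e, smul_smul, smul_smul, mul_assoc]⟩

theorem contra_mulVec_vecMul (g : PSL3) (l : Fin 3 → ℝ) : (contra g).1 *ᵥ (l ᵥ* g.1) = l := by
  change ((g⁻¹).1ᵀ *ᵥ (l ᵥ* g.1)) = l
  rw [Matrix.mulVec_transpose, Matrix.vecMul_vecMul, ← Matrix.SpecialLinearGroup.coe_mul,
    mul_inv_cancel, Matrix.SpecialLinearGroup.coe_one, Matrix.vecMul_one]

theorem Flag.RepLn.smul {F : Flag} {l m : Fin 3 → ℝ} (h : F.RepLn l) (g : PSL3) {k : ℝ}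
    (hk : k ≠ 0) (e : m ᵥ* g.1 = k • l) : (g • F).RepLn m := by
  obtain ⟨a, ha, h⟩ := h
  obtain ⟨b, -, hb, -, hg, -⟩ := F.exists_factors g
  refine ⟨b * a * k⁻¹, by positivity, ?_⟩
  have e' : l = k⁻¹ • (m ᵥ* g.1) := by rw [e, smul_smul, inv_mul_cancel₀ hk, one_smul]
  rw [hg, h, e', Matrix.mulVec_smul, Matrix.mulVec_smul, contra_mulVec_vecMul, smul_smul,
    smul_smul, mul_assoc]

theorem Flag.RepPt.mulVec {F : Flag} {p : Fin 3 → ℝ} (h : F.RepPt p) (g : PSL3) :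
    (g • F).RepPt (g.1 *ᵥ p) :=
  h.smul g one_ne_zero (one_smul _ _).symm

theorem Flag.RepPt.inv_smul {F : Flag} {p q : Fin 3 → ℝ} (h : F.RepPt p) (g : PSL3) {k : ℝ}
    (hk : k ≠ 0) (e : g.1 *ᵥ q = k • p) : (g⁻¹ • F).RepPt q := by
  refine h.smul g⁻¹ (inv_ne_zero hk) ?_
  have e' : p = k⁻¹ • (g.1 *ᵥ q) := by rw [e, smul_smul, inv_mul_cancel₀ hk, one_smul]
  rw [e', Matrix.mulVec_smul, Matrix.mulVec_mulVec, ← Matrix.SpecialLinearGroup.coe_mul,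
    inv_mul_cancel, Matrix.SpecialLinearGroup.coe_one, Matrix.one_mulVec]

theorem Flag.RepPt.eigen {F : Flag} {p : Fin 3 → ℝ} (h : F.RepPt p) {g : PSL3} (hg : g • F = F) :
    ∃ k : ℝ, k ≠ 0 ∧ g.1 *ᵥ p = k • p := by
  have := h.mulVec g
  rw [hg] at this
  exact h.unique this

theorem Flag.RepLn.eigen {F : Flag} {l : Fin 3 → ℝ} (h : F.RepLn l) {g : PSL3} (hg : g • F = F) :
    ∃ k : ℝ, k ≠ 0 ∧ l ᵥ* g.1 = k • l := by
  have h1 : (g⁻¹ • F).RepLn (l ᵥ* g.1) := by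
    refine h.smul g⁻¹ one_ne_zero ?_
    rw [Matrix.vecMul_vecMul, ← Matrix.SpecialLinearGroup.coe_mul, mul_inv_cancel,
      Matrix.SpecialLinearGroup.coe_one, Matrix.vecMul_one, one_smul]
  rw [inv_smul_eq_iff.mpr hg.symm] at h1
  exact h.unique h1

theorem lineThrough_smul_smul (a b c : ℝ) (p q v : Fin 3 → ℝ) :
    lineThrough (a • p) (b • q) (c • v) = a * b * c * lineThrough p q v := by
  simpa using lineThrough_smul 1 a b c p q v

theorem cr₁_eq {F₁ F₂ F₃ F₄ : Flag} {p₁ p₂ p₃ p₄ l₁ : Fin 3 → ℝ} (h₁ : F₁.RepPt p₁)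
    (h₂ : F₂.RepPt p₂) (h₃ : F₃.RepPt p₃) (h₄ : F₄.RepPt p₄) (k₁ : F₁.RepLn l₁) :
    cr₁ F₁ F₂ F₃ F₄ =
      -((l₁ ⬝ᵥ p₂ * lineThrough p₁ p₃ p₄) / (l₁ ⬝ᵥ p₄ * lineThrough p₁ p₃ p₂)) := by
  obtain ⟨b₁, hb₁, h₁⟩ := h₁
  obtain ⟨b₂, hb₂, h₂⟩ := h₂
  obtain ⟨b₃, hb₃, h₃⟩ := h₃
  obtain ⟨b₄, hb₄, h₄⟩ := h₄
  obtain ⟨a₁, ha₁, k₁⟩ := k₁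
  simp only [cr₁, Flag.pair, k₁, h₁, h₂, h₃, h₄, smul_dotProduct, dotProduct_smul,
    lineThrough_smul_smul, smul_eq_mul]
  congr 1
  rw [show ∀ x y : ℝ, b₂ * (a₁ * x) * (b₁ * b₃ * b₄ * y) = (b₂ * a₁ * b₁ * b₃ * b₄) * (x * y) by
      intros; ring,
    show ∀ x y : ℝ, b₄ * (a₁ * x) * (b₁ * b₃ * b₂ * y) = (b₂ * a₁ * b₁ * b₃ * b₄) * (x * y) by
      intros; ring]
  exact mul_div_mul_left _ _ (by positivity)

theorem cr₂_eq {F₁ F₂ F₃ F₄ : Flag} {p₁ p₂ p₃ p₄ l₃ : Fin 3 → ℝ} (h₁ : F₁.RepPt p₁)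
    (h₂ : F₂.RepPt p₂) (h₃ : F₃.RepPt p₃) (h₄ : F₄.RepPt p₄) (k₃ : F₃.RepLn l₃) :
    cr₂ F₁ F₂ F₃ F₄ =
      -((l₃ ⬝ᵥ p₄ * lineThrough p₁ p₃ p₂) / (l₃ ⬝ᵥ p₂ * lineThrough p₁ p₃ p₄)) := by
  obtain ⟨b₁, hb₁, h₁⟩ := h₁
  obtain ⟨b₂, hb₂, h₂⟩ := h₂
  obtain ⟨b₃, hb₃, h₃⟩ := h₃
  obtain ⟨b₄, hb₄, h₄⟩ := h₄
  obtain ⟨a₃, ha₃, k₃⟩ := k₃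
  simp only [cr₂, Flag.pair, k₃, h₁, h₂, h₃, h₄, smul_dotProduct, dotProduct_smul,
    lineThrough_smul_smul, smul_eq_mul]
  congr 1
  rw [show ∀ x y : ℝ, b₄ * (a₃ * x) * (b₁ * b₃ * b₂ * y) = (b₂ * a₃ * b₁ * b₃ * b₄) * (x * y) by
      intros; ring,
    show ∀ x y : ℝ, b₂ * (a₃ * x) * (b₁ * b₃ * b₄ * y) = (b₂ * a₃ * b₁ * b₃ * b₄) * (x * y) by
      intros; ring]
  exact mul_div_mul_left _ _ (by positivity)

theorem tripleRatio_eq {F₁ F₂ F₃ : Flag} {p₁ p₂ p₃ l₁ l₂ l₃ : Fin 3 → ℝ} (h₁ : F₁.RepPt p₁)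
    (h₂ : F₂.RepPt p₂) (h₃ : F₃.RepPt p₃) (k₁ : F₁.RepLn l₁) (k₂ : F₂.RepLn l₂)
    (k₃ : F₃.RepLn l₃) :
    tripleRatio F₁ F₂ F₃ = (l₁ ⬝ᵥ p₂ * (l₂ ⬝ᵥ p₃) * (l₃ ⬝ᵥ p₁)) /
      (l₁ ⬝ᵥ p₃ * (l₂ ⬝ᵥ p₁) * (l₃ ⬝ᵥ p₂)) := by
  obtain ⟨b₁, hb₁, h₁⟩ := h₁
  obtain ⟨b₂, hb₂, h₂⟩ := h₂
  obtain ⟨b₃, hb₃, h₃⟩ := h₃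
  obtain ⟨a₁, ha₁, k₁⟩ := k₁
  obtain ⟨a₂, ha₂, k₂⟩ := k₂
  obtain ⟨a₃, ha₃, k₃⟩ := k₃
  simp only [tripleRatio, Flag.pair, k₁, k₂, k₃, h₁, h₂, h₃, smul_dotProduct, dotProduct_smul,
    smul_eq_mul]
  rw [show ∀ x y z : ℝ, b₂ * (a₁ * x) * (b₃ * (a₂ * y)) * (b₁ * (a₃ * z)) =
      (a₁ * a₂ * a₃ * b₁ * b₂ * b₃) * (x * y * z) by intros; ring,
    show ∀ x y z : ℝ, b₃ * (a₁ * x) * (b₁ * (a₂ * y)) * (b₂ * (a₃ * z)) =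
      (a₁ * a₂ * a₃ * b₁ * b₂ * b₃) * (x * y * z) by intros; ring]
  exact mul_div_mul_left _ _ (by positivity)

end PairOfPants

end

noncomputable section
namespace PairOfPants

/-! ### The normal form of a positive framed representation -/

/-- The holonomy of `α` in the normal form, up to scale. -/
def matA (y : Fin 8 → ℝ) : Matrix (Fin 3) (Fin 3) ℝ :=
  !![y 6 * y 7, y 3 + y 7 * y 3 + y 7 + y 6 * y 7, y 3 + y 7 * y 3 + y 7 + y 2 * y 3;
    0, y 0 * y 3, (1 + y 2) * (y 0 * y 3);
    0, 0, y 0 * y 1 * y 2 * y 3]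

/-- The holonomy of `γ` in the normal form, up to scale. -/
def matC (y : Fin 8 → ℝ) : Matrix (Fin 3) (Fin 3) ℝ :=
  !![y 0 * y 1 * y 4 * y 5, 0, 0;
    -(y 0 * y 1 * y 4 * (1 + y 5)), y 1 * y 4, 0;
    y 0 * y 1 * (y 6 + y 4 + y 4 * y 5 + y 6 * y 4), -(y 1 * (y 6 + y 4 + y 6 * y 4 + y 6 * y 7)),
      y 6 * y 7]

theorem det_matA (y : Fin 8 → ℝ) :
    (matA y).det = y 6 * y 7 * (y 0 * y 3) * (y 0 * y 1 * y 2 * y 3) := by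
  rw [Matrix.det_fin_three]
  simp [matA]

theorem det_matC (y : Fin 8 → ℝ) :
    (matC y).det = y 0 * y 1 * y 4 * y 5 * (y 1 * y 4) * (y 6 * y 7) := by
  rw [Matrix.det_fin_three]
  simp [matC]

theorem det_matA_pos {y : Fin 8 → ℝ} (hy : y ∈ orthant) : 0 < (matA y).det := by
  have h : ∀ i, 0 < y i := hy
  rw [det_matA]
  have := h 0; have := h 1; have := h 2; have := h 3; have := h 6; have := h 7
  positivity

theorem det_matC_pos {y : Fin 8 → ℝ} (hy : y ∈ orthant) : 0 < (matC y).det := by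
  have h : ∀ i, 0 < y i := hy
  rw [det_matC]
  have := h 0; have := h 1; have := h 4; have := h 5; have := h 6; have := h 7
  positivity

/-- The factor that scales a matrix of determinant `d > 0` to determinant one. -/
def cbrtInv (d : ℝ) : ℝ := d ^ (-(1 / 3 : ℝ))

theorem cbrtInv_pos {d : ℝ} (hd : 0 < d) : 0 < cbrtInv d := Real.rpow_pos_of_pos hd _

theorem cbrtInv_pow {d : ℝ} (hd : 0 < d) : cbrtInv d ^ 3 * d = 1 := by
  have : cbrtInv d ^ 3 = d⁻¹ := by
    rw [cbrtInv, ← Real.rpow_natCast, ← Real.rpow_mul hd.le]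
    norm_num
    exact Real.rpow_neg_one d
  rw [this, inv_mul_cancel₀ hd.ne']

theorem eq_cbrtInv {d k : ℝ} (hd : 0 < d) (hk : k ^ 3 * d = 1) : k = cbrtInv d := by
  have : k ^ 3 = cbrtInv d ^ 3 := mul_right_cancel₀ hd.ne' (hk.trans (cbrtInv_pow hd).symm)
  exact (Odd.strictMono_pow (by decide : Odd 3)).injective this

/-- The matrix of determinant one that is a positive multiple of a given one. -/
def scaled (M : Matrix (Fin 3) (Fin 3) ℝ) (h : 0 < M.det) : PSL3 :=
  ⟨cbrtInv M.det • M, by rw [Matrix.det_smul, Fintype.card_fin, cbrtInv_pow h]⟩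

theorem scaled_mulVec {M : Matrix (Fin 3) (Fin 3) ℝ} (h : 0 < M.det) {k : ℝ} {p q : Fin 3 → ℝ}
    (e : M *ᵥ p = k • q) : (scaled M h).1 *ᵥ p = (cbrtInv M.det * k) • q := by
  change (cbrtInv M.det • M) *ᵥ p = _
  rw [Matrix.smul_mulVec, e, smul_smul]

theorem scaled_vecMul {M : Matrix (Fin 3) (Fin 3) ℝ} (h : 0 < M.det) {k : ℝ} {p q : Fin 3 → ℝ}
    (e : p ᵥ* M = k • q) : p ᵥ* (scaled M h).1 = (cbrtInv M.det * k) • q := by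
  change p ᵥ* (cbrtInv M.det • M) = _
  rw [Matrix.vecMul_smul, e, smul_smul]

theorem Flag.RepPt.scaled_smul {F : Flag} {p q : Fin 3 → ℝ} (h : F.RepPt p)
    {M : Matrix (Fin 3) (Fin 3) ℝ} (hM : 0 < M.det) {k : ℝ}
    (hk : k ≠ 0) (e : M *ᵥ p = k • q) : (scaled M hM • F).RepPt q :=
  h.smul _ (mul_ne_zero (cbrtInv_pos hM).ne' hk) (scaled_mulVec hM e)

theorem Flag.RepLn.scaled_smul {F : Flag} {p q : Fin 3 → ℝ} (h : F.RepLn p)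
    {M : Matrix (Fin 3) (Fin 3) ℝ} (hM : 0 < M.det) {k : ℝ}
    (hk : k ≠ 0) (e : q ᵥ* M = k • p) : (scaled M hM • F).RepLn q :=
  h.smul _ (mul_ne_zero (cbrtInv_pos hM).ne' hk) (scaled_vecMul hM e)

theorem Flag.RepPt.scaled_inv_smul {F : Flag} {p q : Fin 3 → ℝ} (h : F.RepPt p)
    {M : Matrix (Fin 3) (Fin 3) ℝ} (hM : 0 < M.det) {k : ℝ}
    (hk : k ≠ 0) (e : M *ᵥ q = k • p) : ((scaled M hM)⁻¹ • F).RepPt q :=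
  h.inv_smul _ (mul_ne_zero (cbrtInv_pos hM).ne' hk) (scaled_mulVec hM e)

theorem cons_ne_zero_of_fst {a b c : ℝ} (h : a ≠ 0) : ![a, b, c] ≠ 0 := fun e =>
  h (congrFun e 0)

theorem cons_ne_zero_of_last {a b c : ℝ} (h : c ≠ 0) : ![a, b, c] ≠ 0 := fun e =>
  h (congrFun e 2)

/-- The flags of the boundary components `α`, `β`, `γ` in the normal form. They depend only on the
triple ratio `t`. -/
def stdFlag (t : ℝ) : Fin 3 → Flag :=
  ![Flag.ofVec ![1, 0, 0] ![0, 0, 1] (cons_ne_zero_of_fst one_ne_zero)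
      (cons_ne_zero_of_last one_ne_zero) (by simp),
    Flag.ofVec ![1, -1, 1] ![t, 1 + t, 1] (cons_ne_zero_of_fst one_ne_zero)
      (cons_ne_zero_of_last one_ne_zero) (by simp),
    Flag.ofVec ![0, 0, 1] ![1, 0, 0] (cons_ne_zero_of_last one_ne_zero)
      (cons_ne_zero_of_fst one_ne_zero) (by simp)]

/-- Representatives of the points of the standard flags. -/
def stdPt : Fin 3 → Fin 3 → ℝ := ![![1, 0, 0], ![1, -1, 1], ![0, 0, 1]]

/-- Representatives of the lines of the standard flags. -/
def stdLn (t : ℝ) : Fin 3 → Fin 3 → ℝ := ![![0, 0, 1], ![t, 1 + t, 1], ![1, 0, 0]]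

theorem stdFlag_repPt (t : ℝ) (i : Fin 3) : (stdFlag t i).RepPt (stdPt i) := by
  fin_cases i
  exacts [Flag.ofVec_repPt _ _ (by simp), Flag.ofVec_repPt _ _ (by simp),
    Flag.ofVec_repPt _ _ (by simp)]

theorem stdFlag_repLn (t : ℝ) (i : Fin 3) : (stdFlag t i).RepLn (stdLn t i) := by
  fin_cases i
  exacts [Flag.ofVec_repLn _ _ (by simp), Flag.ofVec_repLn _ _ (by simp),
    Flag.ofVec_repLn _ _ (by simp)]

theorem stdFlag_eq {F : Flag} {t : ℝ} {i : Fin 3} (h : F.RepPt (stdPt i))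
    (h' : F.RepLn (stdLn t i)) : F = stdFlag t i :=
  Flag.eq_of_rep h h' (stdFlag_repPt t i) (stdFlag_repLn t i)

/-- The holonomy of `α` in the normal form. -/
def holA {y : Fin 8 → ℝ} (hy : y ∈ orthant) : PSL3 := scaled (matA y) (det_matA_pos hy)

/-- The holonomy of `γ` in the normal form. -/
def holC {y : Fin 8 → ℝ} (hy : y ∈ orthant) : PSL3 := scaled (matC y) (det_matC_pos hy)

theorem matA_mulVec_stdPt (y : Fin 8 → ℝ) :
    matA y *ᵥ stdPt 1 = (y 2 * y 3) • ![1, y 0, y 0 * y 1] := by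
  ext i
  fin_cases i <;> simp [matA, stdPt, Matrix.mulVec] <;> ring

theorem matC_mulVec (y : Fin 8 → ℝ) :
    matC y *ᵥ ![1, y 0, y 0 * y 1] = (y 0 * y 1 * y 4 * y 5) • stdPt 1 := by
  ext i
  fin_cases i <;> simp [matC, stdPt, Matrix.mulVec] <;> ring

theorem vecMul_matA (y : Fin 8 → ℝ) :
    ![y 0 * y 1, -(y 1 * (1 + y 7)), y 7] ᵥ* matA y = (y 0 * y 1 * y 7) • stdLn (y 6) 1 := by
  ext i
  fin_cases i <;> simp [matA, stdLn, Matrix.vecMul] <;> ring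

theorem stdLn_vecMul_matC (y : Fin 8 → ℝ) :
    stdLn (y 6) 1 ᵥ* matC y = y 6 • ![y 0 * y 1, -(y 1 * (1 + y 7)), y 7] := by
  ext i
  fin_cases i <;> simp [matC, stdLn, Matrix.vecMul] <;> ring

theorem holA_smul_stdFlag {y : Fin 8 → ℝ} (hy : y ∈ orthant) :
    holA hy • stdFlag (y 6) 0 = stdFlag (y 6) 0 := by
  have h : ∀ i, 0 < y i := hy
  have h6 := h 6; have h7 := h 7
  have h0 := h 0; have h1 := h 1; have h2 := h 2; have h3 := h 3
  apply stdFlag_eq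
  · refine (stdFlag_repPt _ 0).scaled_smul _ (k := y 6 * y 7) (by positivity) ?_
    ext i
    fin_cases i <;> simp [matA, stdPt, Matrix.mulVec]
  · refine (stdFlag_repLn _ 0).scaled_smul _ (k := y 0 * y 1 * y 2 * y 3) (by positivity) ?_
    ext i
    fin_cases i <;> simp [matA, stdLn, Matrix.vecMul]

theorem holC_smul_stdFlag {y : Fin 8 → ℝ} (hy : y ∈ orthant) :
    holC hy • stdFlag (y 6) 2 = stdFlag (y 6) 2 := by
  have h : ∀ i, 0 < y i := hy
  have h6 := h 6; have h7 := h 7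
  have h0 := h 0; have h1 := h 1; have h4 := h 4; have h5 := h 5
  apply stdFlag_eq
  · refine (stdFlag_repPt _ 2).scaled_smul _ (k := y 6 * y 7) (by positivity) ?_
    ext i
    fin_cases i <;> simp [matC, stdPt, Matrix.mulVec]
  · refine (stdFlag_repLn _ 2).scaled_smul _ (k := y 0 * y 1 * y 4 * y 5) (by positivity) ?_
    ext i
    fin_cases i <;> simp [matC, stdLn, Matrix.vecMul]

theorem holA_smul_repPt {y : Fin 8 → ℝ} (hy : y ∈ orthant) :
    (holA hy • stdFlag (y 6) 1).RepPt ![1, y 0, y 0 * y 1] := by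
  have h : ∀ i, 0 < y i := hy
  have h2 := h 2; have h3 := h 3
  exact (stdFlag_repPt _ 1).scaled_smul _ (by positivity) (matA_mulVec_stdPt y)

theorem holC_mul_holA_smul_stdFlag {y : Fin 8 → ℝ} (hy : y ∈ orthant) :
    (holC hy * holA hy) • stdFlag (y 6) 1 = stdFlag (y 6) 1 := by
  have h : ∀ i, 0 < y i := hy
  have h0 := h 0; have h1 := h 1; have h4 := h 4; have h5 := h 5; have h6 := h 6; have h7 := h 7
  rw [mul_smul]
  apply stdFlag_eq
  · exact (holA_smul_repPt hy).scaled_smul _ (by positivity) (matC_mulVec y)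
  · refine Flag.RepLn.scaled_smul (p := ![y 0 * y 1, -(y 1 * (1 + y 7)), y 7]) ?_ _ h6.ne'
      (stdLn_vecMul_matC y)
    exact (stdFlag_repLn _ 1).scaled_smul _ (by positivity) (vecMul_matA y)

section

variable {G : Type*} [Group G]

/-- A representation of the fundamental group of the pair of pants is given by the images of `α` and
`γ`, since these elements generate it freely. -/
def repOf (a c : G) : Pi1 →* G :=
  PresentedGroup.toGroup (f := ![a, (c * a)⁻¹, c]) (by
    rintro r rfl
    simp)

theorem repOf_α (a c : G) : repOf a c curveα = a := PresentedGroup.toGroup.of _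

theorem repOf_β (a c : G) : repOf a c curveβ = (c * a)⁻¹ := PresentedGroup.toGroup.of _

theorem repOf_γ (a c : G) : repOf a c curveγ = c := PresentedGroup.toGroup.of _

end

theorem curve_mul : curveα * curveβ * curveγ = 1 :=
  PresentedGroup.one_of_mem (Set.mem_singleton _)

theorem curveβ_eq : curveβ = (curveγ * curveα)⁻¹ := by
  rw [eq_inv_iff_mul_eq_one, ← mul_assoc, mul_eq_one_iff_eq_inv, eq_comm, inv_eq_iff_mul_eq_one,
    ← mul_assoc]
  exact curve_mul

theorem Pi1.hom_ext {G : Type*} [Group G] {φ ψ : Pi1 →* G} (hα : φ curveα = ψ curveα)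
    (hγ : φ curveγ = ψ curveγ) : φ = ψ := by
  apply PresentedGroup.ext
  intro i
  fin_cases i
  · exact hα
  · change φ curveβ = ψ curveβ
    rw [curveβ_eq, map_inv, map_inv, map_mul, map_mul, hα, hγ]
  · exact hγ

/-- The framed representation with the coordinates `y`. -/
def normalForm {y : Fin 8 → ℝ} (hy : y ∈ orthant) : FramedRep where
  ρ := repOf (holA hy) (holC hy)
  flag := stdFlag (y 6)
  fixed i := by
    fin_cases i
    · exact (congrArg (· • stdFlag (y 6) 0) (repOf_α _ _)).trans (holA_smul_stdFlag hy)
    · refine (congrArg (· • stdFlag (y 6) 1) (repOf_β _ _)).trans ?_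
      exact inv_smul_eq_iff.mpr (holC_mul_holA_smul_stdFlag hy).symm
    · exact (congrArg (· • stdFlag (y 6) 2) (repOf_γ _ _)).trans (holC_smul_stdFlag hy)

theorem normalForm_coord {y : Fin 8 → ℝ} (hy : y ∈ orthant) : (normalForm hy).coord = y := by
  have h : ∀ i, 0 < y i := hy
  have h0 := h 0; have h1 := h 1; have h2 := h 2; have h3 := h 3
  have h4 := h 4; have h5 := h 5; have h6 := h 6; have h7 := h 7
  have pa := stdFlag_repPt (y 6) 0
  have pb := stdFlag_repPt (y 6) 1
  have pc := stdFlag_repPt (y 6) 2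
  have la := stdFlag_repLn (y 6) 0
  have lb := stdFlag_repLn (y 6) 1
  have lc := stdFlag_repLn (y 6) 2
  have pb' := holA_smul_repPt hy
  have pa' : (holC hy • stdFlag (y 6) 0).RepPt
      ![y 4 * y 5, -(y 4 * (1 + y 5)), y 6 + y 4 + y 4 * y 5 + y 6 * y 4] := by
    refine pa.scaled_smul _ (k := y 0 * y 1) (by positivity) ?_
    ext i
    fin_cases i <;> simp [matC, stdPt, Matrix.mulVec] <;> ring
  have la' : (holC hy • stdFlag (y 6) 0).RepLn
      ![y 5 * (y 6 + y 6 * y 4 + y 6 * y 7) + y 6 * y 7,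
        y 5 * (y 6 + y 4 + y 6 * y 4 + y 6 * y 7), y 4 * y 5] := by
    refine la.scaled_smul _ (k := y 4 * y 5 * (y 6 * y 7)) (by positivity) ?_
    ext i
    fin_cases i <;> simp [matC, stdLn, Matrix.vecMul] <;> ring
  have pc' : ((holC hy * holA hy)⁻¹ • stdFlag (y 6) 2).RepPt
      ![y 2 * y 3 + y 2 + y 6 * y 2 + y 6, -(y 6 * (1 + y 2)), y 6] := by
    have e : (holC hy * holA hy)⁻¹ • stdFlag (y 6) 2 = (holA hy)⁻¹ • stdFlag (y 6) 2 := by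
      rw [mul_inv_rev, mul_smul, inv_smul_eq_iff.mpr (holC_smul_stdFlag hy).symm]
    rw [e]
    refine pc.scaled_inv_smul _ (k := y 6 * (y 0 * y 1 * y 2 * y 3)) (by positivity) ?_
    ext i
    fin_cases i <;> simp [matA, stdPt, Matrix.mulVec] <;> ring
  have hα : (normalForm hy).ρ curveα = holA hy := repOf_α _ _
  have hβ : (normalForm hy).ρ curveβ = (holC hy * holA hy)⁻¹ := repOf_β _ _
  have hγ : (normalForm hy).ρ curveγ = holC hy := repOf_γ _ _
  have hf : (normalForm hy).flag = stdFlag (y 6) := rfl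
  simp only [FramedRep.coord, hα, hβ, hγ, hf]
  rw [cr₂_eq pa pb' pc pb lc, cr₁_eq pa pb' pc pb la, cr₂_eq pb pc' pa pc la,
    cr₁_eq pb pc' pa pc lb, cr₂_eq pc pa' pb pa lb, cr₁_eq pc pa' pb pa lc,
    tripleRatio_eq pa pc pb la lc lb, tripleRatio_eq pc pa' pb lc la' lb]
  ext i
  fin_cases i <;>
    simp [lineThrough, Matrix.det_fin_three, stdPt, stdLn]
  · field_simp
  · field_simp
    ring
  · rw [show y 6 + -(y 6 * (1 + y 2)) = -(y 6 * y 2) by ring]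
    field_simp
    ring
  · rw [show y 6 * (y 4 * y 5) + (-((1 + y 6) * (y 4 * (1 + y 5))) +
      (y 6 + y 4 + y 4 * y 5 + y 6 * y 4)) = y 6 by ring]
    field_simp
    ring
  · rw [show -(y 4 * (1 + y 5)) + y 4 * y 5 = -y 4 by ring]
    field_simp
  · rw [show y 6 * (y 4 * y 5) + (-((1 + y 6) * (y 4 * (1 + y 5))) +
      (y 6 + y 4 + y 4 * y 5 + y 6 * y 4)) = y 6 by ring]
    field_simp
    ring

end PairOfPants

end

noncomputable section
namespace PairOfPants

/-! ### Every positive framed representation has a normal form -/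

theorem eq_mul_of_neg_div_eq {n d x : ℝ} (h : -(n / d) = x) (hx : 0 < x) : n = -x * d := by
  have hd : d ≠ 0 := by
    rintro rfl
    simp at h
    exact hx.ne h
  field_simp at h
  linarith

theorem eq_mul_of_div_eq {n d x : ℝ} (h : n / d = x) (hx : 0 < x) : n = x * d := by
  have hd : d ≠ 0 := by
    rintro rfl
    simp at h
    exact hx.ne h
  field_simp at h
  linarith

/-- The equations that the coordinates impose on the triangular matrices of `α` and `γ` have a
solution that is unique up to scale. -/
theorem matrices_unique {y : Fin 8 → ℝ} (hy : ∀ i, 0 < y i) {a b c d e f p q r s t u m n : ℝ}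
    (hd : d ≠ 0) (hp : p ≠ 0)
    (h0 : e - d = y 0 * (a - b + c)) (h1 : f = y 1 * (e - d)) (h2 : y 2 * d = e - d)
    (h3 : y 3 * (a * d - a * e) = -(y 6 * (b * e - c * d) - (1 + y 6) * (a * e) + a * d))
    (h4 : y 4 * (y 6 * p + (1 + y 6) * q + s) = -(y 6 * (p + q)))
    (h5 : y 5 * (p + q) = -p)
    (h7 : y 7 * (r * (y 6 * p + (1 + y 6) * q + s)) = q * t - r * s + p * t + p * r)
    (hB₁ : p * (a - b + c) = m) (hB₂ : q * (a - b + c) + r * (e - d) = -m)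
    (hB₃ : s * (a - b + c) + t * (e - d) + u * f = m)
    (hL₁ : (y 6 * p + (1 + y 6) * q + s) * a = n * y 6)
    (hL₂ : (y 6 * p + (1 + y 6) * q + s) * b + ((1 + y 6) * r + t) * d = n * (1 + y 6)) :
    ∃ k l : ℝ, !![a, b, c; 0, d, e; 0, 0, f] = k • matA y ∧
      !![p, 0, 0; q, r, 0; s, t, u] = l • matC y := by
  have y0 := hy 0; have y1 := hy 1; have y2 := hy 2; have y3 := hy 3
  have y4 := hy 4; have y5 := hy 5; have y6 := hy 6; have y7 := hy 7
  obtain ⟨k, hk⟩ : ∃ k, d = k * (y 0 * y 3) := ⟨d / (y 0 * y 3), by field_simp⟩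
  obtain ⟨l, hl⟩ : ∃ l, p = l * (y 0 * y 1 * y 4 * y 5) :=
    ⟨p / (y 0 * y 1 * y 4 * y 5), by field_simp⟩
  have hk0 : k ≠ 0 := by rintro rfl; simp at hk; exact hd hk
  have hl0 : l ≠ 0 := by rintro rfl; simp at hl; exact hp hl
  have he : e = k * ((1 + y 2) * (y 0 * y 3)) := by rw [hk] at h2; linarith
  have hX : a - b + c = k * (y 2 * y 3) := by
    apply mul_left_cancel₀ y0.ne'
    rw [← h0, he, hk]; ring
  have hf : f = k * (y 0 * y 1 * y 2 * y 3) := by rw [h1, he, hk]; ring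
  have hq : q = -(l * (y 0 * y 1 * y 4 * (1 + y 5))) := by
    apply mul_left_cancel₀ y5.ne'
    rw [hl] at h5
    linarith
  have hs' : y 6 * p + (1 + y 6) * q + s = l * (y 0 * y 1 * y 6) := by
    apply mul_left_cancel₀ y4.ne'
    rw [h4, hl, hq]; ring
  have hs : s = l * (y 0 * y 1 * (y 6 + y 4 + y 4 * y 5 + y 6 * y 4)) := by
    rw [hl, hq] at hs'
    linarith
  have hed : e - d = k * (y 2 * y 3) * y 0 := by rw [he, hk]; ring
  have hr' : r = l * (y 1 * y 4) := by
    rw [hX, hed, ← hB₁, hX, hl, hq] at hB₂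
    have hne : k * (y 2 * y 3) * y 0 ≠ 0 := by positivity
    apply mul_right_cancel₀ hne
    linarith
  have hB₃' : s + t * y 0 + u * (y 0 * y 1) = p := by
    rw [hX, hed, hf, ← hB₁, hX] at hB₃
    have hne : k * (y 2 * y 3) ≠ 0 := by positivity
    apply mul_right_cancel₀ hne
    linarith
  have ht : t = -(l * (y 1 * (y 6 + y 4 + y 6 * y 4 + y 6 * y 7))) := by
    rw [hs', hr', hl, hq, hs] at h7
    have hne : l * (y 0 * y 1 * y 4) ≠ 0 := by positivity
    apply mul_right_cancel₀ hne
    linear_combination h7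
  have hu : u = l * (y 6 * y 7) := by
    rw [hs, ht, hl] at hB₃'
    have hne : y 0 * y 1 ≠ 0 := by positivity
    apply mul_right_cancel₀ hne
    linear_combination hB₃'
  have hn : n = l * (y 0 * y 1) * a := by
    rw [hs'] at hL₁
    apply mul_right_cancel₀ y6.ne'
    linear_combination -hL₁
  have hc : c = k * (y 2 * y 3) - a + b := by linarith
  have hb1 : y 0 * y 6 * b = y 6 * (1 + y 7) * (k * (y 0 * y 3)) + y 0 * a * (1 + y 6) := by
    rw [hs', hn, hr', ht, hk] at hL₂
    have hne : l * y 1 ≠ 0 := by positivity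
    apply mul_left_cancel₀ hne
    linear_combination hL₂
  have hb2 : y 6 * y 2 * b =
      y 6 * (k * (y 2 * y 3)) + a * (y 2 * y 3 + y 2 + y 6 * y 2) := by
    rw [he, hk, hc] at h3
    have hne : k * (y 0 * y 3) ≠ 0 := by positivity
    apply mul_left_cancel₀ hne
    linear_combination h3
  have ha' : a = k * (y 6 * y 7) := by
    have hne : y 0 * y 2 * y 3 ≠ 0 := by positivity
    apply mul_left_cancel₀ hne
    linear_combination y 2 * hb1 - y 0 * hb2
  have hb : b = k * (y 3 + y 7 * y 3 + y 7 + y 6 * y 7) := by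
    have hne : y 6 * y 2 ≠ 0 := by positivity
    apply mul_left_cancel₀ hne
    rw [hb2, ha']; ring
  refine ⟨k, l, ?_, ?_⟩
  · ext i j
    fin_cases i <;> fin_cases j <;> simp [matA]
    exacts [ha', hb, by rw [hc, ha', hb]; ring, hk, he, hf]
  · ext i j
    fin_cases i <;> fin_cases j <;> simp [matC]
    exacts [hl, hq, hr', hs, ht, hu]

theorem eq_scaled {g : PSL3} {M : Matrix (Fin 3) (Fin 3) ℝ} (hM : 0 < M.det) {k : ℝ}
    (h : g.1 = k • M) : g = scaled M hM := by
  apply Subtype.ext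
  change g.1 = cbrtInv M.det • M
  have hd := g.2
  rw [h, Matrix.det_smul, Fintype.card_fin] at hd
  rw [h, eq_cbrtInv hM hd]

/-- An upper triangular matrix is determined by the images of the points and lines of the standard
flag it fixes. -/
theorem upper_eq {M : Matrix (Fin 3) (Fin 3) ℝ} {k l : ℝ} (h : M *ᵥ ![1, 0, 0] = k • ![1, 0, 0])
    (h' : ![0, 0, 1] ᵥ* M = l • ![0, 0, 1]) :
    M = !![M 0 0, M 0 1, M 0 2; 0, M 1 1, M 1 2; 0, 0, M 2 2] ∧ M 0 0 = k ∧ M 2 2 = l := by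
  have e0 := congrFun h 0
  have e1 := congrFun h 1
  have e2 := congrFun h 2
  have f1 := congrFun h' 1
  have f2 := congrFun h' 2
  simp [Matrix.mulVec, Matrix.vecMul, dotProduct, Fin.sum_univ_three] at e0 e1 e2 f1 f2
  refine ⟨?_, e0, f2⟩
  ext i j
  fin_cases i <;> fin_cases j <;> simp [e1, e2, f1]

theorem lower_eq {M : Matrix (Fin 3) (Fin 3) ℝ} {k l : ℝ} (h : M *ᵥ ![0, 0, 1] = k • ![0, 0, 1])
    (h' : ![1, 0, 0] ᵥ* M = l • ![1, 0, 0]) :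
    M = !![M 0 0, 0, 0; M 1 0, M 1 1, 0; M 2 0, M 2 1, M 2 2] ∧ M 2 2 = k ∧ M 0 0 = l := by
  have e0 := congrFun h 0
  have e1 := congrFun h 1
  have e2 := congrFun h 2
  have f0 := congrFun h' 0
  have f1 := congrFun h' 1
  simp [Matrix.mulVec, Matrix.vecMul, dotProduct, Fin.sum_univ_three] at e0 e1 e2 f0 f1
  refine ⟨?_, e2, f0⟩
  ext i j
  fin_cases i <;> fin_cases j <;> simp [e0, e1, f1]

theorem FramedRep.eq_normalForm {R : FramedRep} (hR : R.coord ∈ orthant)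
    (hpt : ∀ i, (R.flag i).RepPt (stdPt i)) (hln : ∀ i, (R.flag i).RepLn (stdLn (R.coord 6) i)) :
    R = normalForm hR := by
  have hy : ∀ i, 0 < R.coord i := hR
  have pa := hpt 0
  have pb := hpt 1
  have pc := hpt 2
  have la := hln 0
  have lb := hln 1
  have lc := hln 2
  have hβ : R.ρ curveβ = (R.ρ curveγ * R.ρ curveα)⁻¹ := by rw [curveβ_eq, map_inv, map_mul]
  have fa : R.ρ curveα • R.flag 0 = R.flag 0 := R.fixed 0
  have fc : R.ρ curveγ • R.flag 2 = R.flag 2 := R.fixed 2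
  have fb : (R.ρ curveγ * R.ρ curveα) • R.flag 1 = R.flag 1 := by
    have := R.fixed 1
    change R.ρ curveβ • _ = _ at this
    rw [hβ, inv_smul_eq_iff] at this
    exact this.symm
  have c0 : cr₂ (R.flag 0) (R.ρ curveα • R.flag 1) (R.flag 2) (R.flag 1) = R.coord 0 := rfl
  have c1 : cr₁ (R.flag 0) (R.ρ curveα • R.flag 1) (R.flag 2) (R.flag 1) = R.coord 1 := rfl
  have c2 : cr₂ (R.flag 1) (R.ρ curveβ • R.flag 2) (R.flag 0) (R.flag 2) = R.coord 2 := rfl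
  have c3 : cr₁ (R.flag 1) (R.ρ curveβ • R.flag 2) (R.flag 0) (R.flag 2) = R.coord 3 := rfl
  have c4 : cr₂ (R.flag 2) (R.ρ curveγ • R.flag 0) (R.flag 1) (R.flag 0) = R.coord 4 := rfl
  have c5 : cr₁ (R.flag 2) (R.ρ curveγ • R.flag 0) (R.flag 1) (R.flag 0) = R.coord 5 := rfl
  have c7 : tripleRatio (R.flag 2) (R.ρ curveγ • R.flag 0) (R.flag 1) = R.coord 7 := rfl
  rw [hβ] at c2 c3
  obtain ⟨a', ha', hA₁⟩ := pa.eigen fa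
  obtain ⟨f', hf', hA₂⟩ := la.eigen fa
  obtain ⟨u', hu', hC₁⟩ := pc.eigen fc
  obtain ⟨p', hp', hC₂⟩ := lc.eigen fc
  obtain ⟨m, hm, hB⟩ := pb.eigen fb
  obtain ⟨n, hn, hL⟩ := lb.eigen fb
  obtain ⟨hA, ea, ef⟩ := upper_eq hA₁ hA₂
  obtain ⟨hC, eu, ep⟩ := lower_eq hC₁ hC₂
  have dA := (R.ρ curveα).2
  have dC := (R.ρ curveγ).2
  rw [← ea] at ha'
  rw [← ef] at hf'
  rw [← eu] at hu'
  rw [← ep] at hp'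
  clear ea ef eu ep
  generalize (R.ρ curveα).1 0 0 = a at *
  generalize (R.ρ curveα).1 0 1 = b at *
  generalize (R.ρ curveα).1 0 2 = c at *
  generalize (R.ρ curveα).1 1 1 = d at *
  generalize (R.ρ curveα).1 1 2 = e at *
  generalize (R.ρ curveα).1 2 2 = f at *
  generalize (R.ρ curveγ).1 0 0 = p at *
  generalize (R.ρ curveγ).1 1 0 = q at *
  generalize (R.ρ curveγ).1 1 1 = r at *
  generalize (R.ρ curveγ).1 2 0 = s at *
  generalize (R.ρ curveγ).1 2 1 = t at *
  generalize (R.ρ curveγ).1 2 2 = u at *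
  rw [hA, Matrix.det_fin_three] at dA
  rw [hC, Matrix.det_fin_three] at dC
  simp at dA dC
  have hd : d ≠ 0 := by rintro rfl; simp at dA
  have hr : r ≠ 0 := by rintro rfl; simp at dC
  have pb' : (R.ρ curveα • R.flag 1).RepPt ![a - b + c, e - d, f] := by
    refine pb.smul _ one_ne_zero ?_
    rw [hA]
    ext i
    fin_cases i <;> simp [stdPt, Matrix.mulVec, dotProduct, Fin.sum_univ_three] <;> ring
  have pa' : (R.ρ curveγ • R.flag 0).RepPt ![p, q, s] := by
    refine pa.smul _ one_ne_zero ?_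
    rw [hC]
    ext i
    fin_cases i <;> simp [stdPt, Matrix.mulVec, dotProduct, Fin.sum_univ_three]
  have la' : (R.ρ curveγ • R.flag 0).RepLn ![q * t - r * s, -(p * t), p * r] := by
    refine la.smul _ (k := p * r * u) (by positivity) ?_
    rw [hC]
    ext i
    fin_cases i <;> simp [stdLn, Matrix.vecMul, dotProduct, Fin.sum_univ_three] <;> ring
  have pc' : ((R.ρ curveγ * R.ρ curveα)⁻¹ • R.flag 2).RepPt
      ![b * e - c * d, -(a * e), a * d] := by
    refine pc.inv_smul _ (k := a * d * f * u) (by positivity) ?_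
    rw [Matrix.SpecialLinearGroup.coe_mul, ← Matrix.mulVec_mulVec, hA, hC]
    ext i
    fin_cases i <;> simp [stdPt, Matrix.mulVec, dotProduct, Fin.sum_univ_three]
    · right
      ring
    · ring
    · ring
  rw [cr₂_eq pa pb' pc pb lc] at c0
  rw [cr₁_eq pa pb' pc pb la] at c1
  rw [cr₂_eq pb pc' pa pc la] at c2
  rw [cr₁_eq pb pc' pa pc lb] at c3
  rw [cr₂_eq pc pa' pb pa lb] at c4
  rw [cr₁_eq pc pa' pb pa lc] at c5
  rw [tripleRatio_eq pc pa' pb lc la' lb] at c7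
  replace c0 := eq_mul_of_neg_div_eq c0 (hy 0)
  replace c1 := eq_mul_of_neg_div_eq c1 (hy 1)
  replace c2 := eq_mul_of_neg_div_eq c2 (hy 2)
  replace c3 := eq_mul_of_neg_div_eq c3 (hy 3)
  replace c4 := eq_mul_of_neg_div_eq c4 (hy 4)
  replace c5 := eq_mul_of_neg_div_eq c5 (hy 5)
  replace c7 := eq_mul_of_div_eq c7 (hy 7)
  rw [Matrix.SpecialLinearGroup.coe_mul, ← Matrix.mulVec_mulVec, hA, hC] at hB
  rw [Matrix.SpecialLinearGroup.coe_mul, ← Matrix.vecMul_vecMul, hA, hC] at hL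
  have b0 := congrFun hB 0
  have b1 := congrFun hB 1
  have b2 := congrFun hB 2
  have l0 := congrFun hL 0
  have l1 := congrFun hL 1
  simp [lineThrough, Matrix.det_fin_three, stdPt, stdLn, Matrix.mulVec, Matrix.vecMul, dotProduct,
    Fin.sum_univ_three] at c0 c1 c2 c3 c4 c5 c7 b0 b1 b2 l0 l1
  have h2 : R.coord 2 * d = e - d := mul_left_cancel₀ ha' (by linarith)
  have h7 := mul_left_cancel₀ hp' (c7.trans (by ring :
    _ = p * (R.coord 7 * (r * (R.coord 6 * p + (1 + R.coord 6) * q + s)))))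
  obtain ⟨k, l, hk, hl⟩ := matrices_unique (y := R.coord) hy hd hp'
    (a := a) (b := b) (c := c) (d := d) (e := e) (f := f) (p := p) (q := q) (r := r) (s := s)
    (t := t) (u := u) (m := m) (n := n)
    (by linarith) (by linarith) h2 (by linarith) (by linarith) (by linarith) (by linarith)
    (by linarith) (by linarith) (by linarith) l0 l1
  have eα : R.ρ curveα = holA hR := eq_scaled _ (hA.trans hk)
  have eγ : R.ρ curveγ = holC hR := eq_scaled _ (hC.trans hl)
  apply FramedRep.ext
  · apply Pi1.hom_ext
    · exact eα.trans (repOf_α _ _).symm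
    · exact eγ.trans (repOf_γ _ _).symm
  · funext i
    exact stdFlag_eq (hpt i) (hln i)

end PairOfPants

end

noncomputable section
namespace PairOfPants

theorem exists_unimodular {M : Matrix (Fin 3) (Fin 3) ℝ} (h : M.det ≠ 0) :
    ∃ (g : PSL3) (k : ℝ), k ≠ 0 ∧ g.1 = k • M := by
  rcases lt_or_gt_of_ne h with h | h
  · have h' : 0 < (-M).det := by
      rw [Matrix.det_neg, Fintype.card_fin]
      linarith
    refine ⟨scaled (-M) h', -cbrtInv (-M).det, neg_ne_zero.mpr (cbrtInv_pos h').ne', ?_⟩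
    change cbrtInv (-M).det • (-M) = _
    rw [smul_neg, neg_smul]
  · exact ⟨scaled M h, cbrtInv M.det, (cbrtInv_pos h).ne', rfl⟩

theorem eq_of_dotProduct_eq {p q v m n : Fin 3 → ℝ} (h : lineThrough p q v ≠ 0)
    (hp : m ⬝ᵥ p = n ⬝ᵥ p) (hq : m ⬝ᵥ q = n ⬝ᵥ q) (hv : m ⬝ᵥ v = n ⬝ᵥ v) : m = n := by
  rw [← sub_eq_zero]
  refine Matrix.eq_zero_of_mulVec_eq_zero h (funext fun i => ?_)
  fin_cases i
  · change p ⬝ᵥ (m - n) = 0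
    rw [dotProduct_comm, sub_dotProduct, hp, sub_self]
  · change q ⬝ᵥ (m - n) = 0
    rw [dotProduct_comm, sub_dotProduct, hq, sub_self]
  · change v ⬝ᵥ (m - n) = 0
    rw [dotProduct_comm, sub_dotProduct, hv, sub_self]

theorem lineThrough_eq_dotProduct (p q v : Fin 3 → ℝ) :
    lineThrough p q v =
      ![p 1 * q 2 - p 2 * q 1, p 2 * q 0 - p 0 * q 2, p 0 * q 1 - p 1 * q 0] ⬝ᵥ v := by
  simp [lineThrough, Matrix.det_fin_three, dotProduct, Fin.sum_univ_three]
  ring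

/-- The matrix whose rows are the functionals `ℓ_c / ℓ_c(p_b)`, `-det(p_a, p_c, ·) / det(p_a, p_c, p_b)`
and `ℓ_a / ℓ_a(p_b)` moves the flags of a positive framed representation to the standard ones. -/
theorem FramedRep.exists_standard {R : FramedRep} (hR : R.coord ∈ orthant) :
    ∃ g : PSL3, (∀ i, (g • R.flag i).RepPt (stdPt i)) ∧
      ∀ i, (g • R.flag i).RepLn (stdLn (R.coord 6) i) := by
  have hy : ∀ i, 0 < R.coord i := hR
  have c0 : cr₂ (R.flag 0) (R.ρ curveα • R.flag 1) (R.flag 2) (R.flag 1) = R.coord 0 := rfl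
  have c6 : tripleRatio (R.flag 0) (R.flag 2) (R.flag 1) = R.coord 6 := rfl
  have y0 := hy 0
  have y6 := hy 6
  rw [← c0, cr₂] at y0
  rw [← c6, tripleRatio] at y6
  have ia := (R.flag 0).incident
  have ib := (R.flag 1).incident
  have ic := (R.flag 2).incident
  have pa := (R.flag 0).repPt_self
  have pb := (R.flag 1).repPt_self
  have pc := (R.flag 2).repPt_self
  have la := (R.flag 0).repLn_self
  have lb := (R.flag 1).repLn_self
  have lc := (R.flag 2).repLn_self
  rw [tripleRatio] at c6
  simp only [Flag.pair] at y0 y6 c6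
  generalize (R.flag 0).point.rep = a at *
  generalize (R.flag 1).point.rep = b at *
  generalize (R.flag 2).point.rep = c at *
  generalize (R.flag 0).line.rep = m at *
  generalize (R.flag 1).line.rep = n at *
  generalize (R.flag 2).line.rep = o at *
  have hD : lineThrough a c b ≠ 0 := fun e => by simp [e] at y0
  have hmc : m ⬝ᵥ c ≠ 0 := fun e => by simp [e] at y6
  have hmb : m ⬝ᵥ b ≠ 0 := fun e => by simp [e] at y6
  have hob : o ⬝ᵥ b ≠ 0 := fun e => by simp [e] at y6
  have hoa : o ⬝ᵥ a ≠ 0 := fun e => by simp [e] at y6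
  have hna : n ⬝ᵥ a ≠ 0 := fun e => by simp [e] at y6
  have hnc : n ⬝ᵥ c ≠ 0 := fun e => by simp [e] at y6
  have hLa : lineThrough a c a = 0 := by
    simp only [lineThrough, Matrix.det_fin_three, Matrix.of_apply, Matrix.cons_val]; ring
  have hLc : lineThrough a c c = 0 := by
    simp only [lineThrough, Matrix.det_fin_three, Matrix.of_apply, Matrix.cons_val]; ring
  let G : Matrix (Fin 3) (Fin 3) ℝ := Matrix.of ![(o ⬝ᵥ b)⁻¹ • o, (-(lineThrough a c b)⁻¹) •
    ![a 1 * c 2 - a 2 * c 1, a 2 * c 0 - a 0 * c 2, a 0 * c 1 - a 1 * c 0], (m ⬝ᵥ b)⁻¹ • m]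
  have hG : ∀ v, G *ᵥ v =
      ![o ⬝ᵥ v / (o ⬝ᵥ b), -(lineThrough a c v / lineThrough a c b), m ⬝ᵥ v / (m ⬝ᵥ b)] := by
    intro v
    have e0 : (G *ᵥ v) 0 = ((o ⬝ᵥ b)⁻¹ • o) ⬝ᵥ v := rfl
    have e1 : (G *ᵥ v) 1 = ((-(lineThrough a c b)⁻¹) •
      ![a 1 * c 2 - a 2 * c 1, a 2 * c 0 - a 0 * c 2, a 0 * c 1 - a 1 * c 0]) ⬝ᵥ v := rfl
    have e2 : (G *ᵥ v) 2 = ((m ⬝ᵥ b)⁻¹ • m) ⬝ᵥ v := rfl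
    rw [smul_dotProduct] at e0 e1 e2
    rw [← lineThrough_eq_dotProduct] at e1
    ext i
    fin_cases i
    · exact e0.trans (by simp; ring)
    · exact e1.trans (by simp; ring)
    · exact e2.trans (by simp; ring)
  have hdet : G.det ≠ 0 := by
    have e : G.det = (o ⬝ᵥ b)⁻¹ * (lineThrough a c b)⁻¹ * (m ⬝ᵥ b)⁻¹ *
        (o ⬝ᵥ a * (m ⬝ᵥ c)) := by
      have h1 : (o ⬝ᵥ a) * (m ⬝ᵥ c) = (o ⬝ᵥ a) * (m ⬝ᵥ c) - (m ⬝ᵥ a) * (o ⬝ᵥ c) := by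
        rw [ia, zero_mul, sub_zero]
      rw [h1, Matrix.det_fin_three]
      simp only [G, Matrix.of_apply, Matrix.cons_val, Pi.smul_apply, smul_eq_mul]
      generalize (o ⬝ᵥ b)⁻¹ = k₁
      generalize (lineThrough a c b)⁻¹ = k₂
      generalize (m ⬝ᵥ b)⁻¹ = k₃
      simp only [dotProduct, Fin.sum_univ_three]
      ring
    rw [e]
    exact mul_ne_zero (mul_ne_zero (mul_ne_zero (inv_ne_zero hob) (inv_ne_zero hD))
      (inv_ne_zero hmb)) (mul_ne_zero hoa hmc)
  have hrow : ∀ x v, (x ᵥ* G) ⬝ᵥ v = x ⬝ᵥ (G *ᵥ v) := fun x v =>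
    (Matrix.dotProduct_mulVec x G v).symm
  obtain ⟨g, k, hk, hg⟩ := exists_unimodular hdet
  have hpt : ∀ {F : Flag} {p q : Fin 3 → ℝ} {r : ℝ}, F.RepPt p → r ≠ 0 → G *ᵥ p = r • q →
      (g • F).RepPt q := by
    intro F p q r hF hr e
    refine hF.smul g (mul_ne_zero hk hr) ?_
    rw [hg, Matrix.smul_mulVec, e, smul_smul]
  have hln : ∀ {F : Flag} {p q : Fin 3 → ℝ} {r : ℝ}, F.RepLn p → r ≠ 0 → q ᵥ* G = r • p →
      (g • F).RepLn q := by
    intro F p q r hF hr e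
    refine hF.smul g (mul_ne_zero hk hr) ?_
    rw [hg, Matrix.vecMul_smul, e, smul_smul]
  refine ⟨g, fun i => ?_, fun i => ?_⟩
  · fin_cases i
    · refine hpt pa (div_ne_zero hoa hob) ?_
      rw [hG, ia, hLa]
      ext i
      fin_cases i <;> simp [stdPt]
    · refine hpt pb one_ne_zero ?_
      rw [hG, div_self hob, div_self hD, div_self hmb, one_smul]
      rfl
    · refine hpt pc (div_ne_zero hmc hmb) ?_
      rw [hG, ic, hLc]
      ext i
      fin_cases i <;> simp [stdPt]
  · fin_cases i
    · refine hln la (inv_ne_zero hmb) (eq_of_dotProduct_eq hD ?_ ?_ ?_) <;>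
        (rw [hrow, hG]; simp [stdLn]; ring)
    · refine hln lb (r := m ⬝ᵥ c / (m ⬝ᵥ b) / (n ⬝ᵥ c))
        (div_ne_zero (div_ne_zero hmc hmb) hnc) (eq_of_dotProduct_eq hD ?_ ?_ ?_)
      · rw [hrow, hG, ia, hLa, ← c6]
        simp [stdLn]
        field_simp
      · rw [hrow, hG, ic, hLc, ← c6]
        simp [stdLn]
        field_simp
      · rw [hrow, hG, smul_dotProduct, ib, div_self hob, div_self hD, div_self hmb]
        simp [stdLn]
    · refine hln lc (inv_ne_zero hob) (eq_of_dotProduct_eq hD ?_ ?_ ?_) <;>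
        (rw [hrow, hG]; simp [stdLn]; ring)

theorem FramedRep.exists_smul_eq_normalForm {R : FramedRep} (hR : R.coord ∈ orthant) :
    ∃ g : PSL3, g • R = normalForm hR := by
  obtain ⟨g, hpt, hln⟩ := R.exists_standard hR
  have hc : (g • R).coord = R.coord := R.coord_smul g
  have hR' : (g • R).coord ∈ orthant := hc ▸ hR
  have := FramedRep.eq_normalForm (R := g • R) hR' hpt (by rw [hc]; exact hln)
  refine ⟨g, this.trans ?_⟩
  congr 1

/-! ### The Fock-Goncharov chart is a bijection onto the positive orthant -/

/-- The point of the deformation space with the coordinates `y`. -/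
def ofCoord {y : Fin 8 → ℝ} (hy : y ∈ orthant) : FramedConvex :=
  ⟨⟦normalForm hy⟧, fun i => by
    change 0 < (normalForm hy).coord i
    rw [normalForm_coord]
    exact hy i⟩

theorem coord_ofCoord {y : Fin 8 → ℝ} (hy : y ∈ orthant) : coord (ofCoord hy) = y :=
  normalForm_coord hy

theorem coord_mem (x : FramedConvex) : coord x ∈ orthant := x.2

theorem coord_pos (x : FramedConvex) (i : Fin 8) : 0 < coord x i := x.2 i

theorem ofCoord_coord (x : FramedConvex) : ofCoord (coord_mem x) = x := by
  obtain ⟨q, hq⟩ := x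
  induction q using Quotient.inductionOn with
  | h R =>
    obtain ⟨g, hg⟩ := R.exists_smul_eq_normalForm hq
    apply Subtype.ext
    exact Quotient.sound ⟨g, hg⟩

theorem coord_injective : Function.Injective coord := by
  intro x y h
  rw [← ofCoord_coord x, ← ofCoord_coord y]
  congr 1

theorem tr_ofCoord (c : Pi1) {y : Fin 8 → ℝ} (hy : y ∈ orthant) :
    tr c (ofCoord hy) = Matrix.trace ((normalForm hy).ρ c).1 := rfl

theorem inChart_coord (f : FramedConvex → ℝ) (x : FramedConvex) : inChart f (coord x) = f x :=
  coord_injective.extend_apply f 0 x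

theorem inChart_of_mem (f : FramedConvex → ℝ) {y : Fin 8 → ℝ} (hy : y ∈ orthant) :
    inChart f y = f (ofCoord hy) := by
  conv_lhs => rw [← coord_ofCoord hy]
  exact inChart_coord f _

end PairOfPants

end

noncomputable section
namespace PairOfPants

/-! ### Symplectic leaves -/

open Complex (I)

open scoped InnerProductSpace

/-- The weights of the coordinates along a leaf: a leaf is parametrized by the plane `ℂ`, with
coordinate `s + i r`, by multiplying `σ₁, σ₃, σ₅` by `e^s`, `σ₂, σ₄, σ₆` by `e^(-s)`, `τ₁` by `e^r`
and `τ₂` by `e^(-r)`. -/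
def weight : Fin 8 → ℂ := ![1, -1, 1, -1, 1, -1, I, -I]

/-- The exchange matrix is the standard symplectic form of the plane, evaluated on the weights. -/
theorem exchange_eq (i j : Fin 8) : exchange i j = ⟪weight i, -I * weight j⟫_ℝ := by
  fin_cases i <;> fin_cases j <;> simp [exchange, weight, Complex.inner]

/-- The parametrization of the leaf of the point with the coordinates `y`. -/
def leafPt (y : Fin 8 → ℝ) (z : ℂ) : Fin 8 → ℝ := fun i => y i * Real.exp ⟪weight i, z⟫_ℝ

theorem leafPt_mem {y : Fin 8 → ℝ} (hy : y ∈ orthant) (z : ℂ) : leafPt y z ∈ orthant :=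
  fun i => mul_pos (hy i) (Real.exp_pos _)

theorem leafPt_add (y : Fin 8 → ℝ) (z w : ℂ) : leafPt (leafPt y z) w = leafPt y (z + w) := by
  funext i
  simp only [leafPt]
  rw [inner_add_right, Real.exp_add, mul_assoc]

theorem leafPt_zero (y : Fin 8 → ℝ) : leafPt y 0 = y := by
  funext i
  simp [leafPt]

/-- The parametrization of the leaf of the point `x`. -/
def leafMove (x : FramedConvex) (z : ℂ) : FramedConvex := ofCoord (leafPt_mem (coord_mem x) z)

theorem coord_leafMove (x : FramedConvex) (z : ℂ) : coord (leafMove x z) = leafPt (coord x) z :=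
  coord_ofCoord _

theorem leafMove_add (x : FramedConvex) (z w : ℂ) :
    leafMove (leafMove x z) w = leafMove x (z + w) := by
  apply coord_injective
  rw [coord_leafMove, coord_leafMove, coord_leafMove, leafPt_add]

theorem leafMove_zero (x : FramedConvex) : leafMove x 0 = x := by
  apply coord_injective
  rw [coord_leafMove, leafPt_zero]

/-- The gradient of `f` along the leaf through `x`, with respect to the parametrization. -/
def leafGrad (f : FramedConvex → ℝ) (x : FramedConvex) : ℂ :=
  ∑ j, (coord x j * partialDeriv f x j) • weight j

theorem orthant_mem_nhds {y : Fin 8 → ℝ} (hy : y ∈ orthant) : orthant ∈ nhds y := by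
  have : IsOpen orthant := by
    simp only [orthant, Set.ofPred_forall]
    exact isOpen_iInter_of_finite fun i => isOpen_lt continuous_const (continuous_apply i)
  exact this.mem_nhds hy

theorem inChart_eventuallyEq {f : FramedConvex → ℝ} {F : (Fin 8 → ℝ) → ℝ}
    (h : ∀ x, f x = F (coord x)) (x : FramedConvex) : inChart f =ᶠ[nhds (coord x)] F := by
  filter_upwards [orthant_mem_nhds (coord_mem x)] with y hy
  rw [inChart_of_mem f hy, h, coord_ofCoord]

theorem partialDeriv_coord (x : FramedConvex) (i k : Fin 8) :
    partialDeriv (fun y => coord y i) x k = if k = i then 1 else 0 := by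
  have h : HasFDerivAt (fun y : Fin 8 → ℝ => y i) (ContinuousLinearMap.proj (R := ℝ) i)
      (coord x) := hasFDerivAt_apply i (coord x)
  rw [partialDeriv, (inChart_eventuallyEq (F := fun y => y i) (fun _ => rfl) x).fderiv_eq,
    h.fderiv]
  simp [Pi.single_apply, eq_comm]

theorem hamiltonianField_eq (f : FramedConvex → ℝ) (x : FramedConvex) (i : Fin 8) :
    hamiltonianField f x i = coord x i * ⟪weight i, -2 * I * leafGrad f x⟫_ℝ := by
  have e : -2 * I * leafGrad f x =
      ∑ j, (2 * (coord x j * partialDeriv f x j)) • (-I * weight j) := by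
    rw [leafGrad, Finset.mul_sum]
    refine Finset.sum_congr rfl fun j _ => ?_
    simp only [Complex.real_smul]
    push_cast
    ring
  rw [e, inner_sum, hamiltonianField, poisson, Finset.mul_sum, Finset.sum_eq_single i]
  · refine Finset.sum_congr rfl fun j _ => ?_
    rw [partialDeriv_coord, if_pos rfl, real_inner_smul_right, ← exchange_eq]
    ring
  · intro k _ hk
    refine Finset.sum_eq_zero fun j _ => ?_
    rw [partialDeriv_coord, if_neg hk]
    ring
  · simp

theorem hasFDerivAt_leafPt (y : Fin 8 → ℝ) (z : ℂ) :
    HasFDerivAt (leafPt y) (ContinuousLinearMap.pi fun i =>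
      leafPt y z i • innerSL ℝ (weight i)) z := by
  rw [hasFDerivAt_pi]
  intro i
  have := (((innerSL ℝ (weight i)).hasFDerivAt (x := z)).exp).const_mul (y i)
  rw [smul_smul] at this
  exact this

theorem leafMove_hasFDerivAt {f : FramedConvex → ℝ} (x : FramedConvex) (z : ℂ)
    (hf : DifferentiableAt ℝ (inChart f) (coord (leafMove x z))) :
    HasFDerivAt (fun z => f (leafMove x z)) (innerSL ℝ (leafGrad f (leafMove x z))) z := by
  have h1 := hf.hasFDerivAt
  rw [coord_leafMove] at h1
  have h2 := h1.comp z (hasFDerivAt_leafPt (coord x) z)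
  have e : (fun z => f (leafMove x z)) = inChart f ∘ leafPt (coord x) := by
    funext z
    rw [Function.comp_apply, ← coord_leafMove, inChart_coord]
  rw [e]
  refine h2.congr_fderiv ?_
  ext1 v
  rw [innerSL_apply_apply, leafGrad, sum_inner, ContinuousLinearMap.comp_apply]
  rw [← Finset.univ_sum_single
    ((ContinuousLinearMap.pi fun i => leafPt (coord x) z i • innerSL ℝ (weight i)) v), map_sum]
  refine Finset.sum_congr rfl fun j _ => ?_
  have es : (Pi.single j ((ContinuousLinearMap.pi fun i =>
      leafPt (coord x) z i • innerSL ℝ (weight i)) v j) : Fin 8 → ℝ) =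
      (leafPt (coord x) z j * ⟪weight j, v⟫_ℝ) • Pi.single j (1 : ℝ) := by
    rw [← Pi.single_smul', smul_eq_mul, mul_one]
    rfl
  rw [es, map_smul, real_inner_smul_left, partialDeriv, coord_leafMove, smul_eq_mul]
  ring

theorem followsAt_iff {f : FramedConvex → ℝ} {c : ℝ → FramedConvex} {t : ℝ} :
    FollowsAt f c t ↔ ∀ i, HasDerivAt (fun s => coord (c s) i)
      (coord (c t) i * ⟪weight i, -2 * I * leafGrad f (c t)⟫_ℝ) t := by
  rw [FollowsAt, hasDerivAt_pi]
  simp only [hamiltonianField_eq]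

theorem followsAt_leafMove {f : FramedConvex → ℝ} {x : FramedConvex} {z : ℝ → ℂ} {t : ℝ}
    (hz : HasDerivAt z (-2 * I * leafGrad f (leafMove x (z t))) t) :
    FollowsAt f (fun s => leafMove x (z s)) t := by
  rw [followsAt_iff]
  intro i
  have h1 := (((innerSL ℝ (weight i)).hasFDerivAt (x := z t)).comp_hasDerivAt t hz).exp.const_mul
    (coord x i)
  have e : (fun s => coord (leafMove x (z s)) i) =
      fun s => coord x i * Real.exp ⟪weight i, z s⟫_ℝ :=
    funext fun s => congrFun (coord_leafMove x (z s)) i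
  rw [e, congrFun (coord_leafMove x (z t)) i, leafPt, mul_assoc]
  exact h1

/-- The parameter of the point `x'` of the leaf of `x`. -/
def leafParam (x x' : FramedConvex) : ℂ :=
  ⟨Real.log (coord x' 0) - Real.log (coord x 0), Real.log (coord x' 6) - Real.log (coord x 6)⟩

theorem leafParam_self (x : FramedConvex) : leafParam x x = 0 := by
  simp [leafParam, Complex.ext_iff]

theorem hasDerivAt_log_coord {f : FramedConvex → ℝ} {c : ℝ → FramedConvex} {t : ℝ}
    (h : FollowsAt f c t) (i : Fin 8) :
    HasDerivAt (fun s => Real.log (coord (c s) i)) ⟪weight i, -2 * I * leafGrad f (c t)⟫_ℝ t := by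
  have := (followsAt_iff.mp h i).log (coord_pos (c t) i).ne'
  rwa [mul_div_cancel_left₀ _ (coord_pos (c t) i).ne'] at this

theorem hasDerivAt_leafParam {f : FramedConvex → ℝ} {c : ℝ → FramedConvex} {t : ℝ}
    (h : FollowsAt f c t) (x : FramedConvex) :
    HasDerivAt (fun s => leafParam x (c s)) (-2 * I * leafGrad f (c t)) t := by
  have h0 := (hasDerivAt_log_coord h 0).sub_const (Real.log (coord x 0))
  have h6 := (hasDerivAt_log_coord h 6).sub_const (Real.log (coord x 6))
  have h1 := h0.ofReal_comp.add (h6.ofReal_comp.mul_const I)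
  have e : (fun s => leafParam x (c s)) = fun s =>
      ((Real.log (coord (c s) 0) - Real.log (coord x 0) : ℝ) : ℂ) +
        ((Real.log (coord (c s) 6) - Real.log (coord x 6) : ℝ) : ℂ) * I := by
    funext s
    apply Complex.ext <;> simp [leafParam]
  rw [e]
  have ev : ∀ v : ℂ, ((⟪weight 0, v⟫_ℝ : ℝ) : ℂ) + ((⟪weight 6, v⟫_ℝ : ℝ) : ℂ) * I = v := by
    intro v
    apply Complex.ext <;> simp [weight, Complex.inner]
  rw [ev] at h1
  exact h1

/-- Every Hamiltonian flow preserves the leaves. -/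
theorem eq_leafMove_of_follows {f : FramedConvex → ℝ} {c : ℝ → FramedConvex} {S : Set ℝ}
    (hS : Convex ℝ S) (h : ∀ t ∈ S, FollowsAt f c t) {a t : ℝ} (ha : a ∈ S) (ht : t ∈ S) :
    c t = leafMove (c a) (leafParam (c a) (c t)) := by
  apply coord_injective
  rw [coord_leafMove]
  funext i
  let u : ℝ → ℝ := fun s =>
    Real.log (coord (c s) i) - ⟪weight i, leafParam (c a) (c s)⟫_ℝ
  have hu : ∀ s ∈ S, HasDerivAt u 0 s := by
    intro s hs
    have h1 := (hasDerivAt_log_coord (h s hs) i).sub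
      ((innerSL ℝ (weight i)).hasFDerivAt.comp_hasDerivAt s (hasDerivAt_leafParam (h s hs) (c a)))
    rw [innerSL_apply_apply, sub_self] at h1
    exact h1
  have hconst : u t = u a := by
    have hle := hS.norm_image_sub_le_of_norm_hasDerivWithin_le (C := 0)
      (fun s hs => (hu s hs).hasDerivWithinAt) (by simp) ha ht
    simpa [sub_eq_zero] using hle
  simp only [u, leafParam_self, inner_zero_right, sub_zero] at hconst
  rw [leafPt, ← Real.exp_log (coord_pos (c t) i), ← Real.exp_log (coord_pos (c a) i),
    ← Real.exp_add]
  congr 1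
  linarith

/-- The Hamiltonian flow of a linear function of `log σ₁` and `log τ₁` is a translation of the
parametrization of the leaf. -/
theorem hamiltonianStep_leafMove (x : FramedConvex) (z : ℂ) :
    HamiltonianStep x (leafMove x z) := by
  let F : (Fin 8 → ℝ) → ℝ := fun y =>
    -z.im / 2 * Real.log (y 0) + z.re / 2 * Real.log (y 6)
  let f : FramedConvex → ℝ := fun x => F (coord x)
  have hF : ∀ y ∈ orthant, ContDiffAt ℝ ∞ F y := by
    intro y hy
    have h0 : y 0 ≠ 0 := (hy 0).ne'
    have h6 : y 6 ≠ 0 := (hy 6).ne'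
    exact (contDiffAt_const.mul ((contDiff_apply ℝ ℝ (0 : Fin 8)).contDiffAt.log h0)).add
      (contDiffAt_const.mul ((contDiff_apply ℝ ℝ (6 : Fin 8)).contDiffAt.log h6))
  have hgrad : ∀ x', -2 * I * leafGrad f x' = z := by
    intro x'
    have h0 := coord_pos x' 0
    have h6 := coord_pos x' 6
    have hd : HasFDerivAt F
        ((-z.im / 2) • ((coord x' 0)⁻¹ • ContinuousLinearMap.proj (R := ℝ) (0 : Fin 8)) +
          (z.re / 2) • ((coord x' 6)⁻¹ • ContinuousLinearMap.proj (R := ℝ) (6 : Fin 8)))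
        (coord x') :=
      (((hasFDerivAt_apply (𝕜 := ℝ) (0 : Fin 8) (coord x')).log h0.ne').const_mul _).add
        (((hasFDerivAt_apply (𝕜 := ℝ) (6 : Fin 8) (coord x')).log h6.ne').const_mul _)
    have hp : ∀ j, partialDeriv f x' j =
        (-z.im / 2) * ((coord x' 0)⁻¹ * Pi.single (M := fun _ => ℝ) j 1 0) +
        (z.re / 2) * ((coord x' 6)⁻¹ * Pi.single (M := fun _ => ℝ) j 1 6) := by
      intro j
      rw [partialDeriv, (inChart_eventuallyEq (f := f) (F := F) (fun _ => rfl) x').fderiv_eq,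
        hd.fderiv]
      rfl
    rw [leafGrad]
    simp only [hp, Fin.sum_univ_eight]
    simp [weight]
    have h0' : (coord x' 0 : ℂ) ≠ 0 := by exact_mod_cast h0.ne'
    have h6' : (coord x' 6 : ℂ) ≠ 0 := by exact_mod_cast h6.ne'
    field_simp
    apply Complex.ext <;> simp
  refine ⟨f, ?_, fun t => leafMove x (t * z), fun t _ => ?_, ?_, ?_⟩
  · intro y hy
    refine ((hF y hy).congr_of_eventuallyEq ?_).contDiffWithinAt
    have := inChart_eventuallyEq (f := f) (F := F) (fun _ => rfl) (ofCoord hy)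
    rwa [coord_ofCoord] at this
  · apply followsAt_leafMove
    rw [hgrad]
    simpa using (Complex.ofRealCLM.hasDerivAt (x := t)).mul_const z
  · simp [leafMove_zero]
  · simp

theorem reachable_eq (x : FramedConvex) :
    {q | Relation.ReflTransGen HamiltonianStep x q} = Set.range (leafMove x) := by
  ext q
  constructor
  · intro h
    induction h with
    | refl => exact ⟨0, leafMove_zero x⟩
    | tail _ hstep ih =>
      obtain ⟨z, rfl⟩ := ih
      obtain ⟨f, -, c, hc, h0, h1⟩ := hstep
      have := eq_leafMove_of_follows (convex_Icc (0 : ℝ) 1) hc (Set.left_mem_Icc.mpr zero_le_one)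
        (Set.right_mem_Icc.mpr zero_le_one)
      rw [h0, h1, leafMove_add] at this
      exact ⟨_, this.symm⟩
  · rintro ⟨z, rfl⟩
    exact Relation.ReflTransGen.single (hamiltonianStep_leafMove x z)

theorem isSymplecticLeaf_iff {Q : Set FramedConvex} :
    IsSymplecticLeaf Q ↔ ∃ x, Q = Set.range (leafMove x) := by
  simp only [IsSymplecticLeaf, reachable_eq]

theorem casimirs_leafMove (x : FramedConvex) (z : ℂ) : casimirs (leafMove x z) = casimirs x := by
  have hc : ∀ i, coord (leafMove x z) i = coord x i * Real.exp ⟪weight i, z⟫_ℝ := fun i =>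
    congrFun (coord_leafMove x z) i
  have h1 := coord_pos x 1
  have h2 := coord_pos x 2
  have h3 := coord_pos x 3
  have h4 := coord_pos x 4
  have h0 := coord_pos x 0
  have h5 := coord_pos x 5
  have e1 := Real.exp_pos z.re
  have e2 := Real.exp_pos z.im
  simp only [casimirs, hc]
  ext i
  fin_cases i <;> simp [weight, Complex.inner, Real.exp_neg] <;> field_simp

/-- The Casimir functions separate the leaves. -/
theorem eq_leafMove_of_casimirs {x x' : FramedConvex} (h : casimirs x' = casimirs x) :
    x' = leafMove x (leafParam x x') := by
  have hl : ∀ i, Real.log (casimirs x' i) = Real.log (casimirs x i) := fun i => by rw [h]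
  have n : ∀ i, coord x i ≠ 0 := fun i => (coord_pos x i).ne'
  have n' : ∀ i, coord x' i ≠ 0 := fun i => (coord_pos x' i).ne'
  have l0 := hl 0
  have l1 := hl 1
  have l2 := hl 2
  have l3 := hl 3
  have l4 := hl 4
  have l5 := hl 5
  simp [casimirs, Real.log_mul, Real.log_div, n, n'] at l0 l1 l2 l3 l4 l5
  apply coord_injective
  rw [coord_leafMove]
  funext i
  rw [leafPt, ← Real.exp_log (coord_pos x' i), ← Real.exp_log (coord_pos x i),
    ← Real.exp_add]
  congr 1
  fin_cases i <;> simp [weight, leafParam, Complex.inner] <;> linarith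

theorem leafOf_casimirs (x : FramedConvex) : leafOf (casimirs x) = Set.range (leafMove x) := by
  ext q
  constructor
  · intro h
    exact ⟨_, (eq_leafMove_of_casimirs h).symm⟩
  · rintro ⟨z, rfl⟩
    exact casimirs_leafMove x z

end PairOfPants

end

noncomputable section
namespace PairOfPants

/-! ### The symmetrized trace of the figure eight curve on a leaf -/

open Complex (I)

open scoped InnerProductSpace

open PlanarFlow

/-- The part of `tr (A adj C)` that contains the exponents `±1` and `±i` of the parametrization of
a leaf. -/
def traceLead (y : Fin 8 → ℝ) : ℝ :=
  y 6 * y 7 * (y 0 * y 1 * y 4) * (y 6 * y 7) + y 3 * (y 0 * y 1 * y 4 * y 5) * (y 6 * y 7) +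
    y 2 * (y 0 * y 3) * (y 0 * y 1 * y 4 * y 5) * y 1 * y 6 +
    y 7 * (y 0 * y 1 * y 4 * y 5) * (y 6 * y 7)

/-- The other terms of `tr (A adj C)`. -/
def traceRest (y : Fin 8 → ℝ) : ℝ :=
  y 6 * y 7 * (y 1 * y 4) * (y 6 * y 7) + y 0 * y 3 * (y 0 * y 1 * y 4 * y 5) * (y 6 * y 7) +
    y 0 * y 1 * y 2 * y 3 * (y 0 * y 1 * y 4 * y 5) * (y 1 * y 4) +
    (y 3 + y 7 * y 3 * (1 + y 5) + y 7 + y 6 * y 7 * y 5) * (y 0 * y 1 * y 4) * (y 6 * y 7) +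
    (y 3 + y 7 * y 3 + y 7 + y 2 * y 3) * (y 0 * y 1 * y 1 * y 4) *
      (y 6 * y 7 + y 5 * (y 6 + y 6 * y 4 + y 6 * y 7)) +
    (y 0 * y 3) * (y 0 * y 1 * y 4 * y 5) * y 1 * (y 6 + y 4 + y 6 * y 4 + y 6 * y 7) +
    y 2 * (y 0 * y 3) * (y 0 * y 1 * y 4 * y 5) * y 1 * (y 4 + y 6 * y 4 + y 6 * y 7)

/-- The polynomial `tr (C adj A)`. -/
def traceInv (y : Fin 8 → ℝ) : ℝ :=
  y 0 * y 1 * y 4 * y 5 * (y 0 * y 3) * (y 0 * y 1 * y 2 * y 3) +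
    y 1 * y 4 * (y 6 * y 7) * (y 0 * y 1 * y 2 * y 3) + y 6 * y 7 * (y 6 * y 7) * (y 0 * y 3) +
    y 0 * y 1 * y 4 * (1 + y 5) * (y 3 + y 7 * y 3 + y 7 + y 6 * y 7) * (y 0 * y 1 * y 2 * y 3) +
    y 0 * y 1 * (y 6 + y 4 + y 4 * y 5 + y 6 * y 4) * (y 0 * y 3) *
      (y 6 * y 7 + y 2 * (y 7 * y 3 + y 7 + y 6 * y 7)) +
    y 1 * (y 6 + y 4 + y 6 * y 4 + y 6 * y 7) * (y 6 * y 7) * ((1 + y 2) * (y 0 * y 3))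

theorem trace_matA_mul_adjugate (y : Fin 8 → ℝ) :
    (matA y * (matC y).adjugate).trace = traceLead y + traceRest y := by
  rw [Matrix.adjugate_fin_three, Matrix.trace_fin_three]
  simp [matA, matC, Matrix.mul_apply, Fin.sum_univ_three, traceLead, traceRest]
  ring

theorem trace_matC_mul_adjugate (y : Fin 8 → ℝ) :
    (matC y * (matA y).adjugate).trace = traceInv y := by
  rw [Matrix.adjugate_fin_three, Matrix.trace_fin_three]
  simp [matA, matC, Matrix.mul_apply, Fin.sum_univ_three, traceInv]
  ring

/-- The symmetrized trace in the chart. -/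
def symTraceChart (y : Fin 8 → ℝ) : ℝ :=
  cbrtInv (matA y).det * cbrtInv (matC y).det ^ 2 * (traceLead y + traceRest y) +
    cbrtInv (matC y).det * cbrtInv (matA y).det ^ 2 * traceInv y

theorem trace_scaled_mul_inv {M N : Matrix (Fin 3) (Fin 3) ℝ} (hM : 0 < M.det) (hN : 0 < N.det) :
    (scaled M hM * (scaled N hN)⁻¹).1.trace =
      cbrtInv M.det * cbrtInv N.det ^ 2 * (M * N.adjugate).trace := by
  have e : (scaled M hM * (scaled N hN)⁻¹).1 =
      (cbrtInv M.det • M) * (cbrtInv N.det • N).adjugate := by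
    rw [Matrix.SpecialLinearGroup.coe_mul, Matrix.SpecialLinearGroup.coe_inv]
    rfl
  rw [e, Matrix.adjugate_smul, Fintype.card_fin, Matrix.smul_mul, Matrix.mul_smul,
    Matrix.trace_smul, Matrix.trace_smul, smul_eq_mul, smul_eq_mul, mul_assoc]

theorem symTrace_eq_trace (x : FramedConvex) :
    symTrace x = (holA (coord_mem x) * (holC (coord_mem x))⁻¹).1.trace +
      (holC (coord_mem x) * (holA (coord_mem x))⁻¹).1.trace := by
  have hy := coord_mem x
  have hα : (normalForm hy).ρ curveα = holA hy := repOf_α _ _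
  have hγ : (normalForm hy).ρ curveγ = holC hy := repOf_γ _ _
  rw [symTrace, ← congrArg (tr curveδ) (ofCoord_coord x),
    ← congrArg (tr curveδ⁻¹) (ofCoord_coord x), tr_ofCoord, tr_ofCoord, curveδ, mul_inv_rev,
    inv_inv, map_mul, map_mul, map_inv, map_inv, hα, hγ]

theorem symTrace_eq (x : FramedConvex) : symTrace x = symTraceChart (coord x) := by
  rw [symTrace_eq_trace, holA, holC, trace_scaled_mul_inv, trace_scaled_mul_inv,
    trace_matA_mul_adjugate, trace_matC_mul_adjugate, symTraceChart]

theorem det_matA_leafPt {y : Fin 8 → ℝ} (z : ℂ) : (matA (leafPt y z)).det = (matA y).det := by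
  have e1 := (Real.exp_pos z.re).ne'
  have e2 := (Real.exp_pos z.im).ne'
  simp only [det_matA, leafPt]
  simp [weight, Complex.inner, Real.exp_neg]
  field_simp

theorem det_matC_leafPt {y : Fin 8 → ℝ} (z : ℂ) : (matC (leafPt y z)).det = (matC y).det := by
  have e1 := (Real.exp_pos z.re).ne'
  have e2 := (Real.exp_pos z.im).ne'
  simp only [det_matC, leafPt]
  simp [weight, Complex.inner, Real.exp_neg]
  field_simp

theorem traceLead_leafPt (y : Fin 8 → ℝ) (z : ℂ) :
    traceLead (leafPt y z) =
      y 6 * y 7 * (y 0 * y 1 * y 4) * (y 6 * y 7) * Real.exp z.re +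
      y 3 * (y 0 * y 1 * y 4 * y 5) * (y 6 * y 7) * Real.exp (-z.re) +
      y 2 * (y 0 * y 3) * (y 0 * y 1 * y 4 * y 5) * y 1 * y 6 * Real.exp z.im +
      y 7 * (y 0 * y 1 * y 4 * y 5) * (y 6 * y 7) * Real.exp (-z.im) := by
  have e1 := (Real.exp_pos z.re).ne'
  have e2 := (Real.exp_pos z.im).ne'
  simp only [traceLead, leafPt]
  simp [weight, Complex.inner, Real.exp_neg]
  field_simp

theorem isExpSum_leafPt {y : Fin 8 → ℝ} (hy : y ∈ orthant) (i : Fin 8) :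
    IsExpSum (fun z => leafPt y z i) :=
  IsExpSum.monomial (hy i).le _

theorem isExpSum_traceRest {y : Fin 8 → ℝ} (hy : y ∈ orthant) :
    IsExpSum (fun z => traceRest (leafPt y z)) := by
  have h := isExpSum_leafPt hy
  have h1 : IsExpSum (fun _ => 1) := IsExpSum.const zero_le_one
  unfold traceRest
  repeat' first
    | exact h _
    | exact h1
    | apply IsExpSum.add
    | apply IsExpSum.mul

theorem isExpSum_traceInv {y : Fin 8 → ℝ} (hy : y ∈ orthant) :
    IsExpSum (fun z => traceInv (leafPt y z)) := by
  have h := isExpSum_leafPt hy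
  have h1 : IsExpSum (fun _ => 1) := IsExpSum.const zero_le_one
  unfold traceInv
  repeat' first
    | exact h _
    | exact h1
    | apply IsExpSum.add
    | apply IsExpSum.mul

theorem differentiableAt_cbrtInv {E : Type*} [NormedAddCommGroup E] [NormedSpace ℝ E] {f : E → ℝ}
    {x : E} (hf : DifferentiableAt ℝ f x) (h : 0 < f x) :
    DifferentiableAt ℝ (fun x => cbrtInv (f x)) x :=
  hf.rpow_const (Or.inl h.ne')

theorem differentiableAt_symTraceChart {y : Fin 8 → ℝ} (hy : y ∈ orthant) :
    DifferentiableAt ℝ symTraceChart y := by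
  have hA : DifferentiableAt ℝ (fun y => cbrtInv (matA y).det) y := by
    refine differentiableAt_cbrtInv ?_ (det_matA_pos hy)
    simp only [det_matA]
    fun_prop
  have hC : DifferentiableAt ℝ (fun y => cbrtInv (matC y).det) y := by
    refine differentiableAt_cbrtInv ?_ (det_matC_pos hy)
    simp only [det_matC]
    fun_prop
  have h1 : DifferentiableAt ℝ (fun y => traceLead y + traceRest y) y := by
    unfold traceLead traceRest
    fun_prop
  have h2 : DifferentiableAt ℝ traceInv y := by
    unfold traceInv
    fun_prop
  exact ((hA.mul (hC.pow 2)).mul h1).add ((hC.mul (hA.pow 2)).mul h2)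

theorem differentiableAt_inChart_symTrace (x : FramedConvex) :
    DifferentiableAt ℝ (inChart symTrace) (coord x) :=
  (differentiableAt_symTraceChart (coord_mem x)).congr_of_eventuallyEq
    (inChart_eventuallyEq symTrace_eq x)

/-- The holonomies of `α` and `γ⁻¹` have nonnegative entries, and their inverses have nonnegative
entries after conjugation by `diag (1, -1, 1)`. So the symmetrized trace is a positive sum of
exponentials on a leaf. -/
theorem convexEnergy_symTrace (x : FramedConvex) :
    ConvexEnergy (fun z => symTrace (leafMove x z))
      (fun z => leafGrad symTrace (leafMove x z)) := by
  have hy := coord_mem x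
  have hp := coord_pos x
  have h0 := hp 0; have h1 := hp 1; have h2 := hp 2; have h3 := hp 3
  have h4 := hp 4; have h5 := hp 5; have h6 := hp 6; have h7 := hp 7
  have ha : 0 < cbrtInv (matA (coord x)).det := cbrtInv_pos (det_matA_pos hy)
  have hc : 0 < cbrtInv (matC (coord x)).det := cbrtInv_pos (det_matC_pos hy)
  obtain ⟨grad, hgrad⟩ : ∃ grad, ConvexEnergy (fun z => symTrace (leafMove x z)) grad := by
    have hg := ((IsExpSum.const (mul_pos ha (pow_pos hc 2)).le).mul (isExpSum_traceRest hy)).add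
      ((IsExpSum.const (mul_pos hc (pow_pos ha 2)).le).mul (isExpSum_traceInv hy))
    refine hg.exists_convexEnergy
      (k₁ := cbrtInv (matA (coord x)).det * cbrtInv (matC (coord x)).det ^ 2 *
        (coord x 6 * coord x 7 * (coord x 0 * coord x 1 * coord x 4) * (coord x 6 * coord x 7)))
      (k₂ := cbrtInv (matA (coord x)).det * cbrtInv (matC (coord x)).det ^ 2 *
        (coord x 3 * (coord x 0 * coord x 1 * coord x 4 * coord x 5) * (coord x 6 * coord x 7)))
      (k₃ := cbrtInv (matA (coord x)).det * cbrtInv (matC (coord x)).det ^ 2 *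
        (coord x 2 * (coord x 0 * coord x 3) * (coord x 0 * coord x 1 * coord x 4 * coord x 5) *
          coord x 1 * coord x 6))
      (k₄ := cbrtInv (matA (coord x)).det * cbrtInv (matC (coord x)).det ^ 2 *
        (coord x 7 * (coord x 0 * coord x 1 * coord x 4 * coord x 5) * (coord x 6 * coord x 7)))
      (by positivity) (by positivity) (by positivity) (by positivity) (fun z => ?_)
    rw [symTrace_eq, coord_leafMove, symTraceChart, det_matA_leafPt, det_matC_leafPt,
      traceLead_leafPt]
    ring
  have e : (fun z => leafGrad symTrace (leafMove x z)) = grad := by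
    funext z
    have := (leafMove_hasFDerivAt x z (differentiableAt_inChart_symTrace _)).unique
      (hgrad.hasFDerivAt z)
    exact innerSL_inj.mp this
  rw [e]
  exact hgrad

end PairOfPants

end

noncomputable section
namespace PairOfPants

/-! ### Hyperbolic structures are critical points -/

/-- Entrywise derivatives of a curve of matrices. -/
def HasEntryDerivAt (M : ℝ → Matrix (Fin 3) (Fin 3) ℝ) (M' : Matrix (Fin 3) (Fin 3) ℝ) (t : ℝ) :
    Prop :=
  ∀ i j, HasDerivAt (fun s => M s i j) (M' i j) t

theorem HasEntryDerivAt.mul {M N : ℝ → Matrix (Fin 3) (Fin 3) ℝ} {M' N' : Matrix (Fin 3) (Fin 3) ℝ}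
    {t : ℝ} (hM : HasEntryDerivAt M M' t) (hN : HasEntryDerivAt N N' t) :
    HasEntryDerivAt (fun s => M s * N s) (M' * N t + M t * N') t := by
  intro i j
  simp only [Matrix.mul_apply, Matrix.add_apply, ← Finset.sum_add_distrib]
  exact HasDerivAt.fun_sum fun k _ => (hM i k).mul (hN k j)

theorem HasEntryDerivAt.trace {M : ℝ → Matrix (Fin 3) (Fin 3) ℝ} {M' : Matrix (Fin 3) (Fin 3) ℝ}
    {t : ℝ} (hM : HasEntryDerivAt M M' t) : HasDerivAt (fun s => (M s).trace) M'.trace t :=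
  HasDerivAt.fun_sum fun k _ => hM k k

theorem HasEntryDerivAt.trace_eq_zero {M : ℝ → Matrix (Fin 3) (Fin 3) ℝ}
    {M' : Matrix (Fin 3) (Fin 3) ℝ} {t : ℝ} (hM : HasEntryDerivAt M M' t) {k : ℝ}
    (h : ∀ s, (M s).trace = k) : M'.trace = 0 := by
  have := hM.trace
  simp only [h] at this
  exact this.unique (hasDerivAt_const _ _)

theorem hasEntryDerivAt_of_differentiableAt {M : ℝ → Matrix (Fin 3) (Fin 3) ℝ} {t : ℝ}
    (h : ∀ i j, DifferentiableAt ℝ (fun s => M s i j) t) :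
    HasEntryDerivAt M (Matrix.of fun i j => deriv (fun s => M s i j) t) t :=
  fun i j => (h i j).hasDerivAt

/-- A curve in `SL(3, ℝ)` has a logarithmic derivative. -/
theorem exists_logDeriv {A : ℝ → PSL3} {t : ℝ}
    (h : ∀ i j, DifferentiableAt ℝ (fun s => (A s).1 i j) t) :
    ∃ U, HasEntryDerivAt (fun s => (A s).1) ((A t).1 * U) t ∧
      HasEntryDerivAt (fun s => (A s)⁻¹.1) (-(U * (A t)⁻¹.1)) t := by
  have h' : ∀ i j, DifferentiableAt ℝ (fun s => (A s)⁻¹.1 i j) t := by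
    intro i j
    simp only [Matrix.SpecialLinearGroup.coe_inv, Matrix.adjugate_fin_three]
    fin_cases i <;> fin_cases j <;> simp <;> fun_prop
  have hA := hasEntryDerivAt_of_differentiableAt h
  have hB := hasEntryDerivAt_of_differentiableAt h'
  have e : ∀ s, (A s).1 * (A s)⁻¹.1 = 1 := fun s => by
    rw [← Matrix.SpecialLinearGroup.coe_mul, mul_inv_cancel, Matrix.SpecialLinearGroup.coe_one]
  have e' : (A t)⁻¹.1 * (A t).1 = 1 := by
    rw [← Matrix.SpecialLinearGroup.coe_mul, inv_mul_cancel, Matrix.SpecialLinearGroup.coe_one]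
  set X := Matrix.of fun i j => deriv (fun s => (A s).1 i j) t
  set Y := Matrix.of fun i j => deriv (fun s => (A s)⁻¹.1 i j) t
  have hXY : X * (A t)⁻¹.1 + (A t).1 * Y = 0 := by
    have hm := hA.mul hB
    simp only [e] at hm
    ext i j
    exact (hm i j).unique (hasDerivAt_const _ _)
  refine ⟨(A t)⁻¹.1 * X, ?_, ?_⟩
  · rw [← mul_assoc, e, one_mul]
    exact hA
  · have : Y = -((A t)⁻¹.1 * X * (A t)⁻¹.1) := by
      rw [eq_neg_iff_add_eq_zero, add_comm, mul_assoc]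
      calc (A t)⁻¹.1 * (X * (A t)⁻¹.1) + Y
          = (A t)⁻¹.1 * (X * (A t)⁻¹.1 + (A t).1 * Y) := by
            rw [mul_add, ← mul_assoc _ _ Y, e', one_mul]
        _ = 0 := by rw [hXY, mul_zero]
    rw [← this]
    exact hB

/-- The difference of `symSquare h` and its inverse, divided by the trace of `h`. It lies in the Lie
algebra of the image of `symSquare`, and it is linear in `h`. -/
def skewPart (h : Matrix (Fin 2) (Fin 2) ℝ) : Matrix (Fin 3) (Fin 3) ℝ :=
  !![h 0 0 - h 1 1, 2 * h 0 1, 0;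
    h 1 0, 0, h 0 1;
    0, 2 * h 1 0, h 1 1 - h 0 0]

theorem symSquare_sub_inv (h : SL(2, ℝ)) :
    (symSquare h).1 - (symSquare h)⁻¹.1 = h.1.trace • skewPart h.1 := by
  rw [← map_inv]
  change symSquareMatrix h.1 - symSquareMatrix (h⁻¹).1 = _
  rw [Matrix.SpecialLinearGroup.coe_inv, Matrix.adjugate_fin_two, Matrix.trace_fin_two]
  ext i j
  fin_cases i <;> fin_cases j <;> simp [symSquareMatrix, skewPart] <;> ring

theorem trace_symSquare (h : SL(2, ℝ)) : (symSquare h).1.trace = h.1.trace ^ 2 - 1 := by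
  have hd := h.2
  rw [Matrix.det_fin_two] at hd
  change (symSquareMatrix h.1).trace = _
  rw [Matrix.trace_fin_three, Matrix.trace_fin_two]
  simp [symSquareMatrix]
  linear_combination -hd

theorem trace_ne_zero_of_symSquare {h : SL(2, ℝ)} (hp : 0 < (symSquare h).1.trace) :
    h.1.trace ≠ 0 := by
  intro e
  rw [trace_symSquare, e] at hp
  norm_num at hp

theorem skewPart_inv_mul (a c : SL(2, ℝ)) :
    skewPart (c⁻¹ * a).1 = c.1.trace • skewPart a.1 - skewPart (c * a).1 := by
  rw [Matrix.SpecialLinearGroup.coe_mul, Matrix.SpecialLinearGroup.coe_mul,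
    Matrix.SpecialLinearGroup.coe_inv, Matrix.adjugate_fin_two, Matrix.trace_fin_two]
  ext i j
  fin_cases i <;> fin_cases j <;> simp [skewPart, Matrix.mul_apply, Fin.sum_univ_two] <;> ring

theorem skewPart_inv_mul' (a c : SL(2, ℝ)) :
    skewPart (c⁻¹ * a).1 = skewPart (a * c).1 - a.1.trace • skewPart c.1 := by
  rw [Matrix.SpecialLinearGroup.coe_mul, Matrix.SpecialLinearGroup.coe_mul,
    Matrix.SpecialLinearGroup.coe_inv, Matrix.adjugate_fin_two, Matrix.trace_fin_two]
  ext i j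
  fin_cases i <;> fin_cases j <;> simp [skewPart, Matrix.mul_apply, Fin.sum_univ_two] <;> ring

theorem trace_mul_sub_trace_inv_mul (h : SL(2, ℝ)) (U : Matrix (Fin 3) (Fin 3) ℝ) :
    ((symSquare h).1 * U).trace - ((symSquare h)⁻¹.1 * U).trace =
      h.1.trace * (skewPart h.1 * U).trace := by
  rw [← Matrix.trace_sub, ← sub_mul, symSquare_sub_inv, Matrix.smul_mul, Matrix.trace_smul,
    smul_eq_mul]

/-- If a deformation of a pair in the image of `symSquare` preserves the traces of the two elements,
of their product and of the inverses, then it preserves the symmetrized trace of `a c⁻¹` to first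
order. The symmetrized traces see only the component of the deformation in `𝔰𝔩₂`, and in `SL(2, ℝ)`
one has `tr (a c⁻¹) = tr a tr c - tr (a c)`. -/
theorem hasDerivAt_symTrace_of_symSquare {A C : ℝ → PSL3} {t : ℝ} {a c : SL(2, ℝ)}
    (hA : ∀ i j, DifferentiableAt ℝ (fun s => (A s).1 i j) t)
    (hC : ∀ i j, DifferentiableAt ℝ (fun s => (C s).1 i j) t)
    (ha : A t = symSquare a) (hc : C t = symSquare c)
    (tA : ∀ s, (A s).1.trace = (A t).1.trace) (tA' : ∀ s, (A s)⁻¹.1.trace = (A t)⁻¹.1.trace)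
    (tC : ∀ s, (C s).1.trace = (C t).1.trace) (tC' : ∀ s, (C s)⁻¹.1.trace = (C t)⁻¹.1.trace)
    (tM : ∀ s, (C s * A s).1.trace = (C t * A t).1.trace)
    (tM' : ∀ s, (C s * A s)⁻¹.1.trace = (C t * A t)⁻¹.1.trace)
    (pA : 0 < (A t).1.trace) (pC : 0 < (C t).1.trace) (pM : 0 < (C t * A t).1.trace) :
    HasDerivAt (fun s => (A s * (C s)⁻¹).1.trace + (C s * (A s)⁻¹).1.trace) 0 t := by
  obtain ⟨U, hA1, hA2⟩ := exists_logDeriv hA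
  obtain ⟨V, hC1, hC2⟩ := exists_logDeriv hC
  simp only [mul_inv_rev, Matrix.SpecialLinearGroup.coe_mul] at tM tM' ⊢
  have z1 := hA1.trace_eq_zero tA
  have z2 := hA2.trace_eq_zero tA'
  have z3 := hC1.trace_eq_zero tC
  have z4 := hC2.trace_eq_zero tC'
  have z5 := (hC1.mul hA1).trace_eq_zero tM
  have z6 := (hA2.mul hC2).trace_eq_zero tM'
  have hd := (hA1.mul hC2).trace.add (hC1.mul hA2).trace
  refine hd.congr_deriv ?_
  rw [ha] at pA z1 z2 z5 z6 ⊢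
  rw [hc] at pC z3 z4 z5 z6 ⊢
  rw [ha, hc, ← map_mul] at pM
  have ta := trace_ne_zero_of_symSquare pA
  have tc := trace_ne_zero_of_symSquare pC
  have tca := trace_ne_zero_of_symSquare pM
  have tac : (a * c).1.trace = (c * a).1.trace := by
    rw [Matrix.SpecialLinearGroup.coe_mul, Matrix.trace_mul_comm, Matrix.SpecialLinearGroup.coe_mul]
  have e1 := trace_mul_sub_trace_inv_mul a U
  have e2 := trace_mul_sub_trace_inv_mul c V
  have e3 := trace_mul_sub_trace_inv_mul (c * a) U
  have e4 := trace_mul_sub_trace_inv_mul (a * c) V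
  have e5 := trace_mul_sub_trace_inv_mul (c⁻¹ * a) U
  have e6 := trace_mul_sub_trace_inv_mul (c⁻¹ * a) V
  rw [skewPart_inv_mul, sub_mul, Matrix.smul_mul, Matrix.trace_sub, Matrix.trace_smul] at e5
  rw [skewPart_inv_mul', sub_mul, Matrix.smul_mul, Matrix.trace_sub, Matrix.trace_smul] at e6
  rw [tac] at e4
  simp only [map_mul, map_inv, mul_inv_rev, inv_inv, Matrix.SpecialLinearGroup.coe_mul,
    smul_eq_mul] at e3 e4 e5 e6
  simp only [Matrix.trace_add, Matrix.mul_neg, Matrix.neg_mul, Matrix.trace_neg] at z2 z4 z5 z6 ⊢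
  -- every trace below is brought to the form `tr (g * U)` or `tr (g * V)`
  generalize (symSquare a).1 = Sa at *
  generalize (symSquare a)⁻¹.1 = Sa' at *
  generalize (symSquare c).1 = Sc at *
  generalize (symSquare c)⁻¹.1 = Sc' at *
  have cyc : ∀ M N : Matrix (Fin 3) (Fin 3) ℝ, ∀ W, (M * W * N).trace = (N * M * W).trace :=
    fun M N W => by rw [Matrix.trace_mul_comm, ← mul_assoc]
  rw [Matrix.trace_mul_comm] at z2 z4
  rw [cyc, ← mul_assoc] at z5
  rw [mul_assoc U, Matrix.trace_mul_comm U, ← mul_assoc, cyc Sa' Sc' V] at z6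
  rw [← mul_assoc, ← mul_assoc, cyc Sa Sc' U, cyc Sa Sc' V, cyc Sc Sa' V, cyc Sc Sa' U]
  have f1 : (skewPart a.1 * U).trace = 0 := by
    apply (mul_eq_zero.mp _).resolve_left ta
    linarith
  have f2 : (skewPart c.1 * V).trace = 0 := by
    apply (mul_eq_zero.mp _).resolve_left tc
    linarith
  have f3 : (skewPart (c * a).1 * U).trace + (skewPart (a * c).1 * V).trace = 0 := by
    apply (mul_eq_zero.mp _).resolve_left tca
    rw [mul_add, Matrix.SpecialLinearGroup.coe_mul, Matrix.SpecialLinearGroup.coe_mul]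
    linarith
  simp only [Matrix.SpecialLinearGroup.coe_mul] at f3
  rw [f1] at e5
  rw [f2] at e6
  linear_combination e5 - e6 - (c⁻¹ * a).1.trace * f3

end PairOfPants

end

noncomputable section
namespace PairOfPants

open scoped InnerProductSpace

theorem trace_matA (y : Fin 8 → ℝ) :
    (matA y).trace = y 6 * y 7 + y 0 * y 3 + y 0 * y 1 * y 2 * y 3 := by
  rw [Matrix.trace_fin_three]
  simp [matA]

theorem trace_matC (y : Fin 8 → ℝ) :
    (matC y).trace = y 0 * y 1 * y 4 * y 5 + y 1 * y 4 + y 6 * y 7 := by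
  rw [Matrix.trace_fin_three]
  simp [matC]

theorem trace_matC_mul_matA (y : Fin 8 → ℝ) :
    (matC y * matA y).trace = y 0 * y 1 * y 2 * y 3 * y 4 * y 5 + y 0 * y 1 * y 6 * y 7 +
      y 0 * y 1 * y 3 * y 4 * y 6 * y 7 := by
  rw [Matrix.trace_fin_three]
  simp [matA, matC, Matrix.mul_apply, Fin.sum_univ_three]
  ring

theorem trace_adjugate_matA (y : Fin 8 → ℝ) :
    (matA y).adjugate.trace = y 6 * y 7 * (y 0 * y 3) + y 6 * y 7 * (y 0 * y 1 * y 2 * y 3) +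
      y 0 * y 3 * (y 0 * y 1 * y 2 * y 3) := by
  rw [Matrix.adjugate_fin_three, Matrix.trace_fin_three]
  simp [matA]
  ring

theorem trace_adjugate_matC (y : Fin 8 → ℝ) :
    (matC y).adjugate.trace = y 6 * y 7 * (y 1 * y 4) + y 6 * y 7 * (y 0 * y 1 * y 4 * y 5) +
      y 1 * y 4 * (y 0 * y 1 * y 4 * y 5) := by
  rw [Matrix.adjugate_fin_three, Matrix.trace_fin_three]
  simp [matC]
  ring

theorem trace_adjugate_matA_mul_adjugate_matC (y : Fin 8 → ℝ) :
    ((matA y).adjugate * (matC y).adjugate).trace =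
      y 0 * y 1 * y 2 * y 3 * y 4 * y 5 * (y 0 * y 1 * y 6 * y 7) +
      y 0 * y 1 * y 2 * y 3 * y 4 * y 5 * (y 0 * y 1 * y 3 * y 4 * y 6 * y 7) +
      y 0 * y 1 * y 6 * y 7 * (y 0 * y 1 * y 3 * y 4 * y 6 * y 7) := by
  rw [Matrix.adjugate_fin_three, Matrix.adjugate_fin_three, Matrix.trace_fin_three]
  simp [matA, matC, Matrix.mul_apply, Fin.sum_univ_three]
  ring

theorem coe_scaled_inv {M : Matrix (Fin 3) (Fin 3) ℝ} (h : 0 < M.det) :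
    (scaled M h)⁻¹.1 = cbrtInv M.det ^ 2 • M.adjugate := by
  rw [Matrix.SpecialLinearGroup.coe_inv]
  change (cbrtInv M.det • M).adjugate = _
  rw [Matrix.adjugate_smul, Fintype.card_fin]

theorem coe_holA {y : Fin 8 → ℝ} (hy : y ∈ orthant) :
    (holA hy).1 = cbrtInv (matA y).det • matA y := rfl

theorem coe_holC {y : Fin 8 → ℝ} (hy : y ∈ orthant) :
    (holC hy).1 = cbrtInv (matC y).det • matC y := rfl

theorem coe_holC_mul_holA {y : Fin 8 → ℝ} (hy : y ∈ orthant) :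
    (holC hy * holA hy).1 =
      (cbrtInv (matC y).det * cbrtInv (matA y).det) • (matC y * matA y) := by
  rw [Matrix.SpecialLinearGroup.coe_mul, coe_holA, coe_holC, Matrix.smul_mul, Matrix.mul_smul,
    smul_smul]

theorem coe_holC_mul_holA_inv {y : Fin 8 → ℝ} (hy : y ∈ orthant) :
    (holC hy * holA hy)⁻¹.1 = (cbrtInv (matA y).det ^ 2 * cbrtInv (matC y).det ^ 2) •
      ((matA y).adjugate * (matC y).adjugate) := by
  rw [mul_inv_rev, Matrix.SpecialLinearGroup.coe_mul, holA, holC, coe_scaled_inv, coe_scaled_inv,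
    Matrix.smul_mul, Matrix.mul_smul, smul_smul]

theorem trace_holA_leafMove (x : FramedConvex) (z : ℂ) :
    (holA (coord_mem (leafMove x z))).1.trace = (holA (coord_mem x)).1.trace := by
  have e1 := (Real.exp_pos z.re).ne'
  have e2 := (Real.exp_pos z.im).ne'
  rw [coe_holA, coe_holA, Matrix.trace_smul, Matrix.trace_smul, coord_leafMove, det_matA_leafPt,
    trace_matA, trace_matA]
  congr 1
  simp [leafPt, weight, Complex.inner, Real.exp_neg]
  field_simp

theorem trace_holA_inv_leafMove (x : FramedConvex) (z : ℂ) :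
    (holA (coord_mem (leafMove x z)))⁻¹.1.trace = (holA (coord_mem x))⁻¹.1.trace := by
  have e1 := (Real.exp_pos z.re).ne'
  have e2 := (Real.exp_pos z.im).ne'
  rw [holA, holA, coe_scaled_inv, coe_scaled_inv, Matrix.trace_smul, Matrix.trace_smul,
    coord_leafMove, det_matA_leafPt, trace_adjugate_matA, trace_adjugate_matA]
  congr 1
  simp [leafPt, weight, Complex.inner, Real.exp_neg]
  field_simp

theorem trace_holC_leafMove (x : FramedConvex) (z : ℂ) :
    (holC (coord_mem (leafMove x z))).1.trace = (holC (coord_mem x)).1.trace := by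
  have e1 := (Real.exp_pos z.re).ne'
  have e2 := (Real.exp_pos z.im).ne'
  rw [coe_holC, coe_holC, Matrix.trace_smul, Matrix.trace_smul, coord_leafMove, det_matC_leafPt,
    trace_matC, trace_matC]
  congr 1
  simp [leafPt, weight, Complex.inner, Real.exp_neg]
  field_simp

theorem trace_holC_inv_leafMove (x : FramedConvex) (z : ℂ) :
    (holC (coord_mem (leafMove x z)))⁻¹.1.trace = (holC (coord_mem x))⁻¹.1.trace := by
  have e1 := (Real.exp_pos z.re).ne'
  have e2 := (Real.exp_pos z.im).ne'
  rw [holC, holC, coe_scaled_inv, coe_scaled_inv, Matrix.trace_smul, Matrix.trace_smul,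
    coord_leafMove, det_matC_leafPt, trace_adjugate_matC, trace_adjugate_matC]
  congr 1
  simp [leafPt, weight, Complex.inner, Real.exp_neg]
  field_simp

theorem trace_holC_mul_holA_leafMove (x : FramedConvex) (z : ℂ) :
    (holC (coord_mem (leafMove x z)) * holA (coord_mem (leafMove x z))).1.trace =
      (holC (coord_mem x) * holA (coord_mem x)).1.trace := by
  have e1 := (Real.exp_pos z.re).ne'
  have e2 := (Real.exp_pos z.im).ne'
  rw [coe_holC_mul_holA, coe_holC_mul_holA, Matrix.trace_smul, Matrix.trace_smul, coord_leafMove,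
    det_matA_leafPt, det_matC_leafPt, trace_matC_mul_matA, trace_matC_mul_matA]
  congr 1
  simp [leafPt, weight, Complex.inner, Real.exp_neg]
  field_simp

theorem trace_holC_mul_holA_inv_leafMove (x : FramedConvex) (z : ℂ) :
    (holC (coord_mem (leafMove x z)) * holA (coord_mem (leafMove x z)))⁻¹.1.trace =
      (holC (coord_mem x) * holA (coord_mem x))⁻¹.1.trace := by
  have e1 := (Real.exp_pos z.re).ne'
  have e2 := (Real.exp_pos z.im).ne'
  rw [coe_holC_mul_holA_inv, coe_holC_mul_holA_inv, Matrix.trace_smul, Matrix.trace_smul,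
    coord_leafMove, det_matA_leafPt, det_matC_leafPt, trace_adjugate_matA_mul_adjugate_matC,
    trace_adjugate_matA_mul_adjugate_matC]
  congr 1
  simp [leafPt, weight, Complex.inner, Real.exp_neg]
  field_simp

theorem differentiable_holA_leafMove (x : FramedConvex) (v : ℂ) (i j : Fin 3) :
    Differentiable ℝ fun s : ℝ => (holA (coord_mem (leafMove x (s • v)))).1 i j := by
  simp only [coe_holA, coord_leafMove, det_matA_leafPt]
  have h : ∀ k, Differentiable ℝ fun s : ℝ => leafPt (coord x) (s • v) k := fun k => by
    simp only [leafPt, inner_smul_right]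
    fun_prop
  have h0 := h 0; have h1 := h 1; have h2 := h 2; have h3 := h 3
  have h6 := h 6; have h7 := h 7
  fin_cases i <;> fin_cases j <;> simp [matA] <;> fun_prop

theorem differentiable_holC_leafMove (x : FramedConvex) (v : ℂ) (i j : Fin 3) :
    Differentiable ℝ fun s : ℝ => (holC (coord_mem (leafMove x (s • v)))).1 i j := by
  simp only [coe_holC, coord_leafMove, det_matC_leafPt]
  have h : ∀ k, Differentiable ℝ fun s : ℝ => leafPt (coord x) (s • v) k := fun k => by
    simp only [leafPt, inner_smul_right]
    fun_prop
  have h0 := h 0; have h1 := h 1; have h4 := h 4; have h5 := h 5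
  have h6 := h 6; have h7 := h 7
  fin_cases i <;> fin_cases j <;> simp [matC] <;> fun_prop

theorem trace_conj (g h : PSL3) : (g⁻¹ * h * g).1.trace = h.1.trace := by
  rw [Matrix.SpecialLinearGroup.coe_mul, Matrix.trace_mul_comm,
    ← Matrix.SpecialLinearGroup.coe_mul]
  exact congrArg (fun x : PSL3 => x.1.trace) (mul_inv_cancel_left g h)

theorem differentiableAt_conj {A : ℝ → PSL3} {t : ℝ}
    (h : ∀ i j, DifferentiableAt ℝ (fun s => (A s).1 i j) t) (g : PSL3) (i j : Fin 3) :
    DifferentiableAt ℝ (fun s => (g⁻¹ * A s * g).1 i j) t := by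
  simp only [Matrix.SpecialLinearGroup.coe_mul, Matrix.mul_apply]
  fun_prop

/-- The holonomies of a hyperbolic structure are simultaneously conjugate into the image of
`symSquare`. -/
theorem IsHyperbolic.exists_conj {x : FramedConvex} (h : IsHyperbolic x) :
    ∃ (g : PSL3) (a c : SL(2, ℝ)), g⁻¹ * holA (coord_mem x) * g = symSquare a ∧
      g⁻¹ * holC (coord_mem x) * g = symSquare c := by
  obtain ⟨R, hR, ρ₀, hρ⟩ := h
  have hc : R.coord = coord x := congrArg FramedClass.coord hR
  obtain ⟨g, hg⟩ := FramedRep.exists_smul_eq_normalForm (R := R) (hc ▸ coord_mem x)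
  have hg : g • R = normalForm (coord_mem x) := by
    rw [hg]
    congr 1
  obtain ⟨a, ha⟩ := QuotientGroup.mk_surjective (ρ₀ curveα)
  obtain ⟨c, hc⟩ := QuotientGroup.mk_surjective (ρ₀ curveγ)
  have hα : (normalForm (coord_mem x)).ρ curveα = holA (coord_mem x) := repOf_α _ _
  have hγ : (normalForm (coord_mem x)).ρ curveγ = holC (coord_mem x) := repOf_γ _ _
  have e : ∀ w, (g • R).ρ w = g * R.ρ w * g⁻¹ := fun w => rfl
  have key : ∀ (w : Pi1) (b : SL(2, ℝ)), (b : PSL2) = ρ₀ w → g⁻¹ * (g • R).ρ w * g = symSquare b := by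
    intro w b hb
    rw [e, hρ, MonoidHom.comp_apply, ← hb]
    change g⁻¹ * (g * symSquare b * g⁻¹) * g = symSquare b
    group
  refine ⟨g, a, c, ?_, ?_⟩
  · rw [← hα, ← hg]
    exact key _ _ ha
  · rw [← hγ, ← hg]
    exact key _ _ hc

theorem IsHyperbolic.leafGrad_eq_zero {x : FramedConvex} (h : IsHyperbolic x) :
    leafGrad symTrace x = 0 := by
  obtain ⟨g, a, c, ha, hc⟩ := h.exists_conj
  have hp := coord_pos x
  have h0 := hp 0; have h1 := hp 1; have h2 := hp 2; have h3 := hp 3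
  have h4 := hp 4; have h5 := hp 5; have h6 := hp 6; have h7 := hp 7
  have kA := cbrtInv_pos (det_matA_pos (coord_mem x))
  have kC := cbrtInv_pos (det_matC_pos (coord_mem x))
  apply ext_inner_right ℝ
  intro v
  rw [inner_zero_left]
  have hA := fun i j => (differentiable_holA_leafMove x v i j) 0
  have hC := fun i j => (differentiable_holC_leafMove x v i j) 0
  have cm : ∀ p q : PSL3, g⁻¹ * p * g * (g⁻¹ * q * g) = g⁻¹ * (p * q) * g := fun p q => by group
  have ci : ∀ p : PSL3, (g⁻¹ * p * g)⁻¹ = g⁻¹ * p⁻¹ * g := fun p => by group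
  have z0 : leafMove x ((0 : ℝ) • v) = x := by rw [zero_smul, leafMove_zero]
  have hz : ∀ f : FramedConvex → PSL3, f (leafMove x ((0 : ℝ) • v)) = f x := fun f => by rw [z0]
  have hd := hasDerivAt_symTrace_of_symSquare (t := 0) (a := a) (c := c)
    (differentiableAt_conj hA g) (differentiableAt_conj hC g)
    ((hz fun y => g⁻¹ * holA (coord_mem y) * g).trans ha)
    ((hz fun y => g⁻¹ * holC (coord_mem y) * g).trans hc)
    (fun s => by simp only [trace_conj, trace_holA_leafMove])
    (fun s => by simp only [ci, trace_conj, trace_holA_inv_leafMove])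
    (fun s => by simp only [trace_conj, trace_holC_leafMove])
    (fun s => by simp only [ci, trace_conj, trace_holC_inv_leafMove])
    (fun s => by simp only [cm, trace_conj, trace_holC_mul_holA_leafMove])
    (fun s => by simp only [cm, ci, trace_conj, trace_holC_mul_holA_inv_leafMove])
    (by
      rw [trace_conj, trace_holA_leafMove, coe_holA, Matrix.trace_smul, trace_matA, smul_eq_mul]
      positivity)
    (by
      rw [trace_conj, trace_holC_leafMove, coe_holC, Matrix.trace_smul, trace_matC, smul_eq_mul]
      positivity)
    (by
      rw [cm, trace_conj, trace_holC_mul_holA_leafMove, coe_holC_mul_holA, Matrix.trace_smul,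
        trace_matC_mul_matA, smul_eq_mul]
      positivity)
  simp only [ci, cm, trace_conj, ← symTrace_eq_trace] at hd
  have hl : HasDerivAt (fun s : ℝ => s • v) v 0 := by
    simpa using (hasDerivAt_id (0 : ℝ)).smul_const v
  have hf := leafMove_hasFDerivAt x ((0 : ℝ) • v) (differentiableAt_inChart_symTrace _)
  have hf' := hf.comp_hasDerivAt (0 : ℝ) hl
  rw [z0] at hf'
  exact hf'.unique hd

end PairOfPants

end

noncomputable section
namespace PairOfPants

/-! ### Tangent framings -/

/-- The point of the invariant conic with the parameter `(s, t)`. -/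
def conicPt (s t : ℝ) : Fin 3 → ℝ := ![s ^ 2, s * t, t ^ 2]

/-- The tangent of the invariant conic at the point with the parameter `(s, t)`. -/
def conicLn (s t : ℝ) : Fin 3 → ℝ := ![t ^ 2, -2 * s * t, s ^ 2]

/-- The flag `F` is the tangent flag of the conic at the parameter `(s, t)`. -/
def Flag.TangentAt (F : Flag) (s t : ℝ) : Prop := F.RepPt (conicPt s t) ∧ F.RepLn (conicLn s t)

theorem Flag.IsTangent.exists_tangentAt {F : Flag} (h : F.IsTangent) : ∃ s t, F.TangentAt s t := by
  obtain ⟨s, t, hp, hl, e, e'⟩ := h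
  refine ⟨s, t, ?_, ?_⟩
  · obtain ⟨a, ha, h⟩ := RP2.rep_mk _ hp
    exact ⟨a, ha, e ▸ h⟩
  · obtain ⟨a, ha, h⟩ := RP2.rep_mk _ hl
    exact ⟨a, ha, e' ▸ h⟩

theorem Flag.TangentAt.isTangent {F : Flag} {s t : ℝ} (h : F.TangentAt s t) : F.IsTangent := by
  obtain ⟨⟨a, ha, hp⟩, b, hb, hl⟩ := h
  have np : conicPt s t ≠ 0 := fun e => F.point.rep_nonzero (by rw [hp, e, smul_zero])
  have nl : conicLn s t ≠ 0 := fun e => F.line.rep_nonzero (by rw [hl, e, smul_zero])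
  obtain ⟨c, hc, hp'⟩ := RP2.rep_mk _ np
  obtain ⟨d, hd, hl'⟩ := RP2.rep_mk _ nl
  exact ⟨s, t, np, nl, RP2.eq_of_rep hc hp hp', RP2.eq_of_rep hd hl hl'⟩

theorem irrep_mk (g : SL(2, ℝ)) : irrep (g : PSL2) = symSquare g := rfl

/-- The irreducible representation preserves the tangent flags of the conic. -/
theorem Flag.TangentAt.irrep_smul {F : Flag} {s t : ℝ} (h : F.TangentAt s t) (g : PSL2) :
    ∃ s' t', (irrep g • F).TangentAt s' t' := by
  obtain ⟨g, rfl⟩ := QuotientGroup.mk_surjective g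
  have hd := g.2
  rw [Matrix.det_fin_two] at hd
  refine ⟨g.1 0 0 * s + g.1 0 1 * t, g.1 1 0 * s + g.1 1 1 * t, ?_, ?_⟩
  · refine h.1.smul _ one_ne_zero ?_
    rw [one_smul]
    change symSquareMatrix g.1 *ᵥ _ = _
    ext i
    fin_cases i <;> simp [symSquareMatrix, conicPt, Matrix.mulVec, dotProduct,
      Fin.sum_univ_three] <;> ring
  · refine h.2.smul _ one_ne_zero ?_
    have e : ∀ u v : ℝ, (conicLn u v) = (g.1 0 0 * g.1 1 1 - g.1 0 1 * g.1 1 0) ^ 2 • conicLn u v :=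
      fun u v => by rw [hd, one_pow, one_smul]
    rw [one_smul, e s t]
    change _ ᵥ* symSquareMatrix g.1 = _
    ext i
    fin_cases i <;> simp [symSquareMatrix, conicLn, Matrix.vecMul, dotProduct,
      Fin.sum_univ_three] <;> ring

theorem conicLn_dotProduct (s t u v : ℝ) : conicLn s t ⬝ᵥ conicPt u v = (s * v - u * t) ^ 2 := by
  simp [conicLn, conicPt, dotProduct, Fin.sum_univ_three]
  ring

theorem lineThrough_conicPt (s₁ t₁ s₂ t₂ s₃ t₃ : ℝ) :
    lineThrough (conicPt s₁ t₁) (conicPt s₂ t₂) (conicPt s₃ t₃) =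
      (s₁ * t₂ - s₂ * t₁) * (s₂ * t₃ - s₃ * t₂) * (s₁ * t₃ - s₃ * t₁) := by
  simp [lineThrough, conicPt, Matrix.det_fin_three]
  ring

/-- For tangent flags all factors are products of the determinants `sᵢ tⱼ - sⱼ tᵢ`, and both cross
ratios reduce to the same quotient of them. -/
theorem cr_eq_of_tangentAt {F₁ F₂ F₃ F₄ : Flag} {s₁ t₁ s₂ t₂ s₃ t₃ s₄ t₄ : ℝ}
    (h₁ : F₁.TangentAt s₁ t₁) (h₂ : F₂.TangentAt s₂ t₂) (h₃ : F₃.TangentAt s₃ t₃)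
    (h₄ : F₄.TangentAt s₄ t₄) (h : 0 < cr₁ F₁ F₂ F₃ F₄) : cr₂ F₁ F₂ F₃ F₄ = cr₁ F₁ F₂ F₃ F₄ := by
  rw [cr₁_eq h₁.1 h₂.1 h₃.1 h₄.1 h₁.2] at h ⊢
  rw [cr₂_eq h₁.1 h₂.1 h₃.1 h₄.1 h₃.2]
  simp only [conicLn_dotProduct, lineThrough_conicPt] at h ⊢
  generalize s₁ * t₂ - s₂ * t₁ = x at *
  generalize s₁ * t₃ - s₃ * t₁ = y at *
  generalize s₁ * t₄ - s₄ * t₁ = z at *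
  generalize s₃ * t₂ - s₂ * t₃ = u at *
  generalize s₃ * t₄ - s₄ * t₃ = v at *
  have hx : x ≠ 0 := by rintro rfl; simp at h
  have hy : y ≠ 0 := by rintro rfl; simp at h
  have hz : z ≠ 0 := by rintro rfl; simp at h
  have hu : u ≠ 0 := by rintro rfl; simp at h
  have hv : v ≠ 0 := by rintro rfl; simp at h
  field_simp

theorem tripleRatio_eq_one_of_tangentAt {F₁ F₂ F₃ : Flag} {s₁ t₁ s₂ t₂ s₃ t₃ : ℝ}
    (h₁ : F₁.TangentAt s₁ t₁) (h₂ : F₂.TangentAt s₂ t₂) (h₃ : F₃.TangentAt s₃ t₃)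
    (h : 0 < tripleRatio F₁ F₂ F₃) : tripleRatio F₁ F₂ F₃ = 1 := by
  rw [tripleRatio_eq h₁.1 h₂.1 h₃.1 h₁.2 h₂.2 h₃.2] at h ⊢
  simp only [conicLn_dotProduct] at h ⊢
  have e : (s₁ * t₂ - s₂ * t₁) ^ 2 * (s₂ * t₃ - s₃ * t₂) ^ 2 * (s₃ * t₁ - s₁ * t₃) ^ 2 =
      (s₁ * t₃ - s₃ * t₁) ^ 2 * (s₂ * t₁ - s₁ * t₂) ^ 2 * (s₃ * t₂ - s₂ * t₃) ^ 2 := by ring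
  rw [e] at h ⊢
  apply div_self
  intro e'
  simp [e'] at h

/-- The coordinate vector with `σ₁ = σ₂`, `σ₃ = σ₄`, `σ₅ = σ₆` and `τ₁ = τ₂ = 1`. -/
def tangentCoord (x y z : ℝ) : Fin 8 → ℝ := ![x, x, y, y, z, z, 1, 1]

theorem FramedRep.coord_eq_tangentCoord {R : FramedRep} (hR : ∀ i, 0 < R.coord i)
    (hF : ∀ i, ∃ s t, (R.flag i).TangentAt s t)
    (hρ : ∀ w F, (∃ s t, Flag.TangentAt F s t) → ∃ s t, (R.ρ w • F).TangentAt s t) :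
    ∃ x y z : ℝ, R.coord = tangentCoord x y z := by
  have h₀' := hρ curveγ _ (hF 0)
  have h₁' := hρ curveα _ (hF 1)
  have h₂' := hρ curveβ _ (hF 2)
  have p1 := hR 1
  have p3 := hR 3
  have p5 := hR 5
  have p6 := hR 6
  have p7 := hR 7
  simp only [FramedRep.coord, Matrix.cons_val] at p1 p3 p5 p6 p7 ⊢
  obtain ⟨s₀, t₀, h₀⟩ := hF 0
  obtain ⟨s₁, t₁, h₁⟩ := hF 1
  obtain ⟨s₂, t₂, h₂⟩ := hF 2
  obtain ⟨s₀', t₀', h₀'⟩ := h₀'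
  obtain ⟨s₁', t₁', h₁'⟩ := h₁'
  obtain ⟨s₂', t₂', h₂'⟩ := h₂'
  rw [cr_eq_of_tangentAt h₀ h₁' h₂ h₁ p1, cr_eq_of_tangentAt h₁ h₂' h₀ h₂ p3,
    cr_eq_of_tangentAt h₂ h₀' h₁ h₀ p5, tripleRatio_eq_one_of_tangentAt h₀ h₂ h₁ p6,
    tripleRatio_eq_one_of_tangentAt h₂ h₀' h₁ p7]
  exact ⟨_, _, _, rfl⟩

theorem IsTangentHyperbolic.exists_coord {q : FramedConvex} (h : IsTangentHyperbolic q) :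
    ∃ x y z : ℝ, coord q = tangentCoord x y z := by
  obtain ⟨R, hR, ⟨ρ₀, hρ⟩, hF⟩ := h
  have hc : coord q = R.coord := (congrArg FramedClass.coord hR).symm
  rw [hc]
  refine FramedRep.coord_eq_tangentCoord (fun i => hc ▸ coord_pos q i)
    (fun i => (hF i).exists_tangentAt) ?_
  rintro w F ⟨s, t, h⟩
  rw [hρ]
  exact h.irrep_smul (ρ₀ w)

theorem casimirs_of_tangentCoord {q : FramedConvex} {x y z : ℝ}
    (h : coord q = tangentCoord x y z) :
    casimirs q = fuchsianLengths (x * y) (y * z) (x * z) := by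
  simp only [casimirs, h, tangentCoord, fuchsianLengths]
  ext i
  fin_cases i <;> simp

theorem tangentCoord_mem {x y z : ℝ} (hx : 0 < x) (hy : 0 < y) (hz : 0 < z) :
    tangentCoord x y z ∈ orthant := by
  intro i
  fin_cases i
  exacts [hx, hx, hy, hy, hz, hz, one_pos, one_pos]

/-- The matrix of determinant one that is a positive multiple of a given one. -/
def scaledTwo (M : Matrix (Fin 2) (Fin 2) ℝ) (h : 0 < M.det) : SL(2, ℝ) :=
  ⟨(√M.det)⁻¹ • M, by
    rw [Matrix.det_smul, Fintype.card_fin, inv_pow, Real.sq_sqrt h.le, inv_mul_cancel₀ h.ne']⟩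

theorem symSquare_scaledTwo {M : Matrix (Fin 2) (Fin 2) ℝ} {N : Matrix (Fin 3) (Fin 3) ℝ}
    (e : N = symSquareMatrix M) (h : 0 < M.det) (h' : 0 < N.det) :
    symSquare (scaledTwo M h) = scaled N h' := by
  apply eq_scaled h' (k := (√M.det)⁻¹ ^ 2)
  rw [e]
  change symSquareMatrix ((√M.det)⁻¹ • M) = _
  ext i j
  fin_cases i <;> fin_cases j <;> simp [symSquareMatrix] <;> ring

/-- The points with `σ₁ = σ₂`, `σ₃ = σ₄`, `σ₅ = σ₆` and `τ₁ = τ₂ = 1` are tangentially framed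
hyperbolic structures, since the matrices of their normal forms are symmetric squares. -/
theorem isTangentHyperbolic_ofCoord {x y z : ℝ} (hx : 0 < x) (hy : 0 < y) (hz : 0 < z) :
    IsTangentHyperbolic (ofCoord (tangentCoord_mem hx hy hz)) := by
  have hm := tangentCoord_mem hx hy hz
  have t0 : tangentCoord x y z 0 = x := rfl
  have t1 : tangentCoord x y z 1 = x := rfl
  have t2 : tangentCoord x y z 2 = y := rfl
  have t3 : tangentCoord x y z 3 = y := rfl
  have t4 : tangentCoord x y z 4 = z := rfl
  have t5 : tangentCoord x y z 5 = z := rfl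
  have t6 : tangentCoord x y z 6 = 1 := rfl
  have t7 : tangentCoord x y z 7 = 1 := rfl
  have eA : matA (tangentCoord x y z) = symSquareMatrix !![1, 1 + y; 0, x * y] := by
    ext i j
    fin_cases i <;> fin_cases j <;> simp [matA, t0, t1, t2, t3, t6, t7, symSquareMatrix] <;> ring
  have eC : matC (tangentCoord x y z) = symSquareMatrix !![x * z, 0; -(x * (1 + z)), 1] := by
    ext i j
    fin_cases i <;> fin_cases j <;> simp [matC, t0, t1, t4, t5, t6, t7, symSquareMatrix] <;> ring
  have dA : 0 < (!![1, 1 + y; 0, x * y] : Matrix (Fin 2) (Fin 2) ℝ).det := by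
    rw [Matrix.det_fin_two]
    simp
    positivity
  have dC : 0 < (!![x * z, 0; -(x * (1 + z)), 1] : Matrix (Fin 2) (Fin 2) ℝ).det := by
    rw [Matrix.det_fin_two]
    simp
    positivity
  have hA : symSquare (scaledTwo _ dA) = holA hm := symSquare_scaledTwo eA dA (det_matA_pos hm)
  have hC : symSquare (scaledTwo _ dC) = holC hm := symSquare_scaledTwo eC dC (det_matC_pos hm)
  refine ⟨normalForm hm, rfl, ⟨repOf (scaledTwo _ dA : PSL2) (scaledTwo _ dC : PSL2), ?_⟩, ?_⟩
  · apply Pi1.hom_ext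
    · rw [MonoidHom.comp_apply, repOf_α, irrep_mk, hA]
      exact repOf_α _ _
    · rw [MonoidHom.comp_apply, repOf_γ, irrep_mk, hC]
      exact repOf_γ _ _
  · have hp := stdFlag_repPt 1
    have hl := stdFlag_repLn 1
    have hf : (normalForm hm).flag = stdFlag 1 :=
      congrArg stdFlag t6
    rw [hf]
    intro i
    fin_cases i
    · refine Flag.TangentAt.isTangent (s := 1) (t := 0) ⟨?_, ?_⟩
      · simpa [conicPt, stdPt] using hp 0
      · simpa [conicLn, stdLn] using hl 0
    · refine Flag.TangentAt.isTangent (s := 1) (t := -1) ⟨?_, ?_⟩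
      · simpa [conicPt, stdPt] using hp 1
      · simpa [conicLn, stdLn, one_add_one_eq_two] using hl 1
    · refine Flag.TangentAt.isTangent (s := 0) (t := 1) ⟨?_, ?_⟩
      · simpa [conicPt, stdPt] using hp 2
      · simpa [conicLn, stdLn] using hl 2

theorem IsTangentHyperbolic.isHyperbolic {q : FramedConvex} (h : IsTangentHyperbolic q) :
    IsHyperbolic q := by
  obtain ⟨R, hR, hρ, -⟩ := h
  exact ⟨R, hR, hρ⟩

/-- The leaf with the length vector `L(F)` contains the tangentially framed hyperbolic structure
with the boundary lengths `F`. -/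
theorem exists_isTangentHyperbolic_mem {ℓα ℓβ ℓγ : ℝ} (hα : 0 < ℓα) (hβ : 0 < ℓβ) (hγ : 0 < ℓγ) :
    ∃ q, IsTangentHyperbolic q ∧ casimirs q = fuchsianLengths ℓα ℓβ ℓγ ∧
      coord q = tangentCoord √(ℓα * ℓγ / ℓβ) √(ℓα * ℓβ / ℓγ) √(ℓβ * ℓγ / ℓα) := by
  have hx : 0 < √(ℓα * ℓγ / ℓβ) := Real.sqrt_pos.mpr (by positivity)
  have hy : 0 < √(ℓα * ℓβ / ℓγ) := Real.sqrt_pos.mpr (by positivity)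
  have hz : 0 < √(ℓβ * ℓγ / ℓα) := Real.sqrt_pos.mpr (by positivity)
  have hc := coord_ofCoord (tangentCoord_mem hx hy hz)
  refine ⟨_, isTangentHyperbolic_ofCoord hx hy hz, ?_, hc⟩
  have e1 : √(ℓα * ℓγ / ℓβ) * √(ℓα * ℓβ / ℓγ) = ℓα := by
    rw [← Real.sqrt_mul (by positivity), show ℓα * ℓγ / ℓβ * (ℓα * ℓβ / ℓγ) = ℓα ^ 2 by field_simp,
      Real.sqrt_sq hα.le]
  have e2 : √(ℓα * ℓβ / ℓγ) * √(ℓβ * ℓγ / ℓα) = ℓβ := by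
    rw [← Real.sqrt_mul (by positivity), show ℓα * ℓβ / ℓγ * (ℓβ * ℓγ / ℓα) = ℓβ ^ 2 by field_simp,
      Real.sqrt_sq hβ.le]
  have e3 : √(ℓα * ℓγ / ℓβ) * √(ℓβ * ℓγ / ℓα) = ℓγ := by
    rw [← Real.sqrt_mul (by positivity), show ℓα * ℓγ / ℓβ * (ℓβ * ℓγ / ℓα) = ℓγ ^ 2 by field_simp,
      Real.sqrt_sq hγ.le]
  rw [casimirs_of_tangentCoord hc, e1, e2, e3]

end PairOfPants

end

noncomputable section
namespace PairOfPants

/-! ### The Hamiltonian flow on a leaf -/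

open PlanarFlow

theorem isFlowLine_leafMove {x : FramedConvex} {z : ℝ → ℂ}
    (hz : IsFlow (fun z => leafGrad symTrace (leafMove x z)) z) :
    IsFlowLine symTrace fun s => leafMove x (z s) :=
  fun t => followsAt_leafMove (hz t)

theorem IsFlowLine.exists_isFlow {x : FramedConvex} {c : ℝ → FramedConvex}
    (hc : IsFlowLine symTrace c) {w : ℂ} (h0 : c 0 = leafMove x w) :
    ∃ z : ℝ → ℂ, z 0 = w ∧ IsFlow (fun z => leafGrad symTrace (leafMove x z)) z ∧
      c = fun s => leafMove x (z s) := by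
  have e : ∀ t, c t = leafMove x (w + leafParam (c 0) (c t)) := fun t => by
    rw [← leafMove_add, ← h0]
    exact eq_leafMove_of_follows convex_univ (fun t _ => hc t) (Set.mem_univ 0) (Set.mem_univ t)
  refine ⟨fun t => w + leafParam (c 0) (c t), by simp [leafParam_self], fun t => ?_, funext e⟩
  beta_reduce
  rw [← e t]
  exact (hasDerivAt_leafParam (hc t) (c 0)).const_add w

theorem isFixedPoint_iff (q : FramedConvex) :
    IsFixedPoint symTrace q ↔ leafGrad symTrace q = 0 := by
  constructor
  · intro h
    have := (hasDerivAt_leafParam (h 0) q).unique (hasDerivAt_const (0 : ℝ) (leafParam q q))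
    simpa using this
  · intro h t
    have h0 : HasDerivAt (fun _ : ℝ => (0 : ℂ))
        (-2 * Complex.I * leafGrad symTrace (leafMove q 0)) t := by
      rw [leafMove_zero, h, mul_zero]
      exact hasDerivAt_const _ _
    have := followsAt_leafMove h0
    rwa [leafMove_zero] at this

end PairOfPants

end

open PairOfPants
theorem theoremC :
    (∀ Q : Set FramedConvex, IsSymplecticLeaf Q → ∃ p ∈ Q,
      -- the symmetrized trace attains a unique minimum on `Q`, at `p`
      (∀ q ∈ Q, q ≠ p → symTrace p < symTrace q) ∧
      -- `p` is the unique fixed point of the Hamiltonian flow on `Q`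
      (∀ q ∈ Q, IsFixedPoint symTrace q ↔ q = p) ∧
      -- through each point of `Q` there is exactly one flow line; it stays in `Q` and is periodic
      (∀ q ∈ Q, ∃ c : ℝ → FramedConvex, IsFlowLine symTrace c ∧ c 0 = q ∧ (∀ t, c t ∈ Q) ∧
        (∃ T : ℝ, 0 < T ∧ Function.Periodic c T) ∧
        ∀ c' : ℝ → FramedConvex, IsFlowLine symTrace c' → c' 0 = q → c' = c) ∧
      -- if `Q` contains a hyperbolic structure, then `p` is the unique one
      ((∃ h ∈ Q, IsHyperbolic h) → ∀ q ∈ Q, IsHyperbolic q ↔ q = p) ∧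
      -- a leaf that contains a hyperbolic structure framed by tangent flags is one of the `Q_{L(F)}`
      ((∃ h ∈ Q, IsTangentHyperbolic h) → ∃ ℓα ℓβ ℓγ : ℝ, 0 < ℓα ∧ 0 < ℓβ ∧ 0 < ℓγ ∧
        Q = leafOf (fuchsianLengths ℓα ℓβ ℓγ)) ∧
      -- on `Q_{L(F)}` the point `p` is hyperbolic, and its coordinates are as follows
      (∀ ℓα ℓβ ℓγ : ℝ, 0 < ℓα → 0 < ℓβ → 0 < ℓγ → Q = leafOf (fuchsianLengths ℓα ℓβ ℓγ) →
        IsTangentHyperbolic p ∧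
        coord p = ![√(ℓα * ℓγ / ℓβ), √(ℓα * ℓγ / ℓβ), √(ℓα * ℓβ / ℓγ), √(ℓα * ℓβ / ℓγ),
          √(ℓβ * ℓγ / ℓα), √(ℓβ * ℓγ / ℓα), 1, 1])) ∧
    -- the sets `Q_{L(F)}` are symplectic leaves
    (∀ ℓα ℓβ ℓγ : ℝ, 0 < ℓα → 0 < ℓβ → 0 < ℓγ →
      IsSymplecticLeaf (leafOf (fuchsianLengths ℓα ℓβ ℓγ))) := by
  refine ⟨fun Q hQ => ?_, fun ℓα ℓβ ℓγ hα hβ hγ => ?_⟩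
  · obtain ⟨x, rfl⟩ := isSymplecticLeaf_iff.mp hQ
    have H := convexEnergy_symTrace x
    obtain ⟨w₀, hw₀⟩ := H.exists_grad_eq_zero
    -- the minimum is the only critical point on the leaf
    have crit : ∀ q ∈ Set.range (leafMove x), leafGrad symTrace q = 0 → q = leafMove x w₀ := by
      rintro _ ⟨w, rfl⟩ hw
      rw [H.eq_of_grad_eq_zero hw₀ hw]
    have hyp : ∀ q ∈ Set.range (leafMove x), IsHyperbolic q → q = leafMove x w₀ :=
      fun q hq h => crit q hq h.leafGrad_eq_zero
    refine ⟨leafMove x w₀, ⟨w₀, rfl⟩, ?_, ?_, ?_, ?_, ?_, ?_⟩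
    · rintro _ ⟨w, rfl⟩ hne
      exact H.lt_of_ne hw₀ fun e => hne (congrArg _ e)
    · intro q hq
      rw [isFixedPoint_iff]
      exact ⟨crit q hq, fun e => e ▸ hw₀⟩
    · rintro _ ⟨w, rfl⟩
      obtain ⟨z, hz0, hz⟩ := H.exists_flow w
      obtain ⟨T, hT, hper⟩ := H.flow_periodic hz
      refine ⟨fun s => leafMove x (z s), isFlowLine_leafMove hz, congrArg _ hz0,
        fun t => ⟨z t, rfl⟩, ⟨T, hT, fun t => congrArg (leafMove x) (hper t)⟩, ?_⟩
      intro c' hc' h0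
      obtain ⟨z', hz0', hz', rfl⟩ := hc'.exists_isFlow h0
      rw [H.flow_unique hz' hz (hz0'.trans hz0.symm)]
    · rintro ⟨h, hQh, hh⟩ q hq
      refine ⟨hyp q hq, fun e => ?_⟩
      rw [e, ← hyp h hQh hh]
      exact hh
    · rintro ⟨_, ⟨w, rfl⟩, hh⟩
      obtain ⟨a, b, c, habc⟩ := hh.exists_coord
      have hpos := coord_pos (leafMove x w)
      rw [habc] at hpos
      have ha : 0 < a := hpos 0
      have hb : 0 < b := hpos 2
      have hc : 0 < c := hpos 4
      refine ⟨a * b, b * c, a * c, mul_pos ha hb, mul_pos hb hc, mul_pos ha hc, ?_⟩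
      rw [← casimirs_of_tangentCoord habc, casimirs_leafMove, leafOf_casimirs]
    · intro ℓα ℓβ ℓγ hα hβ hγ hL
      obtain ⟨q, hq, hcas, hcoord⟩ := exists_isTangentHyperbolic_mem hα hβ hγ
      have e := hyp q (hL ▸ hcas) hq.isHyperbolic
      rw [← e]
      exact ⟨hq, hcoord⟩
  · obtain ⟨q, -, hcas, -⟩ := exists_isTangentHyperbolic_mem hα hβ hγ
    exact isSymplecticLeaf_iff.mpr ⟨q, by rw [← hcas, leafOf_casimirs]⟩
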